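/- Let $n\ge 1$ and let $\Omega\subset\mathbb R^n$ be open. For an open set $U\subset\mathbb R^n$ put $$\mathcal F_U(u,E)=\int_U|\nabla u|^2\,dx+P_U(E),$$ where $P_U(E)=\sup\{\int_U\chi_E\,\mathrm{div}\,g\,dx : g\in C_c^\infty(U;\mathbb R^n),\ |g|\le 1\}$ is the perimeter of $E$ in $U$. Let $\mathcal A(\Omega)$ be the set of pairs $(u,E)$ with $u\in H^1(\Omega)$, $u\ge 0$ in $\Omega$, $E\subset\Omega$ measurable with $P_\Omega(E)<\infty$, and $u=0$ a.e. in $E$. A pair $(u,E)\in\mathcal A(\Omega)$ is a minimizing pair for $\mathcal F$ in $\Omega$ if $\mathcal F_\Omega(u,E)\le\mathcal F_\Omega(v,D)$ for every $(v,D)\in\mathcal A(\Omega)$ that coincides a.e. with $(u,E)$ outside some compact subset of $\Omega$. Let $(u,E)$ be a minimizing pair for $\mathcal F$ in $\Omega$, and let $B_r$ be the open ball of radius $r>0$ centred at the origin. Whenever $B_r\subset\Omega$, the energy $\mathcal F_{B_r}(u,E)$ is finite and $u$ has a trace in $L^2(\partial B_r)$, so that $$\Phi(r)=r^{1-n}\mathcal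 F_{B_r}(u,E)-\tfrac12 r^{-n}\int_{\partial B_r}u^2\,d\sigma$$ is well defined, with $u$ on $\partial B_r$ understood in the sense of traces. The function $\Phi$ is nondecreasing on $\{r>0: B_r\subset\Omega\}$. Moreover, for every $R>0$ with $B_R\subset\Omega$, $\Phi$ is constant on $(0,R]$ if and only if $(u,E)$ is a cone in $B_R$, that is, $u$ is homogeneous of degree $1/2$ and $E$ is homogeneous of degree $0$ in $B_R$: for every $t\in(0,1)$ and almost every $x\in B_R$, $u(tx)=t^{1/2}u(x)$, and $tx\in E$ if and only if $x\in E$. -/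

import Mathlib

open MeasureTheory Set Filter Metric
open scoped Topology ENNReal ContDiff

noncomputable section

namespace DirichletPerimeter

/-- The Euclidean space `ℝⁿ`. -/
abbrev Space (n : ℕ) : Type := EuclideanSpace ℝ (Fin n)

/-- `G` is the weak (distributional) gradient of `u` in the open set `U`. -/
def IsWeakGradient {n : ℕ} (U : Set (Space n)) (u : Space n → ℝ)
    (G : Space n → Space n) : Prop :=
  LocallyIntegrableOn u U volume ∧ LocallyIntegrableOn G U volume ∧
    ∀ φ : Space n → ℝ, ContDiff ℝ ∞ φ → HasCompactSupport φ → tsupport φ ⊆ U →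
      ∫ x in U, u x • gradient φ x = -∫ x in U, φ x • G x

/-- The weak gradient of `u` in `U` (unique up to null sets); `0` if there is none. -/
def weakGradient {n : ℕ} (U : Set (Space n)) (u : Space n → ℝ) : Space n → Space n :=
  open Classical in
  if h : ∃ G : Space n → Space n, IsWeakGradient U u G then h.choose else 0

/-- The Sobolev space `H¹(U)`. -/
def MemH1 {n : ℕ} (U : Set (Space n)) (u : Space n → ℝ) : Prop :=
  MemLp u 2 (volume.restrict U) ∧
    ∃ G : Space n → Space n, IsWeakGradient U u G ∧ MemLp G 2 (volume.restrict U)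

/-- The Dirichlet energy `∫_U |∇u|² dx`. -/
def dirichletEnergy {n : ℕ} (U : Set (Space n)) (u : Space n → ℝ) : ℝ≥0∞ :=
  ∫⁻ x in U, ‖weakGradient U u x‖ₑ ^ 2

/-- The divergence `div g = ∑ᵢ ∂ᵢ gᵢ` of a vector field. -/
def divergence {n : ℕ} (g : Space n → Space n) (x : Space n) : ℝ :=
  ∑ i : Fin n, fderiv ℝ g x (EuclideanSpace.single i 1) i

/-- The perimeter of `E` in `U`: the supremum of `∫_U χ_E div g dx` over smooth vector fields `g`
with compact support in `U` and `|g| ≤ 1`. -/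
def perimeter {n : ℕ} (U E : Set (Space n)) : ℝ≥0∞ :=
  ⨆ g ∈ {g : Space n → Space n | ContDiff ℝ ∞ g ∧ HasCompactSupport g ∧ tsupport g ⊆ U ∧
      ∀ x, ‖g x‖ ≤ 1},
    ENNReal.ofReal (∫ x in U, E.indicator (fun _ => (1 : ℝ)) x * divergence g x)

/-- The Dirichlet-perimeter functional `𝓕_U(u, E) = ∫_U |∇u|² dx + P_U(E)`. -/
def energy {n : ℕ} (U : Set (Space n)) (u : Space n → ℝ) (E : Set (Space n)) : ℝ≥0∞ :=
  dirichletEnergy U u + perimeter U E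

/-- The admissible class `𝓐(Ω)`. -/
structure Admissible {n : ℕ} (Ω : Set (Space n)) (u : Space n → ℝ) (E : Set (Space n)) :
    Prop where
  memH1 : MemH1 Ω u
  subset : E ⊆ Ω
  measurableSet : MeasurableSet E
  perimeter_ne_top : perimeter Ω E ≠ ⊤
  nonneg : ∀ᵐ x ∂volume.restrict Ω, 0 ≤ u x
  eq_zero : ∀ᵐ x ∂volume.restrict E, u x = 0

/-- `(u, E)` is a minimizing pair for `𝓕` in `Ω`: it is admissible and its energy does not exceed
that of any admissible pair which coincides with it (a.e.) outside a compact subset of `Ω`. -/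
def IsMinimizingPair {n : ℕ} (Ω : Set (Space n)) (u : Space n → ℝ) (E : Set (Space n)) : Prop :=
  Admissible Ω u E ∧
    ∀ (v : Space n → ℝ) (D K : Set (Space n)), Admissible Ω v D → IsCompact K → K ⊆ Ω →
      (∀ᵐ x ∂volume.restrict (Ω \ K), v x = u x ∧ (x ∈ D ↔ x ∈ E)) →
      energy Ω u E ≤ energy Ω v D

/-- The surface measure `σ` of the sphere `∂B_r` centred at the origin, as a measure on `ℝⁿ`:
the surface measure of the unit sphere, pushed forward by `θ ↦ r θ` and multiplied
by `r ^ (n - 1)`. -/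
def surfaceMeasure (n : ℕ) (r : ℝ) : Measure (Space n) :=
  ENNReal.ofReal (r ^ (n - 1)) •
    ((volume : Measure (Space n)).toSphere).map
      (fun θ : sphere (0 : Space n) 1 => r • (θ : Space n))

/-- `g ∈ L²(∂B_r)` is the trace on `∂B_r` of `u ∈ H¹(B_r)`: there are smooth functions that
converge to `u` in `H¹(B_r)` and whose restrictions to `∂B_r` converge to `g` in `L²(∂B_r)`. -/
def HasTrace {n : ℕ} (u : Space n → ℝ) (r : ℝ) (g : Space n → ℝ) : Prop :=
  MemLp g 2 (surfaceMeasure n r) ∧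
    ∃ v : ℕ → Space n → ℝ, (∀ k, ContDiff ℝ ∞ (v k)) ∧
      Tendsto (fun k => eLpNorm (fun x => v k x - u x) 2 (volume.restrict (ball 0 r)))
        atTop (𝓝 0) ∧
      Tendsto (fun k => eLpNorm (fun x => gradient (v k) x - weakGradient (ball 0 r) u x) 2
        (volume.restrict (ball 0 r))) atTop (𝓝 0) ∧
      Tendsto (fun k => eLpNorm (fun x => v k x - g x) 2 (surfaceMeasure n r)) atTop (𝓝 0)

/-- The trace of `u` on `∂B_r` (unique up to `σ`-null sets); `0` if there is none. -/
def trace {n : ℕ} (u : Space n → ℝ) (r : ℝ) : Space n → ℝ :=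
  open Classical in
  if h : ∃ g : Space n → ℝ, HasTrace u r g then h.choose else 0

/-- `Φ(r) = r^{1-n} 𝓕_{B_r}(u, E) - ½ r^{-n} ∫_{∂B_r} u² dσ`. -/
def Phi {n : ℕ} (u : Space n → ℝ) (E : Set (Space n)) (r : ℝ) : ℝ :=
  r ^ (1 - (n : ℤ)) * (energy (ball 0 r) u E).toReal
    - 1 / 2 * r ^ (-(n : ℤ)) * ∫ x, trace u r x ^ 2 ∂surfaceMeasure n r

/-- `(u, E)` is a cone in `B_R`: there `u` is homogeneous of degree `1/2` and `E` is homogeneous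
of degree `0`. Since `u` and `E` are only defined up to null sets, for every dilation factor the
relation is asked for almost every point. -/
def IsConeIn {n : ℕ} (R : ℝ) (u : Space n → ℝ) (E : Set (Space n)) : Prop :=
  ∀ t ∈ Ioo (0 : ℝ) 1,
    (∀ᵐ x ∂volume.restrict (ball (0 : Space n) R), u (t • x) = t ^ (1 / 2 : ℝ) * u x) ∧
    (∀ᵐ x ∂volume.restrict (ball (0 : Space n) R), t • x ∈ E ↔ x ∈ E)

end DirichletPerimeter

end

set_option linter.unusedSectionVars false

open MeasureTheory Set Filter Metric
open scoped Topology ENNReal ContDiff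

noncomputable section

namespace DirichletPerimeter

/-! Write `p` for the weak gradient of `u`, and `μ`, `σ` for the perimeter measure and the unit
normal of `E`. Everything rests on an exact formula (`IsRepresented.Phi_sub`): for `0 < a < b` with
`B_b ⊆ Ω` and `A = {a ≤ |x| < b}`, `Φ(b) - Φ(a) = ∫_A 2 |x|^(-n-1) (x·p - u/2)² dx + ∫_A |x|^(-n-1)
(x·σ)² dμ`. Both terms are nonnegative, hence monotonicity. `Φ` is constant on `(0, R]` exactly when
`x·p = u/2` a.e. and `x·σ = 0` `μ`-a.e. in `B_R`. These are Euler's equations for homogeneity of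
degree `1/2` of `u` and of degree `0` of the indicator of `E`, and Euler's theorem holds in the
sense of distributions (`homogeneous_iff_integral_divergence`).

Minimality enters only through two stationarity conditions, tested with a radial cutoff `η`, `∇η = κ
x`. The inner variation moves the whole pair by `x ↦ x + t η(x) x`. The outer variation replaces `u`
by `(1 + tη) u`, which keeps the sign and the zero set condition and leaves `E` alone. In their sum
(`total_variation`) the Dirichlet and the perimeter term carry the same weight `(n-1) η + κ |x|²`.
Instead of differentiating in `r`, the cutoffs are chosen so that `κ → |x|^(-n-1)` on `A` and `0`
elsewhere, while the weight tends to `b^(1-n)` on `B_b` minus `a^(1-n)` on `B_a`. The limit is the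
change of the energy term between the two radii (`energy_sub`). The change of the trace term comes
from integration along rays for smooth functions and approximation in `H¹`
(`boundary_integral_sub`). Subtracting completes the square.

The perimeter is given as a supremum. Riesz representation turns it into a finite measure with a
normal, and `P_U(E) = μ(U)` for all open `U ⊆ Ω` (`perimeter_eq`). For the dilated set only an upper
bound is needed: the Piola identity rewrites its flux as a flux of `E`, and the elementary
inequality `s ≤ (1 + s²)/2`, sharp at `s = 1`, makes the bound differentiable without loss at first
order. No fine structure of the boundary of `E` is used. -/

variable {n : ℕ}

/-! ### Test functions and test fields -/

/-- Smooth functions with compact support contained in `U`. -/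
structure IsTest {F : Type*} [NormedAddCommGroup F] [NormedSpace ℝ F] (U : Set (Space n))
    (g : Space n → F) : Prop where
  contDiff : ContDiff ℝ ∞ g
  hasCompactSupport : HasCompactSupport g
  tsupport_subset : tsupport g ⊆ U

section IsTest

variable {F F' : Type*} [NormedAddCommGroup F] [NormedSpace ℝ F]
  [NormedAddCommGroup F'] [NormedSpace ℝ F'] {U V : Set (Space n)} {g h : Space n → F}

lemma IsTest.mono (hg : IsTest U g) (hUV : U ⊆ V) : IsTest V g :=
  ⟨hg.contDiff, hg.hasCompactSupport, hg.tsupport_subset.trans hUV⟩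

lemma IsTest.of_support_subset (hg : IsTest U g) {k : Space n → F'} (hk : ContDiff ℝ ∞ k)
    (h : Function.support k ⊆ Function.support g) : IsTest U k :=
  ⟨hk, hg.hasCompactSupport.mono h, (closure_mono h).trans hg.tsupport_subset⟩

lemma IsTest.add (hg : IsTest U g) (hh : IsTest U h) : IsTest U (fun x => g x + h x) :=
  ⟨hg.contDiff.add hh.contDiff, hg.hasCompactSupport.add hh.hasCompactSupport,
    (tsupport_add g h).trans (union_subset hg.tsupport_subset hh.tsupport_subset)⟩

lemma IsTest.const_smul (hg : IsTest U g) (c : ℝ) : IsTest U (fun x => c • g x) :=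
  hg.of_support_subset (contDiff_const.smul hg.contDiff) fun x hx => by
    simp only [Function.mem_support] at hx ⊢
    exact fun h0 => hx (by simp [h0])

lemma IsTest.smul_left (hg : IsTest U g) {φ : Space n → ℝ} (hφ : ContDiff ℝ ∞ φ) :
    IsTest U (fun x => φ x • g x) :=
  hg.of_support_subset (hφ.smul hg.contDiff) fun x hx => by
    simp only [Function.mem_support] at hx ⊢
    exact fun h0 => hx (by simp [h0])

lemma IsTest.smul_right {φ : Space n → ℝ} (hφ : IsTest U φ) (hg : ContDiff ℝ ∞ g) :
    IsTest U (fun x => φ x • g x) :=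
  hφ.of_support_subset (hφ.contDiff.smul hg) fun x hx => by
    simp only [Function.mem_support] at hx ⊢
    exact fun h0 => hx (by simp [h0])

lemma IsTest.clm_comp (hg : IsTest U g) (A : F →L[ℝ] F') : IsTest U (fun x => A (g x)) :=
  hg.of_support_subset (A.contDiff.comp hg.contDiff) fun x hx => by
    simp only [Function.mem_support] at hx ⊢
    exact fun h0 => hx (by simp [h0])

lemma IsTest.comp_apply (hg : IsTest U g) {x : Space n} (hx : x ∉ U) : g x = 0 :=
  image_eq_zero_of_notMem_tsupport fun h => hx (hg.tsupport_subset h)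

lemma IsTest.fderiv_apply (hg : IsTest U g) (v : Space n) :
    IsTest U (fun x => fderiv ℝ g x v) :=
  ⟨(hg.contDiff.fderiv_right (m := ∞) (by simp)).clm_apply contDiff_const,
    (hg.hasCompactSupport.fderiv (𝕜 := ℝ)).mono fun x hx => by
      simp only [Function.mem_support] at hx ⊢
      exact fun h0 => hx (by simp [h0]),
    (closure_mono (t := tsupport g) (fun x hx => by
      apply support_fderiv_subset ℝ
      simp only [Function.mem_support] at hx ⊢
      exact fun h0 => hx (by simp [h0]))).trans
      ((isClosed_tsupport g).closure_eq.subset.trans hg.tsupport_subset)⟩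

lemma IsTest.fderiv_eq_zero (hg : IsTest U g) {x : Space n} (hx : x ∉ U) : fderiv ℝ g x = 0 := by
  by_contra h
  exact hx (hg.tsupport_subset (support_fderiv_subset ℝ h))

lemma IsTest.continuous (hg : IsTest U g) : Continuous g := hg.contDiff.continuous

lemma IsTest.differentiable (hg : IsTest U g) : Differentiable ℝ g :=
  hg.contDiff.differentiable (by simp)

lemma IsTest.bounded (hg : IsTest U g) : ∃ C, 0 ≤ C ∧ ∀ x, ‖g x‖ ≤ C := by
  obtain ⟨C, hC⟩ := hg.hasCompactSupport.exists_bound_of_continuous hg.continuous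
  exact ⟨C, (norm_nonneg _).trans (hC 0), hC⟩

/-- A function dominated by a locally integrable one, and vanishing off a compact set, is
integrable. -/
lemma integrable_of_locallyIntegrableOn_of_bound {f : Space n → F} {k : Space n → F'}
    {K : Set (Space n)} {C : ℝ} {μ : Measure (Space n)}
    (hf : LocallyIntegrableOn f U μ) (hK : IsCompact K)
    (hKU : K ⊆ U) (hk : AEStronglyMeasurable k (μ.restrict K))
    (hb : ∀ x, ‖k x‖ ≤ C * ‖f x‖) (h0 : ∀ x, x ∉ K → k x = 0) : Integrable k μ := by
  have h1 : IntegrableOn k K μ :=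
    ((hf.integrableOn_compact_subset hKU hK).norm.const_mul C).mono' hk
      (Eventually.of_forall hb)
  rw [← integrable_indicator_iff hK.isClosed.measurableSet] at h1
  refine h1.congr (Eventually.of_forall fun x => ?_)
  by_cases hx : x ∈ K
  · simp [hx]
  · simp [hx, h0 x hx]

lemma IsTest.integrable_smul {φ : Space n → ℝ} (hφ : IsTest U φ) {f : Space n → F}
    {μ : Measure (Space n)} (hf : LocallyIntegrableOn f U μ) :
    Integrable (fun x => φ x • f x) μ := by
  obtain ⟨C, -, hC⟩ := hφ.bounded
  refine integrable_of_locallyIntegrableOn_of_bound (C := C) hf hφ.hasCompactSupport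
    hφ.tsupport_subset ?_ (fun x => ?_) (fun x hx => ?_)
  · exact hφ.continuous.aestronglyMeasurable.smul
      (hf.integrableOn_compact_subset hφ.tsupport_subset hφ.hasCompactSupport).aestronglyMeasurable
  · rw [norm_smul]
    exact mul_le_mul_of_nonneg_right (hC x) (norm_nonneg _)
  · simp [image_eq_zero_of_notMem_tsupport hx]

lemma IsTest.integrable_smul_field (hg : IsTest U g) {f : Space n → ℝ}
    {μ : Measure (Space n)} (hf : LocallyIntegrableOn f U μ) :
    Integrable (fun x => f x • g x) μ := by
  obtain ⟨C, -, hC⟩ := hg.bounded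
  refine integrable_of_locallyIntegrableOn_of_bound (C := C) hf hg.hasCompactSupport
    hg.tsupport_subset ?_ (fun x => ?_) (fun x hx => ?_)
  · exact (hf.integrableOn_compact_subset hg.tsupport_subset
      hg.hasCompactSupport).aestronglyMeasurable.smul hg.continuous.aestronglyMeasurable
  · rw [norm_smul, mul_comm]
    exact mul_le_mul_of_nonneg_right (hC x) (norm_nonneg _)
  · simp [image_eq_zero_of_notMem_tsupport hx]

lemma IsTest.integrable_inner {g : Space n → Space n} (hg : IsTest U g) {G : Space n → Space n}
    {μ : Measure (Space n)} (hG : LocallyIntegrableOn G U μ) :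
    Integrable (fun x => inner ℝ (G x) (g x)) μ := by
  obtain ⟨C, -, hC⟩ := hg.bounded
  refine integrable_of_locallyIntegrableOn_of_bound (C := C) hG hg.hasCompactSupport
    hg.tsupport_subset ?_ (fun x => ?_) (fun x hx => ?_)
  · exact (hG.integrableOn_compact_subset hg.tsupport_subset
      hg.hasCompactSupport).aestronglyMeasurable.inner hg.continuous.aestronglyMeasurable
  · refine (norm_inner_le_norm _ _).trans ?_
    rw [mul_comm]
    exact mul_le_mul_of_nonneg_right (hC x) (norm_nonneg _)
  · simp [image_eq_zero_of_notMem_tsupport hx]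

end IsTest

/-! ### Gradient and divergence calculus -/

section Divergence

variable {U V : Set (Space n)}

lemma inner_gradient_left' (φ : Space n → ℝ) (x v : Space n) :
    inner ℝ (gradient φ x) v = fderiv ℝ φ x v :=
  inner_gradient_left

lemma gradient_apply (φ : Space n → ℝ) (x : Space n) (i : Fin n) :
    gradient φ x i = fderiv ℝ φ x (EuclideanSpace.single i 1) := by
  rw [← inner_gradient_left', EuclideanSpace.inner_single_right]
  simp

lemma contDiff_gradient {φ : Space n → ℝ} (hφ : ContDiff ℝ ∞ φ) : ContDiff ℝ ∞ (gradient φ) :=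
  (InnerProductSpace.toDual ℝ (Space n)).symm.contDiff.comp
    (hφ.fderiv_right (m := ∞) (by simp))

/-- The `i`-th coordinate as a continuous linear form. -/
abbrev coordL (i : Fin n) : Space n →L[ℝ] ℝ := EuclideanSpace.proj i

lemma IsTest.gradient {φ : Space n → ℝ} (hφ : IsTest U φ) : IsTest U (gradient φ) := by
  have h : tsupport (_root_.gradient φ) ⊆ tsupport φ := by
    refine closure_minimal (fun x hx => ?_) (isClosed_tsupport φ)
    apply support_fderiv_subset ℝ
    simp only [Function.mem_support] at hx ⊢
    exact fun h0 => hx (by simp [_root_.gradient, h0])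
  exact ⟨contDiff_gradient hφ.contDiff,
    hφ.hasCompactSupport.of_isClosed_subset (isClosed_tsupport _) h, h.trans hφ.tsupport_subset⟩

lemma fderiv_coord {g : Space n → Space n} {x : Space n} (hg : DifferentiableAt ℝ g x)
    (v : Space n) (i : Fin n) : fderiv ℝ (fun y => g y i) x v = fderiv ℝ g x v i := by
  have h := ((coordL i).hasFDerivAt.comp x
    hg.hasFDerivAt).fderiv
  have h2 : fderiv ℝ (fun y => g y i) x
    = (coordL i).comp (fderiv ℝ g x) := h
  rw [h2]
  rfl

lemma IsTest.coord {g : Space n → Space n} (hg : IsTest U g) (i : Fin n) :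
    IsTest U (fun x => g x i) :=
  hg.clm_comp (coordL i)

lemma IsTest.divergence {g : Space n → Space n} (hg : IsTest U g) : IsTest U (divergence g) := by
  have h : ∀ s : Finset (Fin n), IsTest U
      (fun x => ∑ i ∈ s, fderiv ℝ g x (EuclideanSpace.single i 1) i) := by
    intro s
    induction s using Finset.induction_on with
    | empty => exact ⟨by simpa using contDiff_const, by simpa using! (HasCompactSupport.zero (α := Space n) (β := ℝ)),
        by simp [tsupport, Function.support]⟩
    | insert i s hi ih =>
      simp only [Finset.sum_insert hi]
      exact ((hg.fderiv_apply (EuclideanSpace.single i 1)).coord i).add ih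
  exact h Finset.univ

lemma divergence_smul {φ : Space n → ℝ} {g : Space n → Space n} {x : Space n}
    (hφ : DifferentiableAt ℝ φ x) (hg : DifferentiableAt ℝ g x) :
    divergence (fun y => φ y • g y) x = φ x * divergence g x + fderiv ℝ φ x (g x) := by
  have h : fderiv ℝ (fun y => φ y • g y) x
      = φ x • fderiv ℝ g x + (fderiv ℝ φ x).smulRight (g x) := fderiv_fun_smul hφ hg
  simp only [divergence, h]
  have h2 : fderiv ℝ φ x (g x) = ∑ i, fderiv ℝ φ x (EuclideanSpace.single i 1) * g x i := by
    conv_lhs => rw [← (EuclideanSpace.basisFun (Fin n) ℝ).sum_repr (g x), map_sum]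
    refine Finset.sum_congr rfl fun i _ => ?_
    simp [mul_comm]
  rw [h2, Finset.mul_sum, ← Finset.sum_add_distrib]
  refine Finset.sum_congr rfl fun i _ => ?_
  simp

lemma divergence_add {g h : Space n → Space n} {x : Space n}
    (hg : DifferentiableAt ℝ g x) (hh : DifferentiableAt ℝ h x) :
    divergence (fun y => g y + h y) x = divergence g x + divergence h x := by
  simp only [divergence, fderiv_fun_add hg hh, ← Finset.sum_add_distrib]
  rfl

lemma divergence_const_smul (c : ℝ) {g : Space n → Space n} {x : Space n}
    (hg : DifferentiableAt ℝ g x) :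
    divergence (fun y => c • g y) x = c * divergence g x := by
  simp only [divergence, fderiv_fun_const_smul hg, Finset.mul_sum]
  rfl

lemma divergence_smul_const {φ : Space n → ℝ} {x : Space n}
    (hφ : DifferentiableAt ℝ φ x) (e : Space n) :
    divergence (fun y => φ y • e) x = fderiv ℝ φ x e := by
  rw [divergence_smul hφ (differentiableAt_const e)]
  simp [divergence]

lemma divergence_smul_id {φ : Space n → ℝ} {x : Space n} (hφ : DifferentiableAt ℝ φ x) :
    divergence (fun y => φ y • y) x = n * φ x + fderiv ℝ φ x x := by
  rw [divergence_smul hφ (g := fun y => y) differentiableAt_fun_id]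
  simp [divergence, mul_comm]

end Divergence

/-! ### Weak gradients by duality with vector fields -/

section WeakGradient

variable {U V : Set (Space n)} {u : Space n → ℝ} {G G' : Space n → Space n}

lemma IsWeakGradient.integral_gradient (h : IsWeakGradient U u G) {φ : Space n → ℝ}
    (hφ : IsTest U φ) : ∫ x, u x • gradient φ x = -∫ x, φ x • G x := by
  have := h.2.2 φ hφ.contDiff hφ.hasCompactSupport hφ.tsupport_subset
  rwa [setIntegral_eq_integral_of_forall_compl_eq_zero,
    setIntegral_eq_integral_of_forall_compl_eq_zero] at this
  · intro x hx
    simp [hφ.comp_apply hx]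
  · intro x hx
    simp [gradient, hφ.fderiv_eq_zero hx]

/-- A weak gradient may be tested against vector fields. -/
lemma IsWeakGradient.integral_mul_divergence (h : IsWeakGradient U u G) {g : Space n → Space n}
    (hg : IsTest U g) : ∫ x, u x * divergence g x = -∫ x, inner ℝ (G x) (g x) := by
  have hi : ∀ i : Fin n, ∫ x, u x * fderiv ℝ g x (EuclideanSpace.single i 1) i
      = -∫ x, g x i * G x i := by
    intro i
    have h1 := h.integral_gradient (hg.coord i)
    have hI1 : Integrable (fun x => u x • gradient (fun y => g y i) x) := by
      exact (hg.coord i).gradient.integrable_smul_field h.1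
    have hI2 : Integrable (fun x => g x i • G x) := (hg.coord i).integrable_smul h.2.1
    have h2 := congrArg (coordL i) h1
    rw [map_neg, ← ContinuousLinearMap.integral_comp_comm _ hI1,
      ← ContinuousLinearMap.integral_comp_comm _ hI2] at h2
    simpa [gradient_apply, fderiv_coord (hg.differentiable _)] using h2
  have h_int : ∀ i : Fin n, Integrable
      (fun x => u x * fderiv ℝ g x (EuclideanSpace.single i 1) i) := fun i => by
    simpa [mul_comm] using ((hg.fderiv_apply (EuclideanSpace.single i 1)).coord i).integrable_smul
      h.1
  have h_int2 : ∀ i : Fin n, Integrable (fun x => g x i * G x i) := fun i => by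
    have := (coordL i).integrable_comp
      ((hg.coord i).integrable_smul h.2.1)
    simpa using this
  simp only [divergence, Finset.mul_sum, PiLp.inner_apply]
  rw [integral_finsetSum _ fun i _ => h_int i, Finset.sum_congr rfl fun i _ => hi i,
    integral_finsetSum, Finset.sum_neg_distrib]
  · rfl
  · exact fun i _ => h_int2 i

/-- Fields `φ • e` with a constant vector `e` recover the vector identity of `IsWeakGradient`. Weak
gradients can thus be tested against divergences, in the same form in which the perimeter is tested.
-/
lemma isWeakGradient_of_integral_mul_divergence (hu : LocallyIntegrableOn u U)
    (hG : LocallyIntegrableOn G U)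
    (h : ∀ g : Space n → Space n, IsTest U g →
      ∫ x, u x * divergence g x = -∫ x, inner ℝ (G x) (g x)) : IsWeakGradient U u G := by
  refine ⟨hu, hG, fun φ h1 h2 h3 => ?_⟩
  have hφ : IsTest U φ := ⟨h1, h2, h3⟩
  rw [setIntegral_eq_integral_of_forall_compl_eq_zero,
    setIntegral_eq_integral_of_forall_compl_eq_zero]
  rotate_left
  · intro x hx
    simp [hφ.comp_apply hx]
  · intro x hx
    simp [gradient, hφ.fderiv_eq_zero hx]
  refine ext_inner_right ℝ fun e => ?_
  have h4 := h (fun x => φ x • e) (hφ.smul_right contDiff_const)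
  rw [inner_neg_left, real_inner_comm, ← integral_inner (hφ.gradient.integrable_smul_field hu),
    real_inner_comm, ← integral_inner (hφ.integrable_smul hG)]
  refine Eq.trans (integral_congr_ae (Eventually.of_forall fun x => ?_)) (h4.trans ?_)
  · simp only [inner_smul_right]
    rw [divergence_smul_const (hφ.differentiable x), real_inner_comm, inner_gradient_left']
  · refine congrArg _ (integral_congr_ae (Eventually.of_forall fun x => ?_))
    simp only [inner_smul_right]
    rw [real_inner_comm]

/-- The fundamental lemma of the calculus of variations, applied to `G - G'`. -/
lemma IsWeakGradient.ae_eq (hU : IsOpen U) (h : IsWeakGradient U u G)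
    (h' : IsWeakGradient U u G') : G =ᵐ[volume.restrict U] G' := by
  have h0 : ∀ᵐ x, x ∈ U → (fun x => G x - G' x) x = 0 := by
    refine hU.ae_eq_zero_of_integral_contDiff_smul_eq_zero (h.2.1.sub h'.2.1) ?_
    intro φ h1 h2 h3
    have hφ : IsTest U φ := ⟨h1, h2, h3⟩
    simp only [smul_sub]
    rw [integral_sub (hφ.integrable_smul h.2.1) (hφ.integrable_smul h'.2.1), sub_eq_zero]
    exact neg_injective ((h.integral_gradient hφ).symm.trans (h'.integral_gradient hφ))
  filter_upwards [(ae_restrict_iff' hU.measurableSet).2 h0] with x hx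
  exact sub_eq_zero.1 hx

lemma IsWeakGradient.mono (h : IsWeakGradient U u G) (hVU : V ⊆ U) : IsWeakGradient V u G :=
  isWeakGradient_of_integral_mul_divergence (h.1.mono_set hVU) (h.2.1.mono_set hVU)
    fun _ hg => h.integral_mul_divergence (hg.mono hVU)

/-- `weakGradient` is an arbitrary choice; uniqueness allows any known weak gradient to be
substituted for it in the energy and in the definition of traces. -/
lemma IsWeakGradient.weakGradient_ae_eq (hU : IsOpen U) (h : IsWeakGradient U u G) :
    weakGradient U u =ᵐ[volume.restrict U] G := by
  have h' : ∃ G, IsWeakGradient U u G := ⟨G, h⟩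
  rw [weakGradient, dif_pos h']
  exact h'.choose_spec.ae_eq hU h

lemma IsWeakGradient.dirichletEnergy_eq (hU : IsOpen U) (h : IsWeakGradient U u G) :
    dirichletEnergy U u = ∫⁻ x in U, ‖G x‖ₑ ^ 2 := by
  refine lintegral_congr_ae ?_
  filter_upwards [h.weakGradient_ae_eq hU] with x hx
  rw [hx]

lemma locallyIntegrableOn_of_memLp {F : Type*} [NormedAddCommGroup F] {f : Space n → F}
    (hf : MemLp f 2 (volume.restrict U)) : LocallyIntegrableOn f U :=
  locallyIntegrableOn_of_locallyIntegrable_restrict (hf.locallyIntegrable one_le_two)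

end WeakGradient

/-! ### Smooth cutoffs and exhaustion -/

section Cutoff

variable {U : Set (Space n)}

/-- A smooth cutoff function between a compact set and an open neighbourhood of it. -/
lemma exists_cutoff (hU : IsOpen U) {K : Set (Space n)} (hK : IsCompact K) (hKU : K ⊆ U) :
    ∃ φ : Space n → ℝ, IsTest U φ ∧ (∀ x ∈ K, φ x = 1) ∧ ∀ x, φ x ∈ Icc (0 : ℝ) 1 := by
  obtain ⟨L, hL, hKL, hLU⟩ := exists_compact_between hK hU hKU
  obtain ⟨f, hf1, hf2, hf3⟩ := exists_contMDiff_zero_iff_one_iff_of_isClosed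
    (I := modelWithCornersSelf ℝ (Space n)) (n := ⊤)
    isOpen_interior.isClosed_compl hK.isClosed (s := (interior L)ᶜ)
    (disjoint_compl_left_iff_subset.2 hKL)
  have hs : Function.support f ⊆ L := fun x hx => by
    by_contra h
    exact hx ((hf3.1 x).1 (fun h' => h (interior_subset h')))
  have hts : tsupport f ⊆ L := closure_minimal hs hL.isClosed
  exact ⟨f, ⟨hf1.contDiff, hL.of_isClosed_subset (isClosed_tsupport _) hts, hts.trans hLU⟩,
    fun x hx => (hf3.2 x).1 hx, fun x => hf2 (mem_range_self x)⟩

/-- A sequence of cutoff functions exhausting an open set. -/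
lemma exists_cutoff_seq (hU : IsOpen U) :
    ∃ φ : ℕ → Space n → ℝ, (∀ k, IsTest U (φ k)) ∧ (∀ k x, φ k x ∈ Icc (0 : ℝ) 1) ∧
      ∀ K ⊆ U, IsCompact K → ∀ᶠ k in atTop, ∀ x ∈ K, φ k x = 1 := by
  have : LocallyCompactSpace U := hU.locallyCompactSpace
  have : SigmaCompactSpace U := sigmaCompactSpace_of_locallyCompact_secondCountable
  let κ := CompactExhaustion.choice U
  choose φ h1 h2 h3 using fun k => exists_cutoff hU ((κ.isCompact k).image continuous_subtype_val)
    (by rintro _ ⟨x, -, rfl⟩; exact x.2)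
  refine ⟨φ, h1, h3, fun K hKU hK => ?_⟩
  have hK' : IsCompact ((↑) ⁻¹' K : Set U) := by
    rw [Subtype.isCompact_iff, Subtype.image_preimage_coe, inter_eq_right.2 hKU]
    exact hK
  obtain ⟨N, hN⟩ := κ.exists_superset_of_isCompact hK'
  filter_upwards [eventually_ge_atTop N] with k hk x hx
  exact h2 k x ⟨⟨x, hKU hx⟩, κ.subset hk (hN hx), rfl⟩

end Cutoff

/-! ### Mollification -/

section Mollify

open scoped Convolution

variable {F : Type*} [NormedAddCommGroup F] [NormedSpace ℝ F] [CompleteSpace F]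
  {f : Space n → F}

/-- Mollification by a normalized smooth bump function. -/
def mollify (φ : ContDiffBump (0 : Space n)) (f : Space n → F) : Space n → F :=
  φ.normed volume ⋆[ContinuousLinearMap.lsmul ℝ ℝ, volume] f

variable (φ : ContDiffBump (0 : Space n))

lemma mollify_apply (f : Space n → F) (x : Space n) :
    mollify φ f x = ∫ t, φ.normed volume t • f (x - t) := rfl

lemma mollify_apply_swap (f : Space n → F) (x : Space n) :
    mollify φ f x = ∫ t, φ.normed volume (x - t) • f t := by
  rw [mollify, convolution_lsmul_swap]

lemma contDiff_mollify (hf : LocallyIntegrable f) : ContDiff ℝ ∞ (mollify φ f) :=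
  φ.hasCompactSupport_normed.contDiff_convolution_left _ φ.contDiff_normed hf

/-- Mollifying averages against a probability density, so the constraint `|g| ≤ 1` of the perimeter
survives it. -/
lemma norm_mollify_le {C : ℝ} (hC : ∀ x, ‖f x‖ ≤ C) (x : Space n) : ‖mollify φ f x‖ ≤ C := by
  have h1 : ∀ t, ‖φ.normed volume t • f (x - t)‖ ≤ φ.normed volume t * C := fun t => by
    rw [norm_smul, Real.norm_of_nonneg (φ.nonneg_normed t)]
    exact mul_le_mul_of_nonneg_left (hC _) (φ.nonneg_normed t)
  rw [mollify_apply]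
  refine (norm_integral_le_of_norm_le (φ.integrable_normed.mul_const C)
    (Eventually.of_forall h1)).trans ?_
  rw [integral_mul_const, φ.integral_normed, one_mul]

lemma mollify_eq_zero {x : Space n} (h : ∀ y ∈ ball x φ.rOut, f y = 0) : mollify φ f x = 0 := by
  rw [mollify_apply]
  refine integral_eq_zero_of_ae (Eventually.of_forall fun t => ?_)
  by_cases ht : t ∈ ball (0 : Space n) φ.rOut
  · simp [h (x - t) (by simpa [mem_ball, dist_eq_norm] using ht)]
  · have : φ.normed volume t = 0 := by
      rw [← Function.notMem_support, φ.support_normed_eq]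
      exact ht
    simp [this]

lemma tsupport_mollify_subset : tsupport (mollify φ f) ⊆ cthickening φ.rOut (tsupport f) := by
  refine closure_minimal (fun x hx => ?_) isClosed_cthickening
  by_contra h
  refine hx (mollify_eq_zero φ fun y hy => ?_)
  by_contra hy'
  exact h (mem_cthickening_of_dist_le x y _ _ (subset_tsupport f hy') (by
    rw [dist_comm]; exact (mem_ball.1 hy).le))

lemma IsTest.mollify {U V : Set (Space n)} (hf : IsTest U f)
    (hV : cthickening φ.rOut (tsupport f) ⊆ V) : IsTest V (mollify φ f) :=
  ⟨contDiff_mollify φ hf.continuous.locallyIntegrable,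
    hf.hasCompactSupport.cthickening.of_isClosed_subset (isClosed_tsupport _)
      (tsupport_mollify_subset φ), (tsupport_mollify_subset φ).trans hV⟩

lemma IsTest.fderiv_mollify {U : Set (Space n)} (hf : IsTest U f) (x v : Space n) :
    fderiv ℝ (DirichletPerimeter.mollify φ f) x v
      = DirichletPerimeter.mollify φ (fun y => fderiv ℝ f y v) x := by
  have h := (hf.hasCompactSupport.hasFDerivAt_convolution_right
    (ContinuousLinearMap.lsmul ℝ ℝ)
    (φ.integrable_normed (μ := (volume : Measure (Space n)))).locallyIntegrable
    (hf.contDiff.of_le (by simp)) x).fderiv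
  rw [DirichletPerimeter.mollify, h, convolution_precompR_apply]
  · rfl
  · exact φ.integrable_normed.locallyIntegrable
  · exact hf.hasCompactSupport.fderiv (𝕜 := ℝ)
  · exact hf.contDiff.continuous_fderiv (by simp)

lemma IsTest.mollify_coord {U : Set (Space n)} {g : Space n → Space n} (hg : IsTest U g)
    (x : Space n) (i : Fin n) :
    DirichletPerimeter.mollify φ g x i = DirichletPerimeter.mollify φ (fun y => g y i) x := by
  have hI : Integrable (fun t => φ.normed volume t • g (x - t)) := by
    refine Continuous.integrable_of_hasCompactSupport ?_ ?_
    · exact φ.continuous_normed.smul (hg.continuous.comp (continuous_const.sub continuous_id))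
    · exact φ.hasCompactSupport_normed.smul_right
  have := (coordL i).integral_comp_comm hI
  rw [mollify_apply, mollify_apply]
  simpa using this.symm

lemma IsTest.divergence_mollify {U : Set (Space n)} {g : Space n → Space n} (hg : IsTest U g)
    (x : Space n) : DirichletPerimeter.divergence (DirichletPerimeter.mollify φ g) x
      = DirichletPerimeter.mollify φ (DirichletPerimeter.divergence g) x := by
  have e : DirichletPerimeter.mollify φ (DirichletPerimeter.divergence g) x
      = ∫ t, ∑ i, φ.normed volume t • (fderiv ℝ g (x - t) (EuclideanSpace.single i 1) i) := by
    rw [mollify_apply]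
    refine integral_congr_ae (Eventually.of_forall fun t => ?_)
    simp only [DirichletPerimeter.divergence, Finset.smul_sum]
  rw [e, DirichletPerimeter.divergence]
  rw [integral_finsetSum]
  · refine Finset.sum_congr rfl fun i _ => ?_
    rw [hg.fderiv_mollify, (hg.fderiv_apply _).mollify_coord, mollify_apply]
  · intro i _
    refine Continuous.integrable_of_hasCompactSupport ?_ ?_
    · exact φ.continuous_normed.smul (((hg.fderiv_apply _).coord i).continuous.comp
        (continuous_const.sub continuous_id))
    · exact φ.hasCompactSupport_normed.smul_right

/-- Mollification is symmetric. -/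
lemma integral_mul_mollify {w h : Space n → ℝ} (hw : LocallyIntegrable w) (hh : Continuous h)
    (hc : HasCompactSupport h) :
    ∫ x, w x * mollify φ h x = ∫ x, mollify φ w x * h x := by
  have e1 : ∀ x, w x * mollify φ h x = ∫ t, w x * (φ.normed volume (x - t) * h t) := fun x => by
    rw [mollify_apply_swap, integral_const_mul]
    rfl
  have e2 : ∀ t, mollify φ w t * h t = ∫ x, w x * (φ.normed volume (x - t) * h t) := fun t => by
    rw [mollify_apply_swap, ← integral_mul_const]
    refine integral_congr_ae (Eventually.of_forall fun x => ?_)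
    -- The kernel is even, which is what makes mollification self-adjoint.
    have : φ.normed volume (t - x) = φ.normed volume (x - t) := by
      rw [← φ.normed_neg, neg_sub]
    simp only [this, smul_eq_mul]
    ring
  simp only [e1, e2]
  refine integral_integral_swap ?_
  set K := cthickening φ.rOut (tsupport h) with hK
  have hKc : IsCompact K := IsCompact.cthickening hc
  have hm : AEStronglyMeasurable (Function.uncurry fun x t => w x * (φ.normed volume (x - t) * h t))
      (volume.prod volume) := by
    refine (hw.aestronglyMeasurable.comp_fst).mul (Continuous.aestronglyMeasurable ?_)
    exact (φ.continuous_normed.comp (continuous_fst.sub continuous_snd)).mul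
      (hh.comp continuous_snd)
  obtain ⟨C, hC⟩ := φ.hasCompactSupport_normed.exists_bound_of_continuous
    (φ.continuous_normed (μ := (volume : Measure (Space n))))
  -- Since the kernel times `h t` vanishes for `x` off `K`, a product of integrable functions
  -- dominates although `w` is only locally integrable.
  have hdom : Integrable (fun z : Space n × Space n => (K.indicator w z.1) * (C * h z.2))
      (volume.prod volume) :=
    ((integrable_indicator_iff hKc.isClosed.measurableSet).2
      (hw.integrableOn_isCompact hKc)).mul_prod
      ((hh.integrable_of_hasCompactSupport hc).const_mul C)
  refine hdom.mono hm (Eventually.of_forall fun z => ?_)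
  obtain ⟨x, t⟩ := z
  simp only [Function.uncurry_apply_pair, norm_mul]
  have hC0 : ‖φ.normed volume (x - t)‖ ≤ ‖C‖ := (hC _).trans (le_abs_self C)
  by_cases hx : x ∈ K
  · rw [indicator_of_mem hx]
    gcongr
  · have h0 : φ.normed volume (x - t) * h t = 0 := by
      by_contra h0
      refine hx ?_
      have h1 := left_ne_zero_of_mul h0
      have h2 := right_ne_zero_of_mul h0
      rw [← Function.mem_support, φ.support_normed_eq, mem_ball_zero_iff] at h1
      exact mem_cthickening_of_dist_le x t _ _ (subset_tsupport h h2)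
        (by rw [dist_eq_norm]; exact h1.le)
    rw [← norm_mul (φ.normed volume (x - t)), h0]
    simp only [norm_zero, mul_zero]
    positivity

/-- Only the continuous factor is mollified: it converges pointwise, is bounded by `sup |h|`, and
eventually lives in the unit neighbourhood of the support of `h`, so dominated convergence applies.
-/
lemma tendsto_integral_mul_mollify {φ : ℕ → ContDiffBump (0 : Space n)}
    (hφ : Tendsto (fun k => (φ k).rOut) atTop (𝓝 0)) {w h : Space n → ℝ}
    (hw : LocallyIntegrable w) (hh : Continuous h) (hc : HasCompactSupport h) :
    Tendsto (fun k => ∫ x, w x * mollify (φ k) h x) atTop (𝓝 (∫ x, w x * h x)) := by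
  set K := cthickening 1 (tsupport h) with hK
  have hKc : IsCompact K := IsCompact.cthickening hc
  obtain ⟨C, hC⟩ := hc.exists_bound_of_continuous hh
  have h_int : Integrable (fun x => K.indicator (fun x => ‖w x‖ * C) x) :=
    (integrable_indicator_iff hKc.isClosed.measurableSet).2
      ((hw.integrableOn_isCompact hKc).norm.mul_const C)
  refine tendsto_integral_filter_of_dominated_convergence _ ?_ ?_ h_int ?_
  · exact Eventually.of_forall fun k => hw.aestronglyMeasurable.mul
      (contDiff_mollify (φ k) hh.locallyIntegrable).continuous.aestronglyMeasurable
  · filter_upwards [hφ.eventually (eventually_le_nhds one_pos)] with k hk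
    refine Eventually.of_forall fun x => ?_
    by_cases hx : x ∈ K
    · rw [indicator_of_mem hx, norm_mul]
      exact mul_le_mul_of_nonneg_left (norm_mollify_le _ hC x) (norm_nonneg _)
    · rw [indicator_of_notMem hx, norm_le_zero_iff]
      have : mollify (φ k) h x = 0 := by
        refine image_eq_zero_of_notMem_tsupport fun h' => hx ?_
        exact cthickening_mono hk _ (tsupport_mollify_subset (φ k) h')
      rw [this, mul_zero]
  · refine Eventually.of_forall fun x => Tendsto.const_mul _ ?_
    exact ContDiffBump.convolution_tendsto_right_of_continuous hφ hh x

end Mollify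

/-- Smooth functions are weakly differentiable. -/
lemma isWeakGradient_of_contDiff {w : Space n → ℝ} (hw : ContDiff ℝ ∞ w) (U : Set (Space n)) :
    IsWeakGradient U w (gradient w) := by
  have hwc := hw.continuous.locallyIntegrable (μ := (volume : Measure (Space n)))
  have hgc := (contDiff_gradient hw).continuous.locallyIntegrable
    (μ := (volume : Measure (Space n)))
  refine isWeakGradient_of_integral_mul_divergence (hwc.locallyIntegrableOn U)
    (hgc.locallyIntegrableOn U) fun g hg => ?_
  have h1 : ∀ i : Fin n, ∫ x, w x * fderiv ℝ (fun y => g y i) x (EuclideanSpace.single i 1)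
      = -∫ x, fderiv ℝ w x (EuclideanSpace.single i 1) * g x i := by
    intro i
    refine integral_mul_fderiv_eq_neg_fderiv_mul_of_integrable ?_ ?_ ?_
      (fun x _ => hw.differentiable (by simp) x) (fun x _ => (hg.coord i).differentiable x)
    · refine Continuous.integrable_of_hasCompactSupport ?_ (hg.coord i).hasCompactSupport.mul_left
      exact ((hw.continuous_fderiv (by simp)).clm_apply continuous_const).mul
        (hg.coord i).continuous
    · refine Continuous.integrable_of_hasCompactSupport ?_
        ((hg.coord i).fderiv_apply _).hasCompactSupport.mul_left
      exact hw.continuous.mul ((hg.coord i).fderiv_apply _).continuous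
    · refine Continuous.integrable_of_hasCompactSupport ?_ (hg.coord i).hasCompactSupport.mul_left
      exact hw.continuous.mul (hg.coord i).continuous
  simp only [divergence, Finset.mul_sum, PiLp.inner_apply]
  rw [integral_finsetSum, integral_finsetSum, ← Finset.sum_neg_distrib]
  · refine Finset.sum_congr rfl fun i _ => ?_
    simp only [fderiv_coord (hg.differentiable _)] at h1
    rw [h1 i]
    simp [gradient_apply, mul_comm]
  · intro i _
    have := (hg.coord i).integrable_smul (μ := volume) (((contDiff_gradient hw).continuous.comp'
      continuous_id).locallyIntegrable.locallyIntegrableOn U)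
    simpa using (coordL i).integrable_comp this
  · intro i _
    refine Continuous.integrable_of_hasCompactSupport ?_
        ((hg.fderiv_apply _).coord i).hasCompactSupport.mul_left
    exact hw.continuous.mul ((hg.fderiv_apply _).coord i).continuous

/-! ### Approximation of the derivative of an indicator by densities -/

section PerimeterMeasure

variable {U V Ω E : Set (Space n)}

/-- The distributional derivative of the indicator of `E`, tested against a field. -/
def indicatorFlux (E : Set (Space n)) (g : Space n → Space n) : ℝ :=
  ∫ x, E.indicator (fun _ => (1 : ℝ)) x * divergence g x

lemma locallyIntegrable_indicator (hE : MeasurableSet E) :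
    LocallyIntegrable (E.indicator (fun _ => (1 : ℝ))) (volume : Measure (Space n)) :=
  (locallyIntegrable_const (1 : ℝ)).indicator hE

lemma IsTest.setIntegral_divergence {g : Space n → Space n} (hg : IsTest U g)
    (w : Space n → ℝ) : ∫ x in U, w x * DirichletPerimeter.divergence g x
      = ∫ x, w x * DirichletPerimeter.divergence g x :=
  setIntegral_eq_integral_of_forall_compl_eq_zero fun x hx => by
    rw [hg.divergence.comp_apply hx, mul_zero]

lemma IsTest.ofReal_indicatorFlux_le {g : Space n → Space n} (hg : IsTest U g)
    (h1 : ∀ x, ‖g x‖ ≤ 1) : ENNReal.ofReal (indicatorFlux E g) ≤ perimeter U E := by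
  rw [perimeter]
  refine le_trans (le_of_eq ?_) (le_iSup₂ (f := fun (g : Space n → Space n) _ =>
    ENNReal.ofReal (∫ x in U, E.indicator (fun _ => (1 : ℝ)) x * DirichletPerimeter.divergence g x))
    g ⟨hg.contDiff, hg.hasCompactSupport, hg.tsupport_subset, h1⟩)
  simp only [indicatorFlux, hg.setIntegral_divergence]

lemma perimeter_le_of_forall {c : ℝ≥0∞} (h : ∀ g : Space n → Space n, IsTest U g →
    (∀ x, ‖g x‖ ≤ 1) → ENNReal.ofReal (indicatorFlux E g) ≤ c) : perimeter U E ≤ c := by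
  rw [perimeter]
  refine iSup₂_le fun g hg => ?_
  have hg' : IsTest U g := ⟨hg.1, hg.2.1, hg.2.2.1⟩
  rw [hg'.setIntegral_divergence]
  exact h g hg' hg.2.2.2

lemma IsTest.indicatorFlux_le {g : Space n → Space n} (hg : IsTest U g)
    (hP : perimeter U E ≠ ⊤) (h1 : ∀ x, ‖g x‖ ≤ 1) :
    indicatorFlux E g ≤ (perimeter U E).toReal :=
  (ENNReal.ofReal_le_iff_le_toReal hP).1 (hg.ofReal_indicatorFlux_le h1)

lemma IsTest.integrable_indicatorFlux (hE : MeasurableSet E) {g : Space n → Space n}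
    (hg : IsTest U g) :
    Integrable (fun x => E.indicator (fun _ => (1 : ℝ)) x * DirichletPerimeter.divergence g x) := by
  simpa [mul_comm] using hg.divergence.integrable_smul (μ := volume)
    ((locallyIntegrable_indicator hE).locallyIntegrableOn U)

lemma IsTest.indicatorFlux_add (hE : MeasurableSet E) {g h : Space n → Space n}
    (hg : IsTest U g) (hh : IsTest U h) :
    indicatorFlux E (fun x => g x + h x) = indicatorFlux E g + indicatorFlux E h := by
  rw [indicatorFlux, indicatorFlux, indicatorFlux, ← integral_add
    (hg.integrable_indicatorFlux hE) (hh.integrable_indicatorFlux hE)]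
  refine integral_congr_ae (Eventually.of_forall fun x => ?_)
  simp only [divergence_add (hg.differentiable x) (hh.differentiable x), mul_add]

lemma IsTest.indicatorFlux_smul (c : ℝ) {g : Space n → Space n} (hg : IsTest U g) :
    indicatorFlux E (fun x => c • g x) = c * indicatorFlux E g := by
  rw [indicatorFlux, indicatorFlux, ← integral_const_mul]
  refine integral_congr_ae (Eventually.of_forall fun x => ?_)
  simp only [divergence_const_smul c (hg.differentiable x)]
  ring

/-- The field `(δ² + |g|²)^(-1/2) g` is a smooth substitute for the direction `g / |g|`; by the next
two lemmas its norm is at most `1` and its pairing with `g` loses at most `δ`. -/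
lemma contDiff_inv_sqrt_sq_add {g : Space n → Space n} (hg : ContDiff ℝ ∞ g) {δ : ℝ}
    (hδ : 0 < δ) : ContDiff ℝ ∞ (fun x => (Real.sqrt (δ ^ 2 + ‖g x‖ ^ 2))⁻¹) := by
  have hpos : ∀ x, 0 < δ ^ 2 + ‖g x‖ ^ 2 := fun x => by positivity
  refine ContDiff.inv (ContDiff.sqrt (contDiff_const.add (hg.norm_sq ℝ)) fun x => (hpos x).ne') ?_
  exact fun x => (Real.sqrt_pos.2 (hpos x)).ne'

lemma norm_normalized_le {δ : ℝ} (hδ : 0 < δ) (v : Space n) :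
    ‖(Real.sqrt (δ ^ 2 + ‖v‖ ^ 2))⁻¹ • v‖ ≤ 1 := by
  have hpos : 0 < Real.sqrt (δ ^ 2 + ‖v‖ ^ 2) := Real.sqrt_pos.2 (by positivity)
  rw [norm_smul, norm_inv, Real.norm_of_nonneg hpos.le, inv_mul_le_iff₀ hpos, mul_one]
  exact Real.le_sqrt_of_sq_le (by nlinarith [sq_nonneg δ])

lemma norm_sub_le_inner_normalized {δ : ℝ} (hδ : 0 < δ) (v : Space n) :
    ‖v‖ - δ ≤ inner ℝ v ((Real.sqrt (δ ^ 2 + ‖v‖ ^ 2))⁻¹ • v) := by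
  have hpos : 0 < Real.sqrt (δ ^ 2 + ‖v‖ ^ 2) := Real.sqrt_pos.2 (by positivity)
  rw [inner_smul_right, real_inner_self_eq_norm_sq, inv_mul_eq_div, le_div_iff₀ hpos]
  have h1 : Real.sqrt (δ ^ 2 + ‖v‖ ^ 2) ≤ δ + ‖v‖ :=
    Real.sqrt_le_iff.2 ⟨by positivity, by nlinarith [mul_nonneg hδ.le (norm_nonneg v)]⟩
  have h2 : ‖v‖ ≤ Real.sqrt (δ ^ 2 + ‖v‖ ^ 2) :=
    Real.le_sqrt_of_sq_le (by nlinarith [sq_nonneg δ])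
  have h3 : δ ≤ Real.sqrt (δ ^ 2 + ‖v‖ ^ 2) :=
    Real.le_sqrt_of_sq_le (by nlinarith [sq_nonneg ‖v‖])
  nlinarith [norm_nonneg v]

/-- The derivative of the indicator of a set of finite perimeter is a weak limit of continuous
densities whose total mass is at most the perimeter. -/
lemma exists_approx_fields (hΩ : IsOpen Ω) (hE : MeasurableSet E) (hP : perimeter Ω E ≠ ⊤) :
    ∃ W : ℕ → Space n → Space n, (∀ k, Continuous (W k) ∧ HasCompactSupport (W k)) ∧
      (∀ k, ∫ x, ‖W k x‖ ≤ (perimeter Ω E).toReal) ∧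
      ∀ g, IsTest Ω g →
        Tendsto (fun k => ∫ x, inner ℝ (W k x) (g x)) atTop (𝓝 (indicatorFlux E g)) := by
  obtain ⟨ζ, hζ, hζ01, hζ1⟩ := exists_cutoff_seq hΩ
  -- The radius tends to zero and is small enough for the mollification of any field cut off by `ζ
  -- k` to stay supported in `Ω`.
  have hε : ∀ k : ℕ, ∃ ε : ℝ, 0 < ε ∧ ε ≤ 1 / ((k : ℝ) + 1) ∧
      cthickening ε (tsupport (ζ k)) ⊆ Ω := fun k => by
    obtain ⟨ε, h0, h1⟩ := (hζ k).hasCompactSupport.exists_cthickening_subset_open hΩ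
      (hζ k).tsupport_subset
    exact ⟨min ε (1 / ((k : ℝ) + 1)), lt_min h0 (by positivity), min_le_right _ _,
      (cthickening_mono (min_le_left _ _) _).trans h1⟩
  choose ε hε0 hε1 hεΩ using hε
  let φ : ℕ → ContDiffBump (0 : Space n) := fun k =>
    ⟨ε k / 2, ε k, half_pos (hε0 k), half_lt_self (hε0 k)⟩
  have hφ0 : Tendsto (fun k => (φ k).rOut) atTop (𝓝 0) :=
    squeeze_zero (fun k => (hε0 k).le) hε1 tendsto_one_div_add_atTop_nhds_zero_nat
  set χ : Space n → ℝ := E.indicator (fun _ => (1 : ℝ)) with hχ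
  have hχi : LocallyIntegrable χ := locallyIntegrable_indicator hE
  have hw : ∀ k, ContDiff ℝ ∞ (mollify (φ k) χ) := fun k => contDiff_mollify _ hχi
  -- The sign is that of `∫ χ div g = -∫ ∇χ · g`.
  let W : ℕ → Space n → Space n := fun k x => -(ζ k x • gradient (mollify (φ k) χ) x)
  have hWt : ∀ k, IsTest Ω (W k) := fun k => by
    have := ((hζ k).smul_right (contDiff_gradient (hw k))).const_smul (-1)
    simpa only [neg_smul, one_smul] using this
  -- The mollifier is moved from the indicator to the field, so pairing with `W k` becomes a genuine
  -- flux of `E`, to which the definition of the perimeter applies.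
  have key : ∀ k (g : Space n → Space n), ContDiff ℝ ∞ g → ∫ x, inner ℝ (W k x) (g x)
      = indicatorFlux E (mollify (φ k) (fun x => ζ k x • g x)) := by
    intro k g hg
    have ht : IsTest Ω (fun x => ζ k x • g x) := (hζ k).smul_right hg
    have h1 := (isWeakGradient_of_contDiff (hw k) Ω).integral_mul_divergence ht
    have h2 : ∫ x, inner ℝ (W k x) (g x)
        = -∫ x, inner ℝ (gradient (mollify (φ k) χ) x) (ζ k x • g x) := by
      rw [← integral_neg]
      refine integral_congr_ae (Eventually.of_forall fun x => ?_)
      simp only [W, inner_neg_left, inner_smul_left, inner_smul_right]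
      simp
    rw [h2, ← h1, indicatorFlux]
    simp only [ht.divergence_mollify]
    exact (integral_mul_mollify _ hχi ht.divergence.continuous
      ht.divergence.hasCompactSupport).symm
  refine ⟨W, fun k => ⟨(hWt k).continuous, (hWt k).hasCompactSupport⟩, fun k => ?_, fun g hg => ?_⟩
  -- The mass of `W k` is computed by pairing with its regularized direction. The mollified field
  -- has norm at most `1`, hence flux at most the perimeter; the error `δ` is paid only on the
  -- compact support.
  · have hb : ∀ δ : ℝ, 0 < δ → ∫ x, ‖W k x‖
        ≤ (perimeter Ω E).toReal + δ * volume.real (tsupport (W k)) := by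
      intro δ hδ
      set g : Space n → Space n := fun x => (Real.sqrt (δ ^ 2 + ‖W k x‖ ^ 2))⁻¹ • W k x with hgdef
      have hgt : IsTest Ω g := (hWt k).smul_left (contDiff_inv_sqrt_sq_add (hWt k).contDiff hδ)
      have hg1 : ∀ x, ‖g x‖ ≤ 1 := fun x => norm_normalized_le hδ _
      have hζg : IsTest Ω (fun x => ζ k x • g x) := (hζ k).smul_right hgt.contDiff
      have hts : tsupport (fun x => ζ k x • g x) ⊆ tsupport (ζ k) :=
        closure_mono fun x hx => by
          simp only [Function.mem_support] at hx ⊢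
          exact fun h0 => hx (by simp [h0])
      have h1 : ∫ x, inner ℝ (W k x) (g x) ≤ (perimeter Ω E).toReal := by
        rw [key k g hgt.contDiff]
        refine (hζg.mollify (φ k) ((cthickening_subset_of_subset _ hts).trans
          (hεΩ k))).indicatorFlux_le hP fun x => norm_mollify_le _ (fun y => ?_) x
        rw [norm_smul, Real.norm_of_nonneg (hζ01 k y).1]
        exact mul_le_one₀ (hζ01 k y).2 (norm_nonneg _) (hg1 y)
      have hK : IsCompact (tsupport (W k)) := (hWt k).hasCompactSupport
      have hi1 : Integrable (fun x => inner ℝ (W k x) (g x)) :=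
        hgt.integrable_inner ((hWt k).continuous.locallyIntegrable.locallyIntegrableOn Ω)
      have hi2 : Integrable ((tsupport (W k)).indicator (fun _ => δ)) :=
        (integrable_indicator_iff hK.isClosed.measurableSet).2
          (integrableOn_const hK.measure_lt_top.ne)
      calc ∫ x, ‖W k x‖ ≤ ∫ x, (inner ℝ (W k x) (g x) + (tsupport (W k)).indicator (fun _ => δ) x) := by
            refine integral_mono ((hWt k).continuous.integrable_of_hasCompactSupport
              (hWt k).hasCompactSupport).norm (hi1.add hi2) fun x => ?_
            by_cases hx : x ∈ tsupport (W k)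
            · simp only [indicator_of_mem hx]
              linarith [norm_sub_le_inner_normalized hδ (W k x)]
            · simp [image_eq_zero_of_notMem_tsupport hx, hx]
        _ ≤ _ := by
            rw [integral_add hi1 hi2, integral_indicator hK.isClosed.measurableSet,
              setIntegral_const, smul_eq_mul, mul_comm δ]
            linarith
    refine le_of_forall_pos_le_add fun η hη => ?_
    have hv : 0 ≤ volume.real (tsupport (W k)) := measureReal_nonneg
    refine (hb (η / (volume.real (tsupport (W k)) + 1)) (by positivity)).trans ?_
    gcongr
    rw [div_mul_eq_mul_div, div_le_iff₀ (by positivity)]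
    nlinarith
  -- For large `k` the cutoff equals `1` on the support of `g` and drops out.
  · have h1 : ∀ᶠ k in atTop, ∫ x, inner ℝ (W k x) (g x)
        = ∫ x, χ x * mollify (φ k) (divergence g) x := by
      filter_upwards [hζ1 _ hg.tsupport_subset hg.hasCompactSupport] with k hk
      have h2 : (fun x => ζ k x • g x) = g := by
        ext1 x
        by_cases hx : x ∈ tsupport g
        · simp [hk x hx]
        · simp [image_eq_zero_of_notMem_tsupport hx]
      rw [key k g hg.contDiff, h2, indicatorFlux]
      simp only [hg.divergence_mollify]
      rfl
    exact (tendsto_integral_mul_mollify hφ0 hχi hg.divergence.continuous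
      hg.divergence.hasCompactSupport).congr' (h1.mono fun k hk => hk.symm)

end PerimeterMeasure

/-! ### A weak limit of the total variations -/

section WeakLimit

open scoped CompactlySupported

/-- Weak limits of continuous densities of bounded mass are dominated by a finite measure. -/
lemma exists_finite_measure_dominating {W : ℕ → Space n → Space n} {P : ℝ}
    (hW : ∀ k, Continuous (W k) ∧ HasCompactSupport (W k)) (hP : ∀ k, ∫ x, ‖W k x‖ ≤ P) :
    ∃ μ : Measure (Space n), IsFiniteMeasure μ ∧
      ∀ (g : Space n → Space n) (l : ℝ), Continuous g → HasCompactSupport g →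
        Tendsto (fun k => ∫ x, inner ℝ (W k x) (g x)) atTop (𝓝 l) → |l| ≤ ∫ x, ‖g x‖ ∂μ := by
  have hWi : ∀ k, Integrable (fun x => ‖W k x‖) := fun k =>
    ((hW k).1.integrable_of_hasCompactSupport (hW k).2).norm
  let I : ℕ → C_c(Space n, ℝ) → ℝ := fun k f => ∫ x, f x * ‖W k x‖
  have hIi : ∀ k (f : C_c(Space n, ℝ)), Integrable (fun x => f x * ‖W k x‖) := fun k f =>
    (f.continuous.mul (hW k).1.norm).integrable_of_hasCompactSupport f.hasCompactSupport.mul_right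
  have hbd : ∀ f : C_c(Space n, ℝ), ∀ C : ℝ, (∀ x, |f x| ≤ C) → ∀ k : ℕ, |I k f| ≤ C * P := by
    intro f C hC k
    have hC0 : 0 ≤ C := (abs_nonneg _).trans (hC 0)
    calc |I k f| = ‖I k f‖ := rfl
      _ ≤ ∫ x, C * ‖W k x‖ := by
          refine norm_integral_le_of_norm_le ((hWi k).const_mul C) (Eventually.of_forall fun x => ?_)
          rw [norm_mul, norm_norm]
          exact mul_le_mul_of_nonneg_right (hC x) (norm_nonneg _)
      _ ≤ C * P := by
          rw [integral_const_mul]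
          exact mul_le_mul_of_nonneg_left (hP k) hC0
  -- The limit along an ultrafilter exists for every bounded sequence simultaneously and is linear
  -- and positive in `f`, so no subsequence has to be extracted.
  have hlim : ∀ f : C_c(Space n, ℝ), ∃ l, Tendsto (fun k => I k f) (hyperfilter ℕ) (𝓝 l) := by
    intro f
    obtain ⟨C, hC⟩ := f.hasCompactSupport.exists_bound_of_continuous f.continuous
    obtain ⟨l, -, hl⟩ := (isCompact_Icc (a := -(C * P)) (b := C * P)).ultrafilter_le_nhds
      ((hyperfilter ℕ).map fun k => I k f) (by
        refine le_principal_iff.2 (mem_map.2 (univ_mem' fun k => ?_))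
        exact abs_le.1 (hbd f C hC k))
    exact ⟨l, hl⟩
  choose Λ₀ hΛ₀ using hlim
  let Λ₁ : C_c(Space n, ℝ) →ₗ[ℝ] ℝ :=
    { toFun := Λ₀
      map_add' := fun f g => tendsto_nhds_unique (hΛ₀ (f + g)) (by
        refine ((hΛ₀ f).add (hΛ₀ g)).congr fun k => ?_
        rw [← integral_add (hIi k f) (hIi k g)]
        simp [I, add_mul])
      map_smul' := fun c f => tendsto_nhds_unique (hΛ₀ (c • f)) (by
        refine ((hΛ₀ f).const_mul c).congr fun k => ?_
        rw [← integral_const_mul]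
        simp [I, mul_assoc]) }
  let Λ : C_c(Space n, ℝ) →ₚ[ℝ] ℝ := PositiveLinearMap.mk₀ Λ₁ (fun f hf => by
    refine ge_of_tendsto (hΛ₀ f) (Eventually.of_forall fun k => ?_)
    exact integral_nonneg fun x => mul_nonneg (hf x) (norm_nonneg _))
  have hΛ : ∀ f, Λ f = Λ₀ f := fun f => rfl
  set μ := RealRMK.rieszMeasure Λ with hμ
  -- Each closed ball has mass at most the value of the functional on a cutoff equal to `1` there,
  -- hence at most `P`.
  have hfin : μ univ ≤ ENNReal.ofReal P := by
    have hcov : (univ : Set (Space n)) = ⋃ k : ℕ, closedBall 0 k := (iUnion_closedBall_nat 0).symm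
    have hmono : Monotone fun k : ℕ => closedBall (0 : Space n) k := fun i j hij =>
      closedBall_subset_closedBall (by exact_mod_cast hij)
    rw [hcov, hmono.measure_iUnion]
    refine iSup_le fun k => ?_
    obtain ⟨f, hf, hf1, hf01⟩ := exists_cutoff (U := univ) isOpen_univ
      (isCompact_closedBall (0 : Space n) (k : ℝ)) (subset_univ _)
    let f' : C_c(Space n, ℝ) := ⟨⟨f, hf.continuous⟩, hf.hasCompactSupport⟩
    refine (RealRMK.rieszMeasure_le_of_eq_one Λ (f := f') (fun x => (hf01 x).1)
      (isCompact_closedBall _ _) hf1).trans (ENNReal.ofReal_le_ofReal ?_)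
    rw [hΛ]
    refine le_of_tendsto (hΛ₀ f') (Eventually.of_forall fun j => ?_)
    have := hbd f' 1 (fun x => by
      rw [abs_of_nonneg]
      exacts [(hf01 x).2, (hf01 x).1]) j
    exact (le_abs_self _).trans (this.trans_eq (one_mul P))
  refine ⟨μ, ⟨hfin.trans_lt ENNReal.ofReal_lt_top⟩, fun g l hg hgc hl => ?_⟩
  let f : C_c(Space n, ℝ) := ⟨⟨fun x => ‖g x‖, hg.norm⟩, hgc.norm⟩
  have h1 : ∫ x, ‖g x‖ ∂μ = Λ₀ f := RealRMK.integral_rieszMeasure Λ f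
  rw [h1]
  -- The hyperfilter refines `atTop`, so the given limit `l` is also the limit along it and can be
  -- compared with the functional evaluated at `|g|`.
  refine le_of_tendsto_of_tendsto ((hl.mono_left ?_).abs) (hΛ₀ f) (Eventually.of_forall fun k => ?_)
  · exact Nat.hyperfilter_le_atTop
  · change ‖∫ x, inner ℝ (W k x) (g x)‖ ≤ ∫ x, f x * ‖W k x‖
    refine norm_integral_le_of_norm_le (hIi k f) (Eventually.of_forall fun x => ?_)
    exact (norm_inner_le_norm _ _).trans_eq (mul_comm _ _)

end WeakLimit

/-! ### Perimeter measure and normal -/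

section Duality

variable {Ω E : Set (Space n)}

/-- The space of smooth vector fields with compact support in `U`. -/
def testFields (U : Set (Space n)) : Submodule ℝ (Space n → Space n) where
  carrier := {g | IsTest U g}
  add_mem' := fun h1 h2 => h1.add h2
  zero_mem' := ⟨contDiff_const, HasCompactSupport.zero, by simp [tsupport]⟩
  smul_mem' := fun c _ h => h.const_smul c

/-- A linear functional on test fields that is dominated by the `L¹` norm of a finite measure is
represented by a vector density. -/
lemma exists_density {μ : Measure (Space n)} [IsFiniteMeasure μ] (L : testFields Ω →ₗ[ℝ] ℝ)
    (hL : ∀ g : testFields Ω, |L g| ≤ ∫ x, ‖(g : Space n → Space n) x‖ ∂μ) :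
    ∃ ν : Space n → Space n, StronglyMeasurable ν ∧ MemLp ν 2 μ ∧
      ∀ g : testFields Ω, L g = ∫ x, inner ℝ (ν x) ((g : Space n → Space n) x) ∂μ := by
  have hmem : ∀ g : testFields Ω, MemLp (g : Space n → Space n) 2 μ := fun g =>
    g.2.continuous.memLp_of_hasCompactSupport g.2.hasCompactSupport
  let T : testFields Ω →ₗ[ℝ] Lp (Space n) 2 μ :=
    { toFun := fun g => (hmem g).toLp _
      map_add' := fun g h => rfl
      map_smul' := fun c g => rfl }
  -- As `μ` is finite, Hölder turns the `L¹` bound into an `L²` bound. This permits Riesz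
  -- representation in a Hilbert space in place of the dual of `L¹`.
  have hbound : ∀ g : testFields Ω, |L g| ≤ μ.real univ ^ (1 / 2 : ℝ) * ‖T g‖ := by
    intro g
    refine (hL g).trans ?_
    have h1 := eLpNorm_le_eLpNorm_mul_rpow_measure_univ (p := 1) (q := 2) one_le_two
      (hmem g).aestronglyMeasurable
    have h2 : ∫ x, ‖(g : Space n → Space n) x‖ ∂μ = (eLpNorm (g : Space n → Space n) 1 μ).toReal := by
      rw [eLpNorm_one_eq_lintegral_enorm, integral_norm_eq_lintegral_enorm
        (hmem g).aestronglyMeasurable]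
    have h3 : ‖T g‖ = (eLpNorm (g : Space n → Space n) 2 μ).toReal := Lp.norm_toLp _ (hmem g)
    rw [h2, h3, mul_comm, measureReal_def, ENNReal.toReal_rpow, ← ENNReal.toReal_mul]
    refine ENNReal.toReal_mono ?_ (h1.trans_eq ?_)
    · exact ENNReal.mul_ne_top (hmem g).eLpNorm_ne_top
        (ENNReal.rpow_ne_top_of_nonneg (by norm_num) (measure_ne_top _ _))
    · congr 2
      norm_num
  -- Fields that agree `μ`-a.e. have the same class, so `T` need not be injective; the bound shows
  -- that `L` still descends to the range of `T`.
  have hker : LinearMap.ker T ≤ LinearMap.ker L := fun g hg => by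
    rw [LinearMap.mem_ker] at hg ⊢
    have := hbound g
    rw [hg, norm_zero, mul_zero] at this
    exact abs_nonpos_iff.1 this
  let L₁ : LinearMap.range T →ₗ[ℝ] ℝ :=
    ((LinearMap.ker T).liftQ L hker).comp T.quotKerEquivRange.symm.toLinearMap
  have hL₁ : ∀ g, L₁ ⟨T g, LinearMap.mem_range_self T g⟩ = L g := fun g => by
    have : T.quotKerEquivRange.symm ⟨T g, LinearMap.mem_range_self T g⟩
        = (LinearMap.ker T).mkQ g := by
      rw [LinearEquiv.symm_apply_eq]
      rfl
    change (LinearMap.ker T).liftQ L hker (T.quotKerEquivRange.symm _) = _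
    rw [this]
    rfl
  let L₂ : LinearMap.range T →L[ℝ] ℝ := L₁.mkContinuous (μ.real univ ^ (1 / 2 : ℝ)) (by
    rintro ⟨_, g, rfl⟩
    rw [hL₁]
    exact hbound g)
  -- Hahn–Banach extends the functional from the range of `T` to all of `L²`, where it is an inner
  -- product with a fixed element.
  obtain ⟨L₃, hL₃, -⟩ := exists_extension_norm_eq (LinearMap.range T) L₂
  let N : Lp (Space n) 2 μ := (InnerProductSpace.toDual ℝ (Lp (Space n) 2 μ)).symm L₃
  refine ⟨N, Lp.stronglyMeasurable N, Lp.memLp N, fun g => ?_⟩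
  have h1 : L g = inner ℝ N (T g) := by
    rw [InnerProductSpace.toDual_symm_apply]
    rw [← hL₁ g]
    exact (hL₃ ⟨T g, LinearMap.mem_range_self T g⟩).symm
  rw [h1, MeasureTheory.L2.inner_def]
  refine integral_congr_ae ?_
  filter_upwards [(hmem g).coeFn_toLp] with x hx
  change inner ℝ (N x) ((hmem g).toLp _ x) = _
  rw [hx]

/-- The perimeter measure `μ` and the unit normal `σ` of the set `E` in `Ω`. -/
structure IsPerimeterMeasure (Ω E : Set (Space n)) (μ : Measure (Space n))
    (σ : Space n → Space n) : Prop where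
  finite : IsFiniteMeasure μ
  measurable : Measurable σ
  norm_eq_one : ∀ᵐ x ∂μ, ‖σ x‖ = 1
  compl : μ Ωᶜ = 0
  flux : ∀ g, IsTest Ω g → indicatorFlux E g = ∫ x, inner ℝ (σ x) (g x) ∂μ

/-- Polar decomposition of the represented derivative: the length of the density `ν` is absorbed
into the measure, its direction becomes the normal. -/
lemma exists_isPerimeterMeasure (hΩ : IsOpen Ω) (hE : MeasurableSet E)
    (hP : perimeter Ω E ≠ ⊤) : ∃ μ σ, IsPerimeterMeasure Ω E μ σ := by
  obtain ⟨W, hW1, hW2, hW3⟩ := exists_approx_fields hΩ hE hP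
  obtain ⟨μ₀, hfin, hμ₀⟩ := exists_finite_measure_dominating hW1 hW2
  let L : testFields Ω →ₗ[ℝ] ℝ :=
    { toFun := fun g => indicatorFlux E g
      map_add' := fun g h => IsTest.indicatorFlux_add hE g.2 h.2
      map_smul' := fun c g => IsTest.indicatorFlux_smul c g.2 }
  obtain ⟨ν, hνm, hν2, hν⟩ := exists_density L fun g =>
    hμ₀ g _ g.2.continuous g.2.hasCompactSupport (hW3 g g.2)
  have hν1 : Integrable ν μ₀ := hν2.integrable one_le_two
  have hνe : Measurable fun x => ‖ν x‖₊ := hνm.measurable.nnnorm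
  -- Test fields vanish off `Ω`, so restricting there loses nothing. Where `ν = 0` the direction is
  -- the default `0`, but the density vanishes as well.
  refine ⟨(μ₀.restrict Ω).withDensity fun x => ‖ν x‖₊, fun x => ‖ν x‖⁻¹ • ν x, ?_, ?_, ?_, ?_, ?_⟩
  · exact isFiniteMeasure_withDensity (hν1.integrableOn (s := Ω)).2.ne
  · exact hνm.measurable.norm.inv.smul hνm.measurable
  · rw [ae_withDensity_iff hνe.coe_nnreal_ennreal]
    refine Eventually.of_forall fun x hx => ?_
    have : ‖ν x‖ ≠ 0 := by simpa using hx
    rw [norm_smul, norm_inv, norm_norm, inv_mul_cancel₀ this]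
  · rw [withDensity_apply _ hΩ.measurableSet.compl, Measure.restrict_restrict
      hΩ.measurableSet.compl, compl_inter_self]
    simp
  · intro g hg
    rw [integral_withDensity_eq_integral_smul hνe]
    refine (hν ⟨g, hg⟩).trans ?_
    rw [← setIntegral_eq_integral_of_forall_compl_eq_zero (s := Ω)]
    · refine integral_congr_ae (Eventually.of_forall fun x => ?_)
      by_cases hx : ν x = 0
      · simp [hx]
      · have : ‖ν x‖ ≠ 0 := by simpa using hx
        simp only [inner_smul_left, NNReal.smul_def, coe_nnnorm, smul_eq_mul]
        simp [this]
    · intro x hx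
      simp [hg.comp_apply hx]

variable {U : Set (Space n)} {μ : Measure (Space n)} {σ : Space n → Space n}

lemma IsPerimeterMeasure.perimeter_le (h : IsPerimeterMeasure Ω E μ σ)
    (hUΩ : U ⊆ Ω) : perimeter U E ≤ μ U := by
  have := h.finite
  refine perimeter_le_of_forall fun g hg h1 => ?_
  rw [h.flux g (hg.mono hUΩ), ← setIntegral_eq_integral_of_forall_compl_eq_zero (s := U)
    fun x hx => by simp [hg.comp_apply hx]]
  refine ENNReal.ofReal_le_of_le_toReal ?_
  have h2 : ‖∫ x in U, inner ℝ (σ x) (g x) ∂μ‖ ≤ 1 * μ.real U := by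
    refine norm_setIntegral_le_of_norm_le_const_ae (measure_lt_top _ _) ?_
    filter_upwards [ae_restrict_of_ae h.norm_eq_one] with x hx
    refine (norm_inner_le_norm _ _).trans ?_
    rw [hx, one_mul]
    exact h1 x
  rw [one_mul] at h2
  exact (le_abs_self _).trans h2

/-- The normal itself is the optimal field: smooth approximations of `σ` in `L¹(μ)`, normalized and
cut off inside `U`, are competitors whose fluxes tend to `∫_U |σ|² dμ = μ(U)`. -/
lemma IsPerimeterMeasure.le_perimeter (h : IsPerimeterMeasure Ω E μ σ) (hU : IsOpen U)
    (hUΩ : U ⊆ Ω) : μ U ≤ perimeter U E := by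
  have := h.finite
  have hσb : ∀ᵐ x ∂(μ.restrict U), ‖σ x‖ ≤ 1 := by
    filter_upwards [ae_restrict_of_ae h.norm_eq_one] with x hx using hx.le
  have hσi : Integrable σ (μ.restrict U) :=
    Integrable.of_bound h.measurable.aestronglyMeasurable 1 hσb
  have happ : ∀ k : ℕ, ∃ G : Space n → Space n, ContDiff ℝ ∞ G ∧
      eLpNorm (G - σ) 1 (μ.restrict U) ≤ ENNReal.ofReal (1 / ((k : ℝ) + 1)) := by
    intro k
    -- Half of the error goes to a continuous compactly supported approximation, the other half to
    -- its uniform smooth approximation on a space of finite measure.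
    obtain ⟨f, hfc, hf, hfcont, -⟩ := (memLp_one_iff_integrable.2 hσi).exists_hasCompactSupport_eLpNorm_sub_le
      ENNReal.one_ne_top (ε := ENNReal.ofReal (1 / ((k : ℝ) + 1) / 2))
      (by simp; positivity)
    set m := (μ.restrict U).real univ with hm
    have hm0 : 0 ≤ m := measureReal_nonneg
    obtain ⟨G, hG, hGf⟩ := (hfc.uniformContinuous_of_continuous hfcont).exists_contDiff_dist_le
      (ε := 1 / ((k : ℝ) + 1) / 2 / (m + 1)) (by positivity)
    refine ⟨G, hG, ?_⟩
    have h1 : eLpNorm (G - f) 1 (μ.restrict U) ≤ ENNReal.ofReal (1 / ((k : ℝ) + 1) / 2) := by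
      refine (eLpNorm_le_of_ae_bound (C := 1 / ((k : ℝ) + 1) / 2 / (m + 1))
        (Eventually.of_forall fun x => ?_)).trans ?_
      · simpa [dist_eq_norm] using (hGf x).le
      · simp only [ENNReal.toReal_one, inv_one, ENNReal.rpow_one]
        rw [← ENNReal.ofReal_toReal (measure_ne_top (μ.restrict U) univ), ← ENNReal.ofReal_mul
          ENNReal.toReal_nonneg]
        refine ENNReal.ofReal_le_ofReal ?_
        change m * _ ≤ _
        rw [mul_div_assoc', div_le_iff₀ (by positivity)]
        have : (0 : ℝ) ≤ 1 / ((k : ℝ) + 1) / 2 := by positivity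
        nlinarith
    have h2 : G - σ = (G - f) + (f - σ) := by abel
    rw [h2]
    refine (eLpNorm_add_le ?_ ?_ le_rfl).trans ?_
    · exact (hG.continuous.sub hfcont).aestronglyMeasurable
    · exact hfcont.aestronglyMeasurable.sub h.measurable.aestronglyMeasurable
    · rw [eLpNorm_sub_comm f σ]
      refine (add_le_add h1 hf).trans_eq ?_
      rw [← ENNReal.ofReal_add (by positivity) (by positivity), add_halves]
  choose G hG hGσ using happ
  have hG0 : Tendsto (fun k => eLpNorm (G k - σ) 1 (μ.restrict U)) atTop (𝓝 0) := by
    refine tendsto_of_tendsto_of_tendsto_of_le_of_le tendsto_const_nhds ?_ (fun _ => zero_le) hGσ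
    have := ENNReal.tendsto_ofReal (tendsto_one_div_add_atTop_nhds_zero_nat (𝕜 := ℝ))
    rwa [ENNReal.ofReal_zero] at this
  obtain ⟨ns, hns, hae⟩ := (tendstoInMeasure_of_tendsto_eLpNorm one_ne_zero
    (fun k => (hG k).continuous.aestronglyMeasurable) h.measurable.aestronglyMeasurable
    hG0).exists_seq_tendsto_ae
  obtain ⟨ζ, hζ, hζ01, hζ1⟩ := exists_cutoff_seq hU
  -- As `δ k → 0`, the regularized direction converges to `σ / |σ| = σ` a.e.
  let δ : ℕ → ℝ := fun k => 1 / ((k : ℝ) + 1)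
  have hδ : ∀ k, 0 < δ k := fun k => by positivity
  let g : ℕ → Space n → Space n := fun k x =>
    ζ k x • ((Real.sqrt (δ k ^ 2 + ‖G (ns k) x‖ ^ 2))⁻¹ • G (ns k) x)
  have hgt : ∀ k, IsTest U (g k) := fun k => (hζ k).smul_right
    ((contDiff_inv_sqrt_sq_add (hG _) (hδ k)).smul (hG _))
  have hg1 : ∀ k x, ‖g k x‖ ≤ 1 := fun k x => by
    rw [norm_smul, Real.norm_of_nonneg (hζ01 k x).1]
    exact mul_le_one₀ (hζ01 k x).2 (norm_nonneg _) (norm_normalized_le (hδ k) _)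
  have hlim : Tendsto (fun k => ∫ x in U, inner ℝ (σ x) (g k x) ∂μ) atTop
      (𝓝 (∫ x in U, (1 : ℝ) ∂μ)) := by
    refine tendsto_integral_of_dominated_convergence (fun _ => (1 : ℝ)) ?_ (integrable_const _) ?_ ?_
    · exact fun k => h.measurable.aestronglyMeasurable.inner (hgt k).continuous.aestronglyMeasurable
    · intro k
      filter_upwards [hσb] with x hx
      exact (norm_inner_le_norm _ _).trans (mul_le_one₀ hx (norm_nonneg _) (hg1 k x))
    · filter_upwards [hae, ae_restrict_of_ae h.norm_eq_one, ae_restrict_mem hU.measurableSet]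
        with x hx hx1 hxU
      have h1 : ∀ᶠ k in atTop, ζ k x = 1 := by
        filter_upwards [hζ1 {x} (by simpa using hxU) isCompact_singleton] with k hk
        exact hk x rfl
      have h2 : Tendsto (fun k => (Real.sqrt (δ k ^ 2 + ‖G (ns k) x‖ ^ 2))⁻¹ • G (ns k) x) atTop
          (𝓝 ((Real.sqrt (0 ^ 2 + ‖σ x‖ ^ 2))⁻¹ • σ x)) := by
        refine Tendsto.smul (Tendsto.inv₀ ?_ ?_) hx
        · exact (Real.continuous_sqrt.tendsto _).comp
            ((tendsto_one_div_add_atTop_nhds_zero_nat.pow 2).add (hx.norm.pow 2))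
        · simp [hx1]
      have h3 : Tendsto (fun k => g k x) atTop (𝓝 (σ x)) := by
        simp only [hx1] at h2
        simp only [ne_eq, OfNat.ofNat_ne_zero, not_false_eq_true, zero_pow, one_pow, zero_add,
          Real.sqrt_one, inv_one, one_smul] at h2
        refine h2.congr' (h1.mono fun k hk => ?_)
        simp [g, hk]
      have h4 := (tendsto_const_nhds (x := σ x)).inner (𝕜 := ℝ) h3
      rwa [real_inner_self_eq_norm_sq, hx1, one_pow] at h4
  by_cases hP : perimeter U E = ⊤
  · simp [hP]
  have hle : ∫ x in U, (1 : ℝ) ∂μ ≤ (perimeter U E).toReal := by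
    refine le_of_tendsto hlim (Eventually.of_forall fun k => ?_)
    have h1 := (hgt k).indicatorFlux_le hP (hg1 k)
    rwa [h.flux _ ((hgt k).mono hUΩ), ← setIntegral_eq_integral_of_forall_compl_eq_zero (s := U)
      fun x hx => by simp [(hgt k).comp_apply hx]] at h1
  rw [setIntegral_const, smul_eq_mul, mul_one] at hle
  rw [← ENNReal.ofReal_toReal (measure_ne_top μ U)]
  exact ENNReal.ofReal_le_of_le_toReal hle

/-- A single measure on `Ω` gives the perimeter in all balls at once, which replaces the suprema in
`Φ`. -/
lemma IsPerimeterMeasure.perimeter_eq (h : IsPerimeterMeasure Ω E μ σ) (hU : IsOpen U)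
    (hUΩ : U ⊆ Ω) : perimeter U E = μ U :=
  le_antisymm (h.perimeter_le hUΩ) (h.le_perimeter hU hUΩ)

end Duality

/-! ### Radial dilations and the Piola identity -/

/-- A small radial dilation field `x ↦ h(x) x` supported in `Ω`, with `∇h(x) = c(x) x`. -/
structure IsRadialPerturbation (Ω : Set (Space n)) (h c : Space n → ℝ) : Prop where
  isTest : IsTest Ω h
  contDiff : ContDiff ℝ ∞ c
  fderiv_eq : ∀ x v, fderiv ℝ h x v = c x * inner ℝ x v
  abs_apply_le : ∀ x, |h x| ≤ 1 / 4
  abs_mul_le : ∀ x, |c x| * ‖x‖ ^ 2 ≤ 1 / 4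

namespace IsRadialPerturbation

variable {Ω : Set (Space n)} {h c : Space n → ℝ}

/-- The tangential stretching factor. -/
abbrev tang (h : Space n → ℝ) (x : Space n) : ℝ := 1 + h x

/-- The radial stretching factor. -/
abbrev rad (h c : Space n → ℝ) (x : Space n) : ℝ := 1 + h x + c x * ‖x‖ ^ 2

/-- The Jacobian determinant of the radial dilation. -/
abbrev jac (h c : Space n → ℝ) (x : Space n) : ℝ := tang h x ^ (n - 1) * rad h c x

/-- The radial dilation. -/
def dilate (h : Space n → ℝ) (x : Space n) : Space n := x + h x • x

/-- The derivative of the radial dilation. -/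
def dDilate (h c : Space n → ℝ) (x : Space n) : Space n →L[ℝ] Space n :=
  tang h x • ContinuousLinearMap.id ℝ (Space n) + (c x • innerSL ℝ x).smulRight x

/-- The inverse of the derivative of the radial dilation. -/
def dDilateInv (h c : Space n → ℝ) (x : Space n) : Space n →L[ℝ] Space n :=
  (tang h x)⁻¹ • (ContinuousLinearMap.id ℝ (Space n)
    - ((c x / rad h c x) • innerSL ℝ x).smulRight x)

lemma dDilate_apply (x v : Space n) :
    dDilate h c x v = tang h x • v + (c x * inner ℝ x v) • x := by
  simp [dDilate]

lemma dDilateInv_apply (x v : Space n) :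
    dDilateInv h c x v = (tang h x)⁻¹ • (v - (c x / rad h c x * inner ℝ x v) • x) := by
  simp [dDilateInv]

/-- The derivative is a multiple of the identity plus `c x ⊗ x`, hence symmetric; no transpose
appears in the transformation of gradients and normals. -/
lemma inner_dDilateInv (y v w : Space n) :
    inner ℝ v (dDilateInv h c y w) = inner ℝ (dDilateInv h c y v) w := by
  simp only [dDilateInv_apply, inner_smul_left, inner_smul_right, inner_sub_left, inner_sub_right]
  rw [real_inner_comm v y]
  simp only [conj_trivial]
  ring

section

variable (H : IsRadialPerturbation Ω h c)
include H

lemma tang_mem (x : Space n) : tang h x ∈ Icc (3 / 4 : ℝ) (5 / 4) := by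
  have := abs_le.1 (H.abs_apply_le x)
  constructor <;> simp only [tang] <;> linarith [this.1, this.2]

lemma rad_mem (x : Space n) : rad h c x ∈ Icc (1 / 2 : ℝ) (3 / 2) := by
  have h1 := abs_le.1 (H.abs_apply_le x)
  have h2 : |c x * ‖x‖ ^ 2| ≤ 1 / 4 := by
    rw [abs_mul, abs_of_nonneg (sq_nonneg ‖x‖)]
    exact H.abs_mul_le x
  have h3 := abs_le.1 h2
  constructor <;> simp only [rad] <;> linarith [h1.1, h1.2, h3.1, h3.2]

lemma tang_pos (x : Space n) : 0 < tang h x := by linarith [(H.tang_mem x).1]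

lemma rad_pos (x : Space n) : 0 < rad h c x := by linarith [(H.rad_mem x).1]

lemma jac_pos (x : Space n) : 0 < jac h c x := mul_pos (pow_pos (H.tang_pos x) _) (H.rad_pos x)

lemma jac_le (x : Space n) : jac h c x ≤ 2 ^ (n - 1) * 2 := by
  have h1 := H.tang_mem x
  have h2 := H.rad_mem x
  refine mul_le_mul (pow_le_pow_left₀ (H.tang_pos x).le (by linarith [h1.2]) _)
    (by linarith [h2.2]) (H.rad_pos x).le (by positivity)

lemma dDilate_inv_right (x v : Space n) : dDilate h c x (dDilateInv h c x v) = v := by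
  have h1 := (H.tang_pos x).ne'
  have h2 := (H.rad_pos x).ne'
  rw [dDilate_apply, dDilateInv_apply]
  simp only [inner_smul_right, inner_sub_right, real_inner_self_eq_norm_sq]
  rw [smul_smul, mul_inv_cancel₀ h1, one_smul, sub_add, sub_eq_self, ← sub_smul]
  refine smul_eq_zero_of_left ?_ _
  field_simp
  ring

lemma dDilate_inv_left (x v : Space n) : dDilateInv h c x (dDilate h c x v) = v := by
  have h1 := (H.tang_pos x).ne'
  have h2 := (H.rad_pos x).ne'
  rw [dDilateInv_apply, dDilate_apply]
  simp only [inner_smul_right, inner_add_right, real_inner_self_eq_norm_sq]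
  rw [inv_smul_eq_iff₀ h1, add_sub_assoc, add_eq_left, ← sub_smul]
  refine smul_eq_zero_of_left ?_ _
  field_simp
  ring

lemma hasFDerivAt_dilate (x : Space n) : HasFDerivAt (dilate h) (dDilate h c x) x := by
  have h1 : HasFDerivAt (dilate h) (ContinuousLinearMap.id ℝ (Space n)
      + (h x • ContinuousLinearMap.id ℝ (Space n) + (fderiv ℝ h x).smulRight x)) x :=
    (hasFDerivAt_id x).add ((H.isTest.differentiable x).hasFDerivAt.smul (hasFDerivAt_id x))
  convert h1 using 1
  ext1 v
  rw [dDilate_apply]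
  simp only [add_apply, smul_apply,
    ContinuousLinearMap.smulRight_apply, ContinuousLinearMap.id_apply, H.fderiv_eq, tang, add_smul,
    one_smul, add_assoc]

lemma contDiff_dilate : ContDiff ℝ ∞ (dilate h) :=
  contDiff_id.add (H.isTest.contDiff.smul contDiff_id)

/-- The two bounds `1/4` in `IsRadialPerturbation` add up to a Lipschitz constant `1/2` for the
difference from the identity. Being less than `1`, it makes the dilation a global homeomorphism. -/
lemma approximatesLinearOn_dilate : ApproximatesLinearOn (dilate h)
    ((ContinuousLinearEquiv.refl ℝ (Space n) : Space n ≃L[ℝ] Space n) : Space n →L[ℝ] Space n)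
    univ (1 / 2) := by
  refine LipschitzOnWith.approximatesLinearOn ?_
  have hd : ∀ x, HasFDerivAt (dilate h - ⇑((ContinuousLinearEquiv.refl ℝ (Space n) :
      Space n ≃L[ℝ] Space n) : Space n →L[ℝ] Space n))
      (dDilate h c x - ContinuousLinearMap.id ℝ (Space n)) x := fun x =>
    (H.hasFDerivAt_dilate x).sub (ContinuousLinearMap.hasFDerivAt _)
  refine Convex.lipschitzOnWith_of_nnnorm_hasFDerivWithin_le
    (fun x _ => (hd x).hasFDerivWithinAt) (fun x _ => ?_) convex_univ
  rw [← NNReal.coe_le_coe, coe_nnnorm]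
  refine ContinuousLinearMap.opNorm_le_bound _ (by positivity) fun v => ?_
  have e : (dDilate h c x - ContinuousLinearMap.id ℝ (Space n)) v
      = h x • v + (c x * inner ℝ x v) • x := by
    rw [sub_apply, dDilate_apply, ContinuousLinearMap.id_apply, add_smul,
      one_smul]
    abel
  rw [e]
  calc ‖h x • v + (c x * inner ℝ x v) • x‖ ≤ |h x| * ‖v‖ + |c x| * |inner ℝ x v| * ‖x‖ := by
        refine (norm_add_le _ _).trans_eq ?_
        rw [norm_smul, norm_smul, norm_mul]
        rfl
    _ ≤ 1 / 4 * ‖v‖ + |c x| * (‖x‖ * ‖v‖) * ‖x‖ := by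
        gcongr
        · exact H.abs_apply_le x
        · exact abs_real_inner_le_norm x v
    _ = 1 / 4 * ‖v‖ + |c x| * ‖x‖ ^ 2 * ‖v‖ := by ring
    _ ≤ 1 / 4 * ‖v‖ + 1 / 4 * ‖v‖ := by
        gcongr
        exact H.abs_mul_le x
    _ = ((1 / 2 : NNReal) : ℝ) * ‖v‖ := by
        push_cast
        ring

lemma exists_homeomorph : ∃ T : Space n ≃ₜ Space n, (T : Space n → Space n) = dilate h ∧
    ContDiff ℝ ∞ (T.symm : Space n → Space n) := by
  have hc : Subsingleton (Space n) ∨ (1 / 2 : NNReal)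
      < ‖((ContinuousLinearEquiv.refl ℝ (Space n)).symm : Space n →L[ℝ] Space n)‖₊⁻¹ := by
    rcases subsingleton_or_nontrivial (Space n) with hs | hs
    · exact Or.inl hs
    · right
      have : ‖((ContinuousLinearEquiv.refl ℝ (Space n)).symm : Space n →L[ℝ] Space n)‖₊ = 1 := by
        rw [← NNReal.coe_inj]
        simp
      rw [this, inv_one]
      exact NNReal.half_lt_self one_ne_zero
  let T := H.approximatesLinearOn_dilate.toHomeomorph _ hc
  have hT : (T : Space n → Space n) = dilate h := rfl
  refine ⟨T, hT, ?_⟩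
  refine T.contDiff_symm (f₀' := fun x => ContinuousLinearEquiv.equivOfInverse (dDilate h c x)
    (dDilateInv h c x) (H.dDilate_inv_left x) (H.dDilate_inv_right x)) (fun x => ?_) ?_
  · rw [hT]
    exact H.hasFDerivAt_dilate x
  · rw [hT]
    exact H.contDiff_dilate

/-- The radial dilation as a homeomorphism. -/
def homeo : Space n ≃ₜ Space n := H.exists_homeomorph.choose

lemma coe_homeo : (H.homeo : Space n → Space n) = dilate h := H.exists_homeomorph.choose_spec.1

lemma contDiff_symm : ContDiff ℝ ∞ (H.homeo.symm : Space n → Space n) :=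
  H.exists_homeomorph.choose_spec.2

lemma contDiff_homeo : ContDiff ℝ ∞ (H.homeo : Space n → Space n) := by
  rw [H.coe_homeo]
  exact H.contDiff_dilate

lemma hasFDerivAt_homeo (x : Space n) : HasFDerivAt H.homeo (dDilate h c x) x := by
  rw [H.coe_homeo]
  exact H.hasFDerivAt_dilate x

lemma homeo_of_notMem {x : Space n} (hx : x ∉ tsupport h) : H.homeo x = x := by
  rw [H.coe_homeo, dilate, image_eq_zero_of_notMem_tsupport hx, zero_smul, add_zero]

/-- The map is injective and is the identity off the support of `h`, which lies in `Ω`; so no point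
can cross the boundary. -/
lemma homeo_mem_iff (x : Space n) : H.homeo x ∈ Ω ↔ x ∈ Ω := by
  constructor
  · intro hx
    by_contra hn
    rw [H.homeo_of_notMem fun h' => hn (H.isTest.tsupport_subset h')] at hx
    exact hn hx
  · intro hx
    by_contra hn
    have h1 := H.homeo_of_notMem (x := H.homeo x) fun h' => hn (H.isTest.tsupport_subset h')
    rw [H.homeo.injective h1] at hn
    exact hn hx

lemma symm_mem_iff (x : Space n) : H.homeo.symm x ∈ Ω ↔ x ∈ Ω := by
  conv_rhs => rw [← H.homeo.apply_symm_apply x, H.homeo_mem_iff]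

lemma image_eq : H.homeo '' Ω = Ω := by
  ext x
  constructor
  · rintro ⟨y, hy, rfl⟩
    exact (H.homeo_mem_iff y).2 hy
  · exact fun hx => ⟨H.homeo.symm x, (H.symm_mem_iff x).2 hx, H.homeo.apply_symm_apply x⟩

lemma symm_of_notMem {x : Space n} (hx : x ∉ tsupport h) : H.homeo.symm x = x := by
  rw [Homeomorph.symm_apply_eq, H.homeo_of_notMem hx]

/-- The derivative is `tang` times a transvection of determinant `1 + c |x|² / tang`. Multiplying by
`tang ^ n` gives `tang ^ (n - 1) * rad`, which needs `n ≥ 1`. -/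
lemma det_dDilate (hn : 1 ≤ n) (x : Space n) : (dDilate h c x).det = jac h c x := by
  have h1 := (H.tang_pos x).ne'
  have e : (dDilate h c x : Space n →ₗ[ℝ] Space n) = tang h x •
      LinearMap.transvection ((c x / tang h x) • (innerSL ℝ x : Space n →ₗ[ℝ] ℝ)) x := by
    ext1 v
    rw [ContinuousLinearMap.coe_coe, dDilate_apply, LinearMap.smul_apply,
      LinearMap.transvection.apply, smul_add, smul_smul]
    simp only [LinearMap.smul_apply, ContinuousLinearMap.coe_coe, innerSL_apply_apply, smul_eq_mul]
    congr 2
    field_simp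
  rw [ContinuousLinearMap.det, e, LinearMap.det_smul, LinearMap.transvection.det]
  simp only [LinearMap.smul_apply, ContinuousLinearMap.coe_coe, innerSL_apply_apply, smul_eq_mul,
    real_inner_self_eq_norm_sq, finrank_euclideanSpace, Fintype.card_fin]
  obtain ⟨m, rfl⟩ : ∃ m, n = m + 1 := ⟨n - 1, by omega⟩
  simp only [jac, Nat.add_sub_cancel, pow_succ, rad]
  field_simp

lemma integral_comp (hn : 1 ≤ n) {F : Type*} [NormedAddCommGroup F] [NormedSpace ℝ F]
    (f : Space n → F) : ∫ x, f x = ∫ y, jac h c y • f (H.homeo y) := by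
  have := integral_image_eq_integral_abs_det_fderiv_smul volume MeasurableSet.univ
    (fun x _ => (H.hasFDerivAt_homeo x).hasFDerivWithinAt) H.homeo.injective.injOn f
  rw [image_univ, H.homeo.surjective.range_eq, Measure.restrict_univ] at this
  rw [this]
  simp only [H.det_dDilate hn, abs_of_pos (H.jac_pos _)]

lemma lintegral_comp (hn : 1 ≤ n) (hΩ : MeasurableSet Ω) (f : Space n → ℝ≥0∞) :
    ∫⁻ x in Ω, f x = ∫⁻ y in Ω, ENNReal.ofReal (jac h c y) * f (H.homeo y) := by
  have := lintegral_image_eq_lintegral_abs_det_fderiv_mul volume hΩ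
    (fun x _ => (H.hasFDerivAt_homeo x).hasFDerivWithinAt) H.homeo.injective.injOn f
  rw [H.image_eq] at this
  rw [this]
  simp only [H.det_dDilate hn, abs_of_pos (H.jac_pos _)]

lemma contDiff_tang : ContDiff ℝ ∞ (tang h) := contDiff_const.add H.isTest.contDiff

lemma contDiff_rad : ContDiff ℝ ∞ (rad h c) :=
  (contDiff_const.add H.isTest.contDiff).add (H.contDiff.mul (contDiff_id.norm_sq ℝ))

/-- The pull-back of a vector field as a flux. -/
def pullback (g : Space n → Space n) (y : Space n) : Space n :=
  jac h c y • dDilateInv h c y (g (H.homeo y))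

lemma isTest_pullback {g : Space n → Space n} (hg : IsTest Ω g) : IsTest Ω (H.pullback g) := by
  have hs : tsupport (H.pullback g) ⊆ H.homeo ⁻¹' tsupport g := by
    refine closure_minimal (fun x hx => ?_) ((isClosed_tsupport g).preimage H.homeo.continuous)
    refine subset_tsupport g fun h0 => hx ?_
    rw [pullback, h0, map_zero, smul_zero]
  have hgh : ContDiff ℝ ∞ fun y => g (H.homeo y) := hg.contDiff.comp H.contDiff_homeo
  refine ⟨?_, ?_, fun x hx => (H.homeo_mem_iff x).1 (hg.tsupport_subset (hs hx))⟩
  · unfold pullback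
    simp only [dDilateInv_apply]
    refine ContDiff.smul ((H.contDiff_tang.pow _).mul H.contDiff_rad) (ContDiff.smul
      (H.contDiff_tang.inv fun x => (H.tang_pos x).ne') (hgh.sub (ContDiff.smul
        (ContDiff.mul (H.contDiff.div H.contDiff_rad fun x => (H.rad_pos x).ne') ?_) contDiff_id)))
    exact contDiff_id.inner ℝ hgh
  · exact (H.homeo.isCompact_preimage.2 hg.hasCompactSupport).of_isClosed_subset
      (isClosed_tsupport _) hs

lemma hasFDerivAt_symm (y : Space n) :
    HasFDerivAt (H.homeo.symm : Space n → Space n) (dDilateInv h c y) (H.homeo y) := by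
  have h1 : HasFDerivAt (H.homeo : Space n → Space n) ((ContinuousLinearEquiv.equivOfInverse
      (dDilate h c y) (dDilateInv h c y) (H.dDilate_inv_left y) (H.dDilate_inv_right y) :
      Space n ≃L[ℝ] Space n) : Space n →L[ℝ] Space n) (H.homeo.symm (H.homeo y)) := by
    rw [H.homeo.symm_apply_apply]
    exact H.hasFDerivAt_homeo y
  exact h1.of_local_left_inverse H.homeo.symm.continuous.continuousAt
    (Eventually.of_forall fun z => H.homeo.apply_symm_apply z)

/-- The Piola identity. -/
lemma divergence_pullback (hn : 1 ≤ n) {g : Space n → Space n} (hg : IsTest Ω g) :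
    ∀ᵐ y, divergence (H.pullback g) y = jac h c y * divergence g (H.homeo y) := by
  have hp := H.isTest_pullback hg
  have hcj : Continuous fun y => jac h c y * divergence g (H.homeo y) :=
    ((H.contDiff_tang.pow _).mul H.contDiff_rad).continuous.mul
      (hg.divergence.continuous.comp H.homeo.continuous)
  -- Both sides are paired with a smooth compactly supported `w`. Integration by parts before and
  -- after the change of variables reduces the claim to the chain rule for `w ∘ T⁻¹`; the Jacobian
  -- is never differentiated.
  refine ae_eq_of_integral_contDiff_smul_eq hp.divergence.continuous.locallyIntegrable
    hcj.locallyIntegrable fun w hw hwc => ?_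
  have hws : ContDiff ℝ ∞ fun x => w (H.homeo.symm x) := hw.comp H.contDiff_symm
  have h1 := (isWeakGradient_of_contDiff hw Ω).integral_mul_divergence hp
  have h2 := (isWeakGradient_of_contDiff hws Ω).integral_mul_divergence hg
  rw [H.integral_comp hn, H.integral_comp hn (fun x => inner ℝ _ _)] at h2
  simp only [smul_eq_mul]
  rw [h1]
  refine Eq.trans ?_ (h2.symm.trans ?_)
  · refine congrArg _ (integral_congr_ae (Eventually.of_forall fun y => ?_))
    have e := ((hw.differentiable (by simp) (H.homeo.symm (H.homeo y))).hasFDerivAt.comp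
      (H.homeo y) (H.hasFDerivAt_symm y)).fderiv
    have e' : fderiv ℝ (fun x => w (H.homeo.symm x)) (H.homeo y)
      = (fderiv ℝ w (H.homeo.symm (H.homeo y))).comp (dDilateInv h c y) := e
    simp only [pullback, inner_gradient_left', e', map_smul, ContinuousLinearMap.comp_apply,
      H.homeo.symm_apply_apply]
  · refine integral_congr_ae (Eventually.of_forall fun y => ?_)
    simp only [H.homeo.symm_apply_apply, smul_eq_mul]
    ring

/-- No regularity of `w` is required, so this serves both the weak gradient of the moved function
and the perimeter of the moved set. -/
lemma integral_comp_symm_mul_divergence (hn : 1 ≤ n) (w : Space n → ℝ) {g : Space n → Space n}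
    (hg : IsTest Ω g) : ∫ x, w (H.homeo.symm x) * divergence g x
      = ∫ y, w y * divergence (H.pullback g) y := by
  rw [H.integral_comp hn]
  refine integral_congr_ae ?_
  filter_upwards [H.divergence_pullback hn hg] with y hy
  rw [hy, H.homeo.symm_apply_apply, smul_eq_mul]
  ring

/-- The preimage of a null set under the inverse is its image under a differentiable map, hence
null. The a.e. constraints of admissibility are transported in this way. -/
lemma quasiMeasurePreserving_symm :
    Measure.QuasiMeasurePreserving (H.homeo.symm : Space n → Space n) (volume.restrict Ω)
      (volume.restrict Ω) := by
  refine ⟨H.homeo.symm.continuous.measurable, ?_⟩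
  refine Measure.AbsolutelyContinuous.mk fun s hs h0 => ?_
  rw [Measure.map_apply H.homeo.symm.continuous.measurable hs]
  rw [Measure.restrict_apply hs] at h0
  rw [Measure.restrict_apply (H.homeo.symm.continuous.measurable hs)]
  refine measure_mono_null ?_ (addHaar_image_eq_zero_of_differentiableOn_of_addHaar_eq_zero volume
    (f := H.homeo) (fun x _ => (H.hasFDerivAt_homeo x).differentiableAt.differentiableWithinAt) h0)
  rintro x ⟨hx, hxΩ⟩
  exact ⟨H.homeo.symm x, ⟨hx, (H.symm_mem_iff x).2 hxΩ⟩, H.homeo.apply_symm_apply x⟩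

lemma memLp_comp_symm (hn : 1 ≤ n) (hΩ : MeasurableSet Ω) {F : Type*} [NormedAddCommGroup F]
    {f : Space n → F} (hf : MemLp f 2 (volume.restrict Ω)) :
    MemLp (fun x => f (H.homeo.symm x)) 2 (volume.restrict Ω) := by
  refine ⟨hf.1.comp_quasiMeasurePreserving H.quasiMeasurePreserving_symm, ?_⟩
  have h2 := lintegral_rpow_enorm_lt_top_of_eLpNorm_lt_top two_ne_zero ENNReal.ofNat_ne_top hf.2
  refine (eLpNorm_lt_top_iff_lintegral_rpow_enorm_lt_top two_ne_zero ENNReal.ofNat_ne_top).2 ?_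
  rw [H.lintegral_comp hn hΩ]
  simp only [H.homeo.symm_apply_apply]
  refine lt_of_le_of_lt (lintegral_mono fun y => mul_le_mul_left (ENNReal.ofReal_le_ofReal
    (H.jac_le y)) _) ?_
  rw [lintegral_const_mul' _ _ ENNReal.ofReal_ne_top]
  exact ENNReal.mul_lt_top ENNReal.ofReal_lt_top h2

lemma norm_dDilateInv_le (y v : Space n) : ‖dDilateInv h c y v‖ ≤ 2 * ‖v‖ := by
  have h1 := H.tang_mem y
  have h2 := H.rad_mem y
  have h3 := H.abs_mul_le y
  rw [dDilateInv_apply, norm_smul, norm_inv, Real.norm_of_nonneg (H.tang_pos y).le]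
  have h4 : ‖(c y / rad h c y * inner ℝ y v) • y‖ ≤ 1 / 2 * ‖v‖ := by
    rw [norm_smul, norm_mul, norm_div, Real.norm_of_nonneg (H.rad_pos y).le, Real.norm_eq_abs,
      Real.norm_eq_abs]
    calc |c y| / rad h c y * |inner ℝ y v| * ‖y‖ ≤ |c y| / (1 / 2) * (‖y‖ * ‖v‖) * ‖y‖ := by
          gcongr
          · exact h2.1
          · exact abs_real_inner_le_norm y v
      _ = 2 * (|c y| * ‖y‖ ^ 2) * ‖v‖ := by ring
      _ ≤ 2 * (1 / 4) * ‖v‖ := by gcongr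
      _ = 1 / 2 * ‖v‖ := by ring
  calc (tang h y)⁻¹ * ‖v - (c y / rad h c y * inner ℝ y v) • y‖
      ≤ (3 / 4)⁻¹ * (‖v‖ + 1 / 2 * ‖v‖) := by
        gcongr
        · exact h1.1
        · exact (norm_sub_le _ _).trans (by gcongr)
    _ = 2 * ‖v‖ := by ring

lemma continuous_dDilateInv : Continuous fun z : Space n × Space n => dDilateInv h c z.1 z.2 := by
  simp only [dDilateInv_apply]
  have h1 := H.contDiff_tang.continuous
  have h2 := H.contDiff_rad.continuous
  have h3 := H.contDiff.continuous
  refine Continuous.smul ((h1.comp continuous_fst).inv₀ fun z => (H.tang_pos _).ne')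
    (continuous_snd.sub (Continuous.smul (Continuous.mul (Continuous.div (h3.comp continuous_fst)
      (h2.comp continuous_fst) fun z => (H.rad_pos _).ne')
      (continuous_fst.inner continuous_snd)) continuous_fst))

lemma memLp_dDilateInv {p : Space n → Space n} (hp : MemLp p 2 (volume.restrict Ω)) :
    MemLp (fun y => dDilateInv h c y (p y)) 2 (volume.restrict Ω) := by
  refine MemLp.of_le_mul hp ?_ (Eventually.of_forall fun y => H.norm_dDilateInv_le y (p y))
  exact H.continuous_dDilateInv.comp_aestronglyMeasurable
    (aestronglyMeasurable_id.prodMk hp.1)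

variable {u : Space n → ℝ} {p : Space n → Space n}

/-- The chain rule, obtained by duality: a test field is pulled back as a flux, tested against the
weak gradient of `u`, and carried back by symmetry of the inverse derivative. No approximation of
`u` is involved. -/
lemma isWeakGradient_comp_symm (hn : 1 ≤ n) (hΩ : MeasurableSet Ω)
    (hu : MemLp u 2 (volume.restrict Ω)) (hp : MemLp p 2 (volume.restrict Ω))
    (hw : IsWeakGradient Ω u p) :
    IsWeakGradient Ω (fun x => u (H.homeo.symm x))
      (fun x => dDilateInv h c (H.homeo.symm x) (p (H.homeo.symm x))) := by
  refine isWeakGradient_of_integral_mul_divergence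
    (locallyIntegrableOn_of_memLp (H.memLp_comp_symm hn hΩ hu))
    (locallyIntegrableOn_of_memLp (H.memLp_comp_symm hn hΩ (H.memLp_dDilateInv hp)))
    fun g hg => ?_
  rw [H.integral_comp_symm_mul_divergence hn u hg,
    hw.integral_mul_divergence (H.isTest_pullback hg), H.integral_comp hn (fun x =>
      inner ℝ (dDilateInv h c (H.homeo.symm x) (p (H.homeo.symm x))) (g x))]
  refine congrArg _ (integral_congr_ae (Eventually.of_forall fun y => ?_))
  simp only [pullback, inner_smul_right, inner_dDilateInv, H.homeo.symm_apply_apply, smul_eq_mul]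

end

end IsRadialPerturbation

/-! ### Represented pairs and comparison with dilations -/

lemma lintegral_enorm_sq {F : Type*} [NormedAddCommGroup F] {μ : Measure (Space n)}
    {f : Space n → F} (hf : MemLp f 2 μ) :
    ∫⁻ x, ‖f x‖ₑ ^ 2 ∂μ = ENNReal.ofReal (∫ x, ‖f x‖ ^ 2 ∂μ) := by
  rw [ofReal_integral_eq_lintegral_ofReal (hf.integrable_norm_pow (by norm_num))
    (Eventually.of_forall fun x => by positivity)]
  refine lintegral_congr fun x => ?_
  rw [ENNReal.ofReal_pow (norm_nonneg _), ofReal_norm]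

/-- An admissible pair together with its weak gradient, its perimeter measure and its normal. -/
structure IsRepresented (Ω : Set (Space n)) (u : Space n → ℝ) (E : Set (Space n))
    (p : Space n → Space n) (μ : Measure (Space n)) (σ : Space n → Space n) : Prop where
  isOpen : IsOpen Ω
  admissible : Admissible Ω u E
  isWeakGradient : IsWeakGradient Ω u p
  memLp : MemLp p 2 (volume.restrict Ω)
  isPerimeterMeasure : IsPerimeterMeasure Ω E μ σ

lemma Admissible.exists_isRepresented {Ω : Set (Space n)} {u : Space n → ℝ} {E : Set (Space n)}
    (hΩ : IsOpen Ω) (h : Admissible Ω u E) : ∃ p μ σ, IsRepresented Ω u E p μ σ := by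
  obtain ⟨p, hp, hp2⟩ := h.memH1.2
  obtain ⟨μ, σ, hμ⟩ := exists_isPerimeterMeasure hΩ h.measurableSet h.perimeter_ne_top
  exact ⟨p, μ, σ, hΩ, h, hp, hp2, hμ⟩

namespace IsRepresented

variable {Ω E : Set (Space n)} {u : Space n → ℝ} {p : Space n → Space n} {μ : Measure (Space n)}
  {σ : Space n → Space n} (R : IsRepresented Ω u E p μ σ)
include R

lemma energy_eq {U : Set (Space n)} (hU : IsOpen U) (hUΩ : U ⊆ Ω) :
    energy U u E = ENNReal.ofReal (∫ x in U, ‖p x‖ ^ 2) + μ U := by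
  rw [energy, (R.isWeakGradient.mono hUΩ).dirichletEnergy_eq hU,
    lintegral_enorm_sq (R.memLp.mono_measure (Measure.restrict_mono hUΩ le_rfl)),
    R.isPerimeterMeasure.perimeter_eq hU hUΩ]

lemma energy_ne_top {U : Set (Space n)} (hU : IsOpen U) (hUΩ : U ⊆ Ω) : energy U u E ≠ ⊤ := by
  have := R.isPerimeterMeasure.finite
  rw [R.energy_eq hU hUΩ]
  exact ENNReal.add_ne_top.2 ⟨ENNReal.ofReal_ne_top, measure_ne_top _ _⟩

lemma toReal_energy {U : Set (Space n)} (hU : IsOpen U) (hUΩ : U ⊆ Ω) :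
    (energy U u E).toReal = (∫ x in U, ‖p x‖ ^ 2) + μ.real U := by
  have := R.isPerimeterMeasure.finite
  rw [R.energy_eq hU hUΩ, ENNReal.toReal_add ENNReal.ofReal_ne_top (measure_ne_top _ _),
    ENNReal.toReal_ofReal (integral_nonneg fun x => by positivity)]
  rfl

open IsRadialPerturbation

variable {h c : Space n → ℝ} (H : IsRadialPerturbation Ω h c)
include H

/-- The flux of the moved set through `g` is the flux of `E` through the pulled back field, so the
perimeter is at most `∫ |J (DT)⁻¹ σ| dμ`. Then `s ≤ (1 + s²)/2` removes the norm; equality at `s =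
1` means that the bound is exact for the undeformed set. -/
lemma perimeter_preimage_le (hn : 1 ≤ n) : perimeter Ω (H.homeo.symm ⁻¹' E)
    ≤ ENNReal.ofReal (∫ y, 1 / 2 * (1 + ‖jac h c y • dDilateInv h c y (σ y)‖ ^ 2) ∂μ) := by
  have := R.isPerimeterMeasure.finite
  have hσ := R.isPerimeterMeasure.measurable
  have hm : AEStronglyMeasurable (fun y => jac h c y • dDilateInv h c y (σ y)) μ := by
    refine AEStronglyMeasurable.smul
      ((H.contDiff_tang.pow _).mul H.contDiff_rad).continuous.aestronglyMeasurable ?_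
    exact H.continuous_dDilateInv.comp_aestronglyMeasurable
      (aestronglyMeasurable_id.prodMk hσ.aestronglyMeasurable)
  have hb : ∀ᵐ y ∂μ, ‖jac h c y • dDilateInv h c y (σ y)‖ ≤ 2 ^ (n - 1) * 2 * 2 := by
    filter_upwards [R.isPerimeterMeasure.norm_eq_one] with y hy
    rw [norm_smul, Real.norm_of_nonneg (H.jac_pos y).le]
    have h1 := H.norm_dDilateInv_le y (σ y)
    rw [hy, mul_one] at h1
    exact mul_le_mul (H.jac_le y) h1 (norm_nonneg _) (by positivity)
  have hi : Integrable (fun y => 1 / 2 * (1 + ‖jac h c y • dDilateInv h c y (σ y)‖ ^ 2)) μ := by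
    refine Integrable.const_mul (Integrable.add (integrable_const _) ?_) _
    refine Integrable.of_bound (hm.norm.pow 2) ((2 ^ (n - 1) * 2 * 2) ^ 2) ?_
    filter_upwards [hb] with y hy
    rw [norm_pow, norm_norm]
    exact pow_le_pow_left₀ (norm_nonneg _) hy 2
  refine perimeter_le_of_forall fun g hg h1 => ENNReal.ofReal_le_ofReal ?_
  have e1 : indicatorFlux (H.homeo.symm ⁻¹' E) g = indicatorFlux E (H.pullback g) :=
    H.integral_comp_symm_mul_divergence hn (E.indicator fun _ => (1 : ℝ)) hg
  rw [e1, R.isPerimeterMeasure.flux _ (H.isTest_pullback hg)]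
  have hσi : Integrable σ μ := Integrable.of_bound hσ.aestronglyMeasurable 1
    (R.isPerimeterMeasure.norm_eq_one.mono fun x hx => hx.le)
  refine integral_mono ((H.isTest_pullback hg).integrable_inner
    (hσi.locallyIntegrable.locallyIntegrableOn Ω)) hi fun y => ?_
  simp only [pullback, inner_smul_right, inner_dDilateInv]
  rw [← real_inner_smul_left]
  have h2 := real_inner_le_norm (jac h c y • dDilateInv h c y (σ y)) (g (H.homeo y))
  have h3 : ‖jac h c y • dDilateInv h c y (σ y)‖ * ‖g (H.homeo y)‖
      ≤ ‖jac h c y • dDilateInv h c y (σ y)‖ := mul_le_of_le_one_right (norm_nonneg _) (h1 _)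
  nlinarith [sq_nonneg (‖jac h c y • dDilateInv h c y (σ y)‖ - 1)]

lemma admissible_comp_symm (hn : 1 ≤ n) :
    Admissible Ω (fun x => u (H.homeo.symm x)) (H.homeo.symm ⁻¹' E) := by
  have hΩ := R.isOpen.measurableSet
  have hA := R.admissible
  have hS := H.quasiMeasurePreserving_symm
  have hsub : H.homeo.symm ⁻¹' E ⊆ Ω := fun x hx => (H.symm_mem_iff x).1 (hA.subset hx)
  have hD : MeasurableSet (H.homeo.symm ⁻¹' E) :=
    H.homeo.symm.continuous.measurable hA.measurableSet
  refine ⟨⟨H.memLp_comp_symm hn hΩ hA.memH1.1, _,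
    H.isWeakGradient_comp_symm hn hΩ hA.memH1.1 R.memLp R.isWeakGradient,
    H.memLp_comp_symm hn hΩ (H.memLp_dDilateInv R.memLp)⟩, hsub, hD, ?_, hS.ae hA.nonneg, ?_⟩
  · exact ne_top_of_le_ne_top ENNReal.ofReal_ne_top (R.perimeter_preimage_le H hn)
  · have h1 : ∀ᵐ y ∂volume.restrict Ω, y ∈ E → u y = 0 :=
      ae_restrict_of_ae ((ae_restrict_iff' hA.measurableSet).1 hA.eq_zero)
    have h2 : ∀ᵐ x, x ∈ Ω → H.homeo.symm x ∈ E → u (H.homeo.symm x) = 0 :=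
      (ae_restrict_iff' hΩ).1 (hS.ae h1)
    refine (ae_restrict_iff' hD).2 ?_
    filter_upwards [h2] with x hx hxD
    exact hx (hsub hxD) hxD

/-- Comparison of a minimizer with its image under a radial dilation. -/
lemma le_dilated_energy (hn : 1 ≤ n) (hmin : IsMinimizingPair Ω u E) :
    (∫ x in Ω, ‖p x‖ ^ 2) + μ.real univ ≤ (∫ y in Ω, jac h c y * ‖dDilateInv h c y (p y)‖ ^ 2)
      + ∫ y, 1 / 2 * (1 + ‖jac h c y • dDilateInv h c y (σ y)‖ ^ 2) ∂μ := by
  have := R.isPerimeterMeasure.finite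
  have hΩ := R.isOpen.measurableSet
  have hle := hmin.2 _ _ (tsupport h) (R.admissible_comp_symm H hn) H.isTest.hasCompactSupport
    H.isTest.tsupport_subset (by
      refine (ae_restrict_iff' (hΩ.diff (isClosed_tsupport h).measurableSet)).2
        (Eventually.of_forall fun x hx => ?_)
      rw [mem_preimage, H.symm_of_notMem hx.2]
      exact ⟨rfl, Iff.rfl⟩)
  have hV : MemLp (fun x => dDilateInv h c (H.homeo.symm x) (p (H.homeo.symm x))) 2
      (volume.restrict Ω) := H.memLp_comp_symm hn hΩ (H.memLp_dDilateInv R.memLp)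
  have hD : dirichletEnergy Ω (fun x => u (H.homeo.symm x))
      = ENNReal.ofReal (∫ y in Ω, jac h c y * ‖dDilateInv h c y (p y)‖ ^ 2) := by
    rw [(H.isWeakGradient_comp_symm hn hΩ R.admissible.memH1.1 R.memLp
      R.isWeakGradient).dirichletEnergy_eq R.isOpen, H.lintegral_comp hn hΩ]
    simp only [H.homeo.symm_apply_apply]
    rw [ofReal_integral_eq_lintegral_ofReal]
    · refine lintegral_congr fun y => ?_
      rw [ENNReal.ofReal_mul (H.jac_pos y).le, ENNReal.ofReal_pow (norm_nonneg _), ofReal_norm]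
    · have hB := (H.memLp_dDilateInv R.memLp).integrable_norm_pow (p := 2) (by norm_num)
      refine Integrable.bdd_mul (c := 2 ^ (n - 1) * 2) hB
        ((H.contDiff_tang.pow _).mul H.contDiff_rad).continuous.aestronglyMeasurable
        (Eventually.of_forall fun y => ?_)
      rw [Real.norm_of_nonneg (H.jac_pos y).le]
      exact H.jac_le y
    · exact Eventually.of_forall fun y => mul_nonneg (H.jac_pos y).le (by positivity)
  have hμΩ : μ univ = μ Ω := by
    refine le_antisymm ?_ (measure_mono (subset_univ _))
    rw [← union_compl_self Ω]
    refine (measure_union_le _ _).trans ?_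
    rw [R.isPerimeterMeasure.compl, add_zero]
  have hI2 : 0 ≤ ∫ y, 1 / 2 * (1 + ‖jac h c y • dDilateInv h c y (σ y)‖ ^ 2) ∂μ :=
    integral_nonneg fun y => by positivity
  have hI1 : 0 ≤ ∫ y in Ω, jac h c y * ‖dDilateInv h c y (p y)‖ ^ 2 :=
    integral_nonneg fun y => mul_nonneg (H.jac_pos y).le (by positivity)
  have h1 := hle.trans (add_le_add hD.le (R.perimeter_preimage_le H hn))
  rw [← ENNReal.ofReal_add hI1 hI2, R.energy_eq R.isOpen subset_rfl, ← hμΩ,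
    ← ofReal_measureReal, ← ENNReal.ofReal_add (integral_nonneg fun x => by positivity)
      measureReal_nonneg] at h1
  exact (ENNReal.ofReal_le_ofReal_iff (add_nonneg hI1 hI2)).1 h1

end IsRepresented

/-! ### Differentiation under the integral sign -/

section Derivative

/-- Differentiation under the integral sign for integrands `ψ(tη, tζ) w`. -/
lemma hasDerivAt_integral_two_weights {m : Measure (Space n)} {η ζ w₁ w₂ : Space n → ℝ}
    {ψ₁ ψ₂ : ℝ × ℝ → ℝ} {d₁ d₂ : ℝ → ℝ → ℝ} {C : ℝ} (hη : Measurable η) (hζ : Measurable ζ)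
    (hηC : ∀ x, |η x| ≤ C) (hζC : ∀ x, |ζ x| ≤ C) (hw₁ : Integrable w₁ m) (hw₂ : Integrable w₂ m)
    (hψ₁ : ContDiffAt ℝ 1 ψ₁ 0) (hψ₂ : ContDiffAt ℝ 1 ψ₂ 0) (hm₁ : Measurable ψ₁)
    (hm₂ : Measurable ψ₂) (hd₁ : ∀ a z, HasDerivAt (fun t : ℝ => ψ₁ (t * a, t * z)) (d₁ a z) 0)
    (hd₂ : ∀ a z, HasDerivAt (fun t : ℝ => ψ₂ (t * a, t * z)) (d₂ a z) 0)
    (hdm₁ : Measurable fun x => d₁ (η x) (ζ x)) (hdm₂ : Measurable fun x => d₂ (η x) (ζ x)) :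
    HasDerivAt (fun t : ℝ => ∫ x, (ψ₁ (t * η x, t * ζ x) * w₁ x
        + ψ₂ (t * η x, t * ζ x) * w₂ x) ∂m)
      (∫ x, (d₁ (η x) (ζ x) * w₁ x + d₂ (η x) (ζ x) * w₂ x) ∂m) 0 := by
  -- A function that is `C¹` at the origin is Lipschitz near it, and since `η`, `ζ` are bounded by
  -- `C`, the points `t (η, ζ)` remain in that neighbourhood for `|t| < r / (C + 1)`, uniformly in
  -- `x`.
  have hlip : ∀ ψ : ℝ × ℝ → ℝ, ContDiffAt ℝ 1 ψ 0 → ∃ δ > 0, ∃ K : NNReal, ∀ x, ∀ s ∈ ball (0 : ℝ) δ,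
      ∀ t ∈ ball (0 : ℝ) δ, |ψ (s * η x, s * ζ x) - ψ (t * η x, t * ζ x)| ≤ K * C * |s - t| := by
    intro ψ hψ
    obtain ⟨K, N, hN, hK⟩ := hψ.exists_lipschitzOnWith
    obtain ⟨r, hr, hrN⟩ := Metric.mem_nhds_iff.1 hN
    by_cases hne : Nonempty (Space n)
    swap
    · exact ⟨1, one_pos, 0, fun x => (hne ⟨x⟩).elim⟩
    have hC : 0 ≤ C := (abs_nonneg _).trans (hηC hne.some)
    have hmem : ∀ x, ∀ s ∈ ball (0 : ℝ) (r / (C + 1)), (s * η x, s * ζ x) ∈ N := fun x s hs => by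
      refine hrN ?_
      rw [mem_ball_zero_iff] at hs ⊢
      rw [lt_div_iff₀ (by positivity)] at hs
      rw [Prod.norm_def, max_lt_iff]
      simp only [norm_mul]
      constructor
      · refine lt_of_le_of_lt ?_ hs
        exact mul_le_mul_of_nonneg_left ((hηC x).trans (by linarith)) (norm_nonneg s)
      · refine lt_of_le_of_lt ?_ hs
        exact mul_le_mul_of_nonneg_left ((hζC x).trans (by linarith)) (norm_nonneg s)
    refine ⟨r / (C + 1), by positivity, K, fun x s hs t ht => ?_⟩
    have h1 := hK.dist_le_mul _ (hmem x s hs) _ (hmem x t ht)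
    rw [Real.dist_eq] at h1
    refine h1.trans ?_
    rw [mul_assoc]
    refine mul_le_mul_of_nonneg_left ?_ K.2
    rw [Prod.dist_eq, max_le_iff]
    simp only [Real.dist_eq, ← sub_mul, abs_mul]
    constructor
    · rw [mul_comm]
      exact mul_le_mul_of_nonneg_right (hηC x) (abs_nonneg _)
    · rw [mul_comm]
      exact mul_le_mul_of_nonneg_right (hζC x) (abs_nonneg _)
  obtain ⟨δ₁, hδ₁, K₁, hK₁⟩ := hlip ψ₁ hψ₁
  obtain ⟨δ₂, hδ₂, K₂, hK₂⟩ := hlip ψ₂ hψ₂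
  have hmeas : ∀ t : ℝ, AEStronglyMeasurable (fun x => ψ₁ (t * η x, t * ζ x) * w₁ x
      + ψ₂ (t * η x, t * ζ x) * w₂ x) m := fun t => by
    refine AEStronglyMeasurable.add (AEStronglyMeasurable.mul ?_ hw₁.1)
      (AEStronglyMeasurable.mul ?_ hw₂.1)
    · exact (hm₁.comp ((hη.const_mul t).prodMk (hζ.const_mul t))).aestronglyMeasurable
    · exact (hm₂.comp ((hη.const_mul t).prodMk (hζ.const_mul t))).aestronglyMeasurable
  refine (hasDerivAt_integral_of_dominated_loc_of_lip
    (bound := fun x => K₁ * C * |w₁ x| + K₂ * C * |w₂ x|)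
    (ball_mem_nhds (0 : ℝ) (lt_min hδ₁ hδ₂)) (Eventually.of_forall hmeas) ?_ ?_ ?_ ?_ ?_).2
  · simp only [zero_mul]
    exact (hw₁.const_mul _).add (hw₂.const_mul _)
  · exact (hdm₁.aestronglyMeasurable.mul hw₁.1).add (hdm₂.aestronglyMeasurable.mul hw₂.1)
  · refine Eventually.of_forall fun x => LipschitzOnWith.of_dist_le_mul fun s hs t ht => ?_
    have hC : 0 ≤ C := (abs_nonneg _).trans (hηC x)
    have h1 := hK₁ x s (ball_subset_ball (min_le_left _ _) hs) t
      (ball_subset_ball (min_le_left _ _) ht)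
    have h2 := hK₂ x s (ball_subset_ball (min_le_right _ _) hs) t
      (ball_subset_ball (min_le_right _ _) ht)
    rw [Real.coe_nnabs, abs_of_nonneg (by positivity), Real.dist_eq, Real.dist_eq]
    calc _ = |(ψ₁ (s * η x, s * ζ x) - ψ₁ (t * η x, t * ζ x)) * w₁ x
          + (ψ₂ (s * η x, s * ζ x) - ψ₂ (t * η x, t * ζ x)) * w₂ x| := by
            congr 1
            ring
      _ ≤ K₁ * C * |s - t| * |w₁ x| + K₂ * C * |s - t| * |w₂ x| := by
            refine (abs_add_le _ _).trans ?_
            rw [abs_mul, abs_mul]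
            gcongr
      _ = _ := by ring
  · exact (hw₁.abs.const_mul _).add (hw₂.abs.const_mul _)
  · exact Eventually.of_forall fun x =>
      ((hd₁ (η x) (ζ x)).mul_const (w₁ x)).add ((hd₂ (η x) (ζ x)).mul_const (w₂ x))

end Derivative

lemma integrable_inner_of_memLp {F : Type*} [NormedAddCommGroup F] [InnerProductSpace ℝ F]
    {m : Measure (Space n)} {f g : Space n → F} (hf : MemLp f 2 m) (hg : MemLp g 2 m) :
    Integrable (fun x => inner ℝ (f x) (g x)) m := by
  refine ((hf.integrable_norm_pow (p := 2) (by norm_num)).add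
    (hg.integrable_norm_pow (p := 2) (by norm_num))).mono' (hf.1.inner hg.1)
    (Eventually.of_forall fun x => (norm_inner_le_norm _ _).trans ?_)
  simp only [Pi.add_apply]
  nlinarith [sq_nonneg (‖f x‖ - ‖g x‖), sq_nonneg (‖f x‖ + ‖g x‖)]

/-! ### First order expansion of the dilated densities -/

section Densities

/-- The factor of `|∇u|²` in the dilated Dirichlet energy. -/
def dilDir (m : ℕ) (q : ℝ × ℝ) : ℝ := (1 + q.1) ^ m * (1 + q.1 + q.2) / (1 + q.1) ^ 2

/-- The relative change of the squared radial part. -/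
def dilRad (q : ℝ × ℝ) : ℝ := -2 * q.2 / (1 + q.1 + q.2) + q.2 ^ 2 / (1 + q.1 + q.2) ^ 2

/-- The factor in the dilated area. -/
def dilArea (m : ℕ) (q : ℝ × ℝ) : ℝ := ((1 + q.1) ^ m * (1 + q.1 + q.2) / (1 + q.1)) ^ 2

lemma contDiffAt_dilDir (m : ℕ) : ContDiffAt ℝ 1 (dilDir m) 0 := by
  unfold dilDir
  fun_prop (disch := simp)

lemma contDiffAt_dilRad : ContDiffAt ℝ 1 dilRad 0 := by
  unfold dilRad
  fun_prop (disch := simp)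

lemma contDiffAt_dilArea (m : ℕ) : ContDiffAt ℝ 1 (dilArea m) 0 := by
  unfold dilArea
  fun_prop (disch := simp)

lemma measurable_dilDir (m : ℕ) : Measurable (dilDir m) := by
  unfold dilDir
  fun_prop

lemma measurable_dilRad : Measurable dilRad := by
  unfold dilRad
  fun_prop

lemma measurable_dilArea (m : ℕ) : Measurable (dilArea m) := by
  unfold dilArea
  fun_prop

lemma hasDerivAt_tang (a : ℝ) : HasDerivAt (fun t : ℝ => 1 + t * a) a 0 := by
  simpa using ((hasDerivAt_id (0 : ℝ)).mul_const a).const_add 1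

lemma hasDerivAt_rad (a z : ℝ) : HasDerivAt (fun t : ℝ => 1 + t * a + t * z) (a + z) 0 := by
  exact ((hasDerivAt_tang a).fun_add ((hasDerivAt_id (0 : ℝ)).mul_const z)).congr_deriv (by simp)

/-- All factors equal `1` at `t = 0`, so the derivative is `m a + (a + z) - 2 a`. -/
lemma hasDerivAt_dilDir (m : ℕ) (a z : ℝ) :
    HasDerivAt (fun t : ℝ => dilDir m (t * a, t * z)) ((m - 1) * a + z) 0 := by
  have h := (((hasDerivAt_tang a).fun_pow m).fun_mul (hasDerivAt_rad a z)).fun_div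
    ((hasDerivAt_tang a).fun_pow 2) (by simp)
  unfold dilDir
  exact h.congr_deriv (by simp; ring)

lemma hasDerivAt_dilRad (a z : ℝ) :
    HasDerivAt (fun t : ℝ => dilRad (t * a, t * z)) (-2 * z) 0 := by
  have hz : HasDerivAt (fun t : ℝ => t * z) z 0 := by
    simpa using (hasDerivAt_id (0 : ℝ)).mul_const z
  have h := ((hz.const_mul (-2)).fun_div (hasDerivAt_rad a z) (by simp)).fun_add
    ((hz.fun_pow 2).fun_div ((hasDerivAt_rad a z).fun_pow 2) (by simp))
  unfold dilRad
  exact h.congr_deriv (by simp)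

/-- Here the logarithmic derivative is `2 (m a + (a + z) - a)`; the outer factor comes from the
square. -/
lemma hasDerivAt_dilArea (m : ℕ) (a z : ℝ) :
    HasDerivAt (fun t : ℝ => dilArea m (t * a, t * z)) (2 * (m * a + z)) 0 := by
  have h := ((((hasDerivAt_tang a).fun_pow m).fun_mul (hasDerivAt_rad a z)).fun_div
    (hasDerivAt_tang a) (by simp)).fun_pow 2
  unfold dilArea
  exact h.congr_deriv (by simp; ring)

end Densities

/-! ### Inner and outer variations -/

/-- A smooth radial cutoff `η` with `∇η(x) = κ(x) x`. -/
structure IsRadialCutoff (Ω : Set (Space n)) (η κ : Space n → ℝ) : Prop where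
  isTest : IsTest Ω η
  contDiff : ContDiff ℝ ∞ κ
  fderiv_eq : ∀ x v, fderiv ℝ η x v = κ x * inner ℝ x v

namespace IsRadialCutoff

variable {Ω : Set (Space n)} {η κ : Space n → ℝ} (hη : IsRadialCutoff Ω η κ)
include hη

lemma gradient_eq (x : Space n) : gradient η x = κ x • x := by
  refine ext_inner_right ℝ fun v => ?_
  rw [inner_gradient_left', hη.fderiv_eq, real_inner_smul_left]

lemma isTest_gradient : IsTest Ω fun x => κ x • x := by
  have := hη.isTest.gradient
  rwa [show gradient η = fun x => κ x • x from funext hη.gradient_eq] at this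

lemma exists_bound : ∃ C : ℝ, 0 ≤ C ∧ (∀ x, |η x| ≤ C) ∧ (∀ x, |κ x * ‖x‖ ^ 2| ≤ C) := by
  obtain ⟨C₁, h0, h1⟩ := hη.isTest.bounded
  have ht : IsTest Ω fun x => κ x * ‖x‖ ^ 2 := by
    have h3 : (fun x => κ x * ‖x‖ ^ 2) = fun x : Space n => inner ℝ (κ x • x) x := by
      ext1 x
      rw [real_inner_smul_left, real_inner_self_eq_norm_sq]
    rw [h3]
    refine hη.isTest_gradient.of_support_subset
      (hη.isTest_gradient.contDiff.inner ℝ contDiff_id) fun x hx => ?_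
    simp only [Function.mem_support] at hx ⊢
    exact fun h0 => hx (by rw [h0, inner_zero_left])
  obtain ⟨C₂, -, h2⟩ := ht.bounded
  exact ⟨max C₁ C₂, h0.trans (le_max_left _ _), fun x => (h1 x).trans (le_max_left _ _),
    fun x => (h2 x).trans (le_max_right _ _)⟩

lemma exists_isRadialPerturbation : ∃ δ > 0, ∀ t : ℝ, |t| < δ →
    IsRadialPerturbation Ω (fun x => t * η x) (fun x => t * κ x) := by
  obtain ⟨C, hC, h1, h2⟩ := hη.exists_bound
  refine ⟨1 / (4 * (C + 1)), by positivity, fun t ht => ?_⟩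
  have hb : ∀ y : ℝ, |y| ≤ C → |t| * |y| ≤ 1 / 4 := fun y hy => by
    rw [lt_div_iff₀ (by positivity)] at ht
    nlinarith [mul_le_mul_of_nonneg_left hy (abs_nonneg t), abs_nonneg t]
  refine ⟨by simpa using hη.isTest.const_smul t, contDiff_const.mul hη.contDiff, fun x v => ?_,
    fun x => ?_, fun x => ?_⟩
  · rw [fderiv_const_mul (hη.isTest.differentiable x), smul_apply, hη.fderiv_eq,
      smul_eq_mul, mul_assoc]
  · rw [abs_mul]
    exact hb _ (h1 x)
  · have := hb _ (h2 x)
    rwa [abs_mul, abs_of_nonneg (sq_nonneg ‖x‖), ← mul_assoc, ← abs_mul] at this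

end IsRadialCutoff

open IsRadialPerturbation in
-- The inverse derivative divides the tangential part of `v` by `tang` and the radial part by `rad`;
-- `dilRad` is `(tang / rad)² - 1`. At `y = 0` the quotient by `|y|²` is harmless since the inner
-- product vanishes.
lemma IsRadialPerturbation.norm_sq_dDilateInv {Ω : Set (Space n)} {h c : Space n → ℝ}
    (H : IsRadialPerturbation Ω h c) (y v : Space n) :
    ‖dDilateInv h c y v‖ ^ 2 = (‖v‖ ^ 2
      + dilRad (h y, c y * ‖y‖ ^ 2) * (inner ℝ y v ^ 2 / ‖y‖ ^ 2)) / tang h y ^ 2 := by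
  have h1 := (H.tang_pos y).ne'
  have h2 := (H.rad_pos y).ne'
  rw [dDilateInv_apply, norm_smul, mul_pow, norm_inv, inv_pow, Real.norm_eq_abs, sq_abs,
    inv_mul_eq_div, norm_sub_sq_real, norm_smul, inner_smul_right, real_inner_comm v y,
    mul_pow, Real.norm_eq_abs, sq_abs, dilRad]
  congr 1
  by_cases hy : y = 0
  · simp [hy]
  have hy' : ‖y‖ ≠ 0 := norm_ne_zero_iff.2 hy
  simp only [rad] at h2 ⊢
  field_simp
  rw [real_inner_comm]
  ring

namespace IsRepresented

variable {Ω E : Set (Space n)} {u : Space n → ℝ} {p : Space n → Space n} {μ : Measure (Space n)}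
  {σ : Space n → Space n} (R : IsRepresented Ω u E p μ σ)
  {η κ : Space n → ℝ} (hη : IsRadialCutoff Ω η κ)
include R

lemma measurable_inner_sq : Measurable fun x => inner ℝ x (σ x) ^ 2 / ‖x‖ ^ 2 :=
  ((measurable_id.inner R.isPerimeterMeasure.measurable).pow_const 2).div
    (measurable_norm.pow_const 2)

lemma integrable_inner_sq_normal : Integrable (fun x => inner ℝ x (σ x) ^ 2 / ‖x‖ ^ 2) μ := by
  have := R.isPerimeterMeasure.finite
  refine Integrable.of_bound R.measurable_inner_sq.aestronglyMeasurable 1 ?_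
  filter_upwards [R.isPerimeterMeasure.norm_eq_one] with x hx
  rw [Real.norm_of_nonneg (by positivity)]
  refine div_le_one_of_le₀ ?_ (by positivity)
  rw [← sq_abs (inner ℝ x (σ x))]
  refine pow_le_pow_left₀ (abs_nonneg _) ?_ 2
  simpa [hx] using abs_real_inner_le_norm x (σ x)

lemma integrable_norm_sq : Integrable (fun x => ‖p x‖ ^ 2) (volume.restrict Ω) :=
  R.memLp.integrable_norm_pow (p := 2) (by norm_num)

lemma integrable_inner_sq_gradient :
    Integrable (fun x => inner ℝ x (p x) ^ 2 / ‖x‖ ^ 2) (volume.restrict Ω) := by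
  refine R.integrable_norm_sq.mono' ?_ (Eventually.of_forall fun x => ?_)
  · exact ((aestronglyMeasurable_id.inner R.memLp.1).pow 2).mul
      (measurable_norm.pow_const 2).inv.aestronglyMeasurable
  · rw [Real.norm_of_nonneg (by positivity)]
    refine div_le_of_le_mul₀ (by positivity) (by positivity) ?_
    rw [← sq_abs (inner ℝ x (p x)), ← mul_pow, mul_comm]
    exact pow_le_pow_left₀ (abs_nonneg _) (abs_real_inner_le_norm x (p x)) 2

include hη

open IsRadialPerturbation in
/-- Stationarity under radial inner variations. -/
lemma inner_variation (hn : 1 ≤ n) (hmin : IsMinimizingPair Ω u E) :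
    (∫ x in Ω, ((((n : ℝ) - 2) * η x + κ x * ‖x‖ ^ 2) * ‖p x‖ ^ 2
        + -2 * (κ x * ‖x‖ ^ 2) * (inner ℝ x (p x) ^ 2 / ‖x‖ ^ 2)))
      + ∫ x, ((((n : ℝ) - 1) * η x + κ x * ‖x‖ ^ 2) * 1
        + -(κ x * ‖x‖ ^ 2) * (inner ℝ x (σ x) ^ 2 / ‖x‖ ^ 2)) ∂μ = 0 := by
  have := R.isPerimeterMeasure.finite
  obtain ⟨C, hC, h1, h2⟩ := hη.exists_bound
  obtain ⟨m, rfl⟩ : ∃ m, n = m + 1 := ⟨n - 1, by omega⟩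
  have hηm : Measurable η := hη.isTest.continuous.measurable
  have hζm : Measurable fun x => κ x * ‖x‖ ^ 2 :=
    (hη.contDiff.continuous.mul (continuous_norm.pow 2)).measurable
  have hD := hasDerivAt_integral_two_weights (m := volume.restrict Ω) hηm hζm h1 h2
    R.integrable_norm_sq R.integrable_inner_sq_gradient (contDiffAt_dilDir m)
    ((contDiffAt_dilDir m).mul contDiffAt_dilRad) (measurable_dilDir m)
    ((measurable_dilDir m).mul measurable_dilRad) (hasDerivAt_dilDir m)
    (d₂ := fun a z => -2 * z)
    (fun a z => by
      have := (hasDerivAt_dilDir m a z).mul (hasDerivAt_dilRad a z)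
      exact this.congr_deriv (by simp [dilDir, dilRad]))
    (by fun_prop) (by fun_prop)
  have hA := hasDerivAt_integral_two_weights (m := μ) hηm hζm h1 h2
    (integrable_const (1 : ℝ)) R.integrable_inner_sq_normal
    -- The factor `1/2` from `s ≤ (1 + s²)/2` cancels the `2` from differentiating the square,
    -- leaving the usual first variation of area.
    (ψ₁ := fun q => 1 / 2 * (1 + dilArea m q)) (ψ₂ := fun q => 1 / 2 * (dilArea m q * dilRad q))
    (contDiffAt_const.mul (contDiffAt_const.add (contDiffAt_dilArea m)))
    (contDiffAt_const.mul ((contDiffAt_dilArea m).mul contDiffAt_dilRad))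
    (((measurable_dilArea m).const_add 1).const_mul _)
    (((measurable_dilArea m).mul measurable_dilRad).const_mul _)
    (d₁ := fun a z => m * a + z) (d₂ := fun a z => -z)
    (fun a z => by
      have := ((hasDerivAt_dilArea m a z).const_add 1).const_mul (1 / 2)
      exact this.congr_deriv (by ring))
    (fun a z => by
      have := ((hasDerivAt_dilArea m a z).mul (hasDerivAt_dilRad a z)).const_mul (1 / 2)
      exact this.congr_deriv (by simp [dilArea, dilRad]))
    (by fun_prop) (by fun_prop)
  have hsum := hD.add hA
  -- At `t = 0` the bound equals the energy of the minimizer itself, and for small `t` of either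
  -- sign it dominates that of a competitor. So an upper bound of the competitor's energy suffices
  -- for stationarity.
  have hloc : IsLocalMin ((fun t : ℝ => ∫ x in Ω, (dilDir m (t * η x, t * (κ x * ‖x‖ ^ 2)) * ‖p x‖ ^ 2
      + (dilDir m * dilRad) (t * η x, t * (κ x * ‖x‖ ^ 2)) * (inner ℝ x (p x) ^ 2 / ‖x‖ ^ 2)))
      + fun t : ℝ => ∫ x, ((1 / 2 * (1 + dilArea m (t * η x, t * (κ x * ‖x‖ ^ 2)))) * 1
        + (1 / 2 * (dilArea m (t * η x, t * (κ x * ‖x‖ ^ 2))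
          * dilRad (t * η x, t * (κ x * ‖x‖ ^ 2)))) * (inner ℝ x (σ x) ^ 2 / ‖x‖ ^ 2)) ∂μ) 0 := by
    obtain ⟨δ, hδ, hpert⟩ := hη.exists_isRadialPerturbation
    have hball : ∀ᶠ t : ℝ in 𝓝 0, |t| < δ := by
      filter_upwards [ball_mem_nhds (0 : ℝ) hδ] with t ht
      simpa using ht
    filter_upwards [hball] with t ht
    have H := hpert t ht
    have hle := R.le_dilated_energy H (by omega) hmin
    refine le_trans (le_of_eq ?_) (hle.trans (le_of_eq ?_))
    · norm_num [dilDir, dilArea, dilRad, measureReal_def]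
    · refine congrArg₂ (· + ·) ?_ ?_
      · refine integral_congr_ae (Eventually.of_forall fun y => ?_)
        have hα := (H.tang_pos y).ne'
        simp only [H.norm_sq_dDilateInv, Pi.mul_apply, dilDir, jac, rad, tang,
          Nat.add_sub_cancel, mul_assoc]
        simp only [tang] at hα
        field_simp
      · refine integral_congr_ae ?_
        filter_upwards [R.isPerimeterMeasure.norm_eq_one] with y hy
        have hα := (H.tang_pos y).ne'
        simp only [norm_smul, mul_pow, H.norm_sq_dDilateInv, hy, Real.norm_eq_abs, sq_abs, dilArea,
          jac, rad, tang, Nat.add_sub_cancel, mul_assoc]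
        simp only [tang] at hα
        field_simp
        ring
  have h0 := hloc.hasDerivAt_eq_zero hsum
  rw [← h0]
  refine congrArg₂ (· + ·) ?_ ?_
  · refine integral_congr_ae (Eventually.of_forall fun y => ?_)
    simp only
    push_cast
    ring
  · refine integral_congr_ae (Eventually.of_forall fun y => ?_)
    simp only
    push_cast
    ring

lemma isWeakGradient_mul : IsWeakGradient Ω (fun x => η x * u x)
    (fun x => η x • p x + u x • (κ x • x)) := by
  have hw := R.isWeakGradient
  have hi1 : LocallyIntegrableOn (fun x => η x * u x) Ω :=
    (hη.isTest.integrable_smul hw.1).locallyIntegrable.locallyIntegrableOn Ω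
  have hi2 : LocallyIntegrableOn (fun x => η x • p x + u x • (κ x • x)) Ω :=
    ((hη.isTest.integrable_smul hw.2.1).add
      (hη.isTest_gradient.integrable_smul_field hw.1)).locallyIntegrable.locallyIntegrableOn Ω
  refine isWeakGradient_of_integral_mul_divergence hi1 hi2 fun g hg => ?_
  have ht : IsTest Ω (fun x => η x • g x) := hg.smul_left hη.isTest.contDiff
  have h1 := hw.integral_mul_divergence ht
  have hI1 : Integrable fun x => u x * divergence (fun y => η y • g y) x := by
    simpa [mul_comm] using ht.divergence.integrable_smul hw.1
  have hI2 : Integrable fun x => u x * inner ℝ (κ x • x) (g x) := by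
    have hk : IsTest Ω fun x => inner ℝ (κ x • x) (g x) := by
      refine hg.of_support_subset (hη.isTest_gradient.contDiff.inner ℝ hg.contDiff) fun x hx => ?_
      simp only [Function.mem_support] at hx ⊢
      exact fun h0 => hx (by rw [h0, inner_zero_right])
    simpa [mul_comm] using hk.integrable_smul hw.1
  have hI3 : Integrable fun x => inner ℝ (p x) (η x • g x) := ht.integrable_inner hw.2.1
  calc ∫ x, η x * u x * divergence g x
      = ∫ x, (u x * divergence (fun y => η y • g y) x - u x * inner ℝ (κ x • x) (g x)) := by
        refine integral_congr_ae (Eventually.of_forall fun x => ?_)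
        simp only [divergence_smul (hη.isTest.differentiable x) (hg.differentiable x),
          ← hη.gradient_eq, inner_gradient_left']
        ring
    _ = -∫ x, (inner ℝ (p x) (η x • g x) + u x * inner ℝ (κ x • x) (g x)) := by
        rw [integral_sub hI1 hI2, h1, integral_add hI3 hI2]
        ring
    _ = _ := by
        refine congrArg _ (integral_congr_ae (Eventually.of_forall fun x => ?_))
        simp only [inner_add_left, real_inner_smul_left, inner_smul_right]

/-- Stationarity under radial outer variations. -/
lemma outer_variation (hmin : IsMinimizingPair Ω u E) :
    ∫ x in Ω, (η x * ‖p x‖ ^ 2 + u x * (κ x * inner ℝ x (p x))) = 0 := by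
  have := R.isPerimeterMeasure.finite
  have hΩ := R.isOpen.measurableSet
  have hw := R.isWeakGradient
  have hA := R.admissible
  obtain ⟨C, hC, h1, -⟩ := hη.exists_bound
  obtain ⟨C', -, h2⟩ := hη.isTest_gradient.bounded
  set P : Space n → Space n := fun x => η x • p x + u x • (κ x • x) with hPdef
  have hηu : MemLp (fun x => η x * u x) 2 (volume.restrict Ω) := by
    refine MemLp.of_le_mul hA.memH1.1 (hη.isTest.continuous.aestronglyMeasurable.mul hA.memH1.1.1)
      (c := C) (Eventually.of_forall fun x => ?_)
    rw [norm_mul]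
    exact mul_le_mul_of_nonneg_right (h1 x) (norm_nonneg _)
  have hP : MemLp P 2 (volume.restrict Ω) := by
    refine MemLp.add ?_ ?_
    · refine MemLp.of_le_mul R.memLp (hη.isTest.continuous.aestronglyMeasurable.smul R.memLp.1)
        (c := C) (Eventually.of_forall fun x => ?_)
      rw [norm_smul]
      exact mul_le_mul_of_nonneg_right (h1 x) (norm_nonneg _)
    · refine MemLp.of_le_mul hA.memH1.1
        (hA.memH1.1.1.smul hη.isTest_gradient.continuous.aestronglyMeasurable)
        (c := C') (Eventually.of_forall fun x => ?_)
      rw [norm_smul, mul_comm]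
      exact mul_le_mul_of_nonneg_right (h2 x) (norm_nonneg _)
  have hPw := R.isWeakGradient_mul hη
  have hpP : Integrable (fun x => inner ℝ (p x) (P x)) (volume.restrict Ω) :=
    integrable_inner_of_memLp R.memLp hP
  have hPP : Integrable (fun x => ‖P x‖ ^ 2) (volume.restrict Ω) :=
    hP.integrable_norm_pow (p := 2) (by norm_num)
  have hweak : ∀ t : ℝ, IsWeakGradient Ω (fun x => u x + t * (η x * u x))
      (fun x => p x + t • P x) := by
    intro t
    refine isWeakGradient_of_integral_mul_divergence (hw.1.add (hPw.1.smul t))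
      (hw.2.1.add (hPw.2.1.smul t)) fun g hg => ?_
    have hI1 : Integrable fun x => u x * divergence g x := by
      simpa [mul_comm] using hg.divergence.integrable_smul hw.1
    have hI2 : Integrable fun x => (η x * u x) * divergence g x := by
      simpa [mul_comm] using hg.divergence.integrable_smul hPw.1
    have e1 : (fun x => (u x + t * (η x * u x)) * divergence g x)
        = fun x => u x * divergence g x + t * ((η x * u x) * divergence g x) := by
      ext1 x
      ring
    simp only [e1, inner_add_left, real_inner_smul_left]
    rw [integral_add hI1 (hI2.const_mul t), integral_const_mul, hw.integral_mul_divergence hg,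
      hPw.integral_mul_divergence hg, integral_add (hg.integrable_inner hw.2.1)
        ((hg.integrable_inner hPw.2.1).const_mul t), integral_const_mul]
    ring
  -- The condition on `t` keeps `1 + tη ≥ 0`, so `(1 + tη) u` is nonnegative and still vanishes on
  -- `E`. The set is unchanged and its finite perimeter cancels.
  have hcmp : ∀ t : ℝ, |t| * C ≤ 1 →
      0 ≤ t * (2 * ∫ x in Ω, inner ℝ (p x) (P x)) + t ^ 2 * ∫ x in Ω, ‖P x‖ ^ 2 := by
    intro t ht
    have hmem : MemLp (fun x => p x + t • P x) 2 (volume.restrict Ω) := R.memLp.add (hP.const_smul t)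
    have hadm : Admissible Ω (fun x => u x + t * (η x * u x)) E := by
      refine ⟨⟨hA.memH1.1.add (hηu.const_mul t), _, hweak t, hmem⟩, hA.subset,
        hA.measurableSet, hA.perimeter_ne_top, ?_, ?_⟩
      · filter_upwards [hA.nonneg] with x hx
        have h3 : |t * η x| ≤ 1 := by
          rw [abs_mul]
          exact (mul_le_mul_of_nonneg_left (h1 x) (abs_nonneg t)).trans ht
        nlinarith [(abs_le.1 h3).1]
      · filter_upwards [hA.eq_zero] with x hx
        simp [hx]
    have hle := hmin.2 _ _ (tsupport η) hadm hη.isTest.hasCompactSupport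
      hη.isTest.tsupport_subset (by
        refine (ae_restrict_iff' (hΩ.diff (isClosed_tsupport η).measurableSet)).2
          (Eventually.of_forall fun x hx => ?_)
        simp [image_eq_zero_of_notMem_tsupport hx.2])
    simp only [energy] at hle
    rw [ENNReal.add_le_add_iff_right hA.perimeter_ne_top, hw.dirichletEnergy_eq R.isOpen,
      (hweak t).dirichletEnergy_eq R.isOpen, lintegral_enorm_sq R.memLp, lintegral_enorm_sq hmem,
      ENNReal.ofReal_le_ofReal_iff (integral_nonneg fun x => by positivity)] at hle
    have e : ∫ x in Ω, ‖p x + t • P x‖ ^ 2 = (∫ x in Ω, ‖p x‖ ^ 2)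
        + (t * (2 * ∫ x in Ω, inner ℝ (p x) (P x)) + t ^ 2 * ∫ x in Ω, ‖P x‖ ^ 2) := by
      have hI : Integrable (fun x => t * (2 * inner ℝ (p x) (P x)) + t ^ 2 * ‖P x‖ ^ 2)
        (volume.restrict Ω) := ((hpP.const_mul 2).const_mul t).add (hPP.const_mul _)
      rw [← integral_const_mul, ← integral_const_mul, ← integral_const_mul,
        ← integral_add ((hpP.const_mul 2).const_mul t) (hPP.const_mul _),
        ← integral_add R.integrable_norm_sq hI]
      refine integral_congr_ae (Eventually.of_forall fun x => ?_)
      simp only [norm_add_sq_real, inner_smul_right, norm_smul, mul_pow, Real.norm_eq_abs, sq_abs]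
      ring
    rw [e] at hle
    linarith
  have hzero : ∫ x in Ω, inner ℝ (p x) (P x) = 0 := by
    set I := ∫ x in Ω, inner ℝ (p x) (P x) with hI
    set J := ∫ x in Ω, ‖P x‖ ^ 2 with hJ
    have hd : HasDerivAt (fun t : ℝ => t * (2 * I) + t ^ 2 * J) (2 * I) 0 := by
      have := ((hasDerivAt_id (0 : ℝ)).mul_const (2 * I)).add (((hasDerivAt_id (0 : ℝ)).pow 2).mul_const J)
      simpa using! this
    have hmin0 : IsLocalMin (fun t : ℝ => t * (2 * I) + t ^ 2 * J) 0 := by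
      filter_upwards [ball_mem_nhds (0 : ℝ) (show 0 < 1 / (C + 1) by positivity)] with t ht
      have ht' : |t| < 1 / (C + 1) := by simpa using ht
      rw [lt_div_iff₀ (by positivity)] at ht'
      have := hcmp t (by nlinarith [abs_nonneg t])
      simpa using this
    have := hmin0.hasDerivAt_eq_zero hd
    linarith
  rw [← hzero]
  refine integral_congr_ae (Eventually.of_forall fun x => ?_)
  simp only [hPdef, inner_add_right, inner_smul_right, real_inner_self_eq_norm_sq]
  rw [real_inner_comm]

end IsRepresented

/-! ### Polar coordinates and integration along rays -/

section Polar

/-- The surface measure of the unit sphere. -/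
abbrev sphereMeasure (n : ℕ) : Measure (sphere (0 : Space n) 1) := (volume : Measure (Space n)).toSphere

lemma nontrivial_space (hn : 1 ≤ n) : Nontrivial (Space n) := by
  have : Nonempty (Fin n) := ⟨⟨0, hn⟩⟩
  infer_instance

/-- Integration in polar coordinates. -/
lemma integral_polar (hn : 1 ≤ n) {f : Space n → ℝ} (hf : Integrable f) :
    ∫ x, f x = ∫ θ, (∫ r in Ioi (0 : ℝ), r ^ (n - 1) * f (r • (θ : Space n))) ∂sphereMeasure n := by
  have := nontrivial_space hn
  have hmp := (volume : Measure (Space n)).measurePreserving_homeomorphUnitSphereProd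
  have hemb := (homeomorphUnitSphereProd (Space n)).measurableEmbedding
  have hdim : Module.finrank ℝ (Space n) = n := by simp
  let F : sphere (0 : Space n) 1 × Ioi (0 : ℝ) → ℝ := fun z => f ((z.2 : ℝ) • (z.1 : Space n))
  have hF : ∀ x : ({0}ᶜ : Set (Space n)), F (homeomorphUnitSphereProd (Space n) x) = f x := fun x => by
    have hx : ‖(x : Space n)‖ ≠ 0 := norm_ne_zero_iff.2 x.2
    simp only [F]
    congr 1
    rw [homeomorphUnitSphereProd_apply_snd_coe, homeomorphUnitSphereProd_apply_fst_coe, smul_smul,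
      mul_inv_cancel₀ hx, one_smul]
  have hfi : Integrable (fun x : ({0}ᶜ : Set (Space n)) => f x) (volume.comap Subtype.val) := by
    have h1 : IntegrableOn f ({0}ᶜ : Set (Space n)) := hf.integrableOn
    rwa [integrableOn_iff_comap_subtypeVal (measurableSet_singleton _).compl] at h1
  have hFi : Integrable F ((volume : Measure (Space n)).toSphere.prod
      (Measure.volumeIoiPow (Module.finrank ℝ (Space n) - 1))) := by
    rw [← hmp.integrable_comp_emb hemb]
    exact hfi.congr (Eventually.of_forall fun x => (hF x).symm)
  calc ∫ x, f x = ∫ x : ({0}ᶜ : Set (Space n)), f x ∂(volume.comap Subtype.val) := by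
        rw [integral_subtype_comap (measurableSet_singleton _).compl f]
        rw [restrict_compl_singleton]
    _ = ∫ z, F z ∂((volume : Measure (Space n)).toSphere.prod
          (Measure.volumeIoiPow (Module.finrank ℝ (Space n) - 1))) := by
        rw [← hmp.integral_comp hemb]
        exact integral_congr_ae (Eventually.of_forall fun x => (hF x).symm)
    _ = _ := by
        rw [integral_prod _ hFi]
        refine integral_congr_ae (Eventually.of_forall fun θ => ?_)
        simp only [F, Measure.volumeIoiPow, ENNReal.ofReal]
        rw [integral_withDensity_eq_integral_smul (by fun_prop), hdim]
        rw [← integral_subtype_comap measurableSet_Ioi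
          (fun r : ℝ => r ^ (n - 1) * f (r • (θ : Space n)))]
        refine integral_congr_ae (Eventually.of_forall fun r => ?_)
        have hr : (0 : ℝ) ≤ (r : ℝ) ^ (n - 1) := pow_nonneg (le_of_lt r.2) _
        simp only [NNReal.smul_def, smul_eq_mul, Real.coe_toNNReal _ hr]

/-- The half-open annulus `a ≤ |x| < b`. -/
def annulus (n : ℕ) (a b : ℝ) : Set (Space n) := {x | a ≤ ‖x‖ ∧ ‖x‖ < b}

lemma measurableSet_annulus (a b : ℝ) : MeasurableSet (annulus n a b) :=
  (measurableSet_le measurable_const measurable_norm).inter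
    (measurableSet_lt measurable_norm measurable_const)

lemma annulus_subset_ball (a b : ℝ) : annulus n a b ⊆ ball 0 b := fun x hx => by
  simpa using hx.2

lemma annulus_zero (b : ℝ) : annulus n 0 b = ball 0 b := by
  ext x
  simp [annulus]

/-- The fundamental theorem of calculus along rays, integrated over the sphere. -/
lemma setIntegral_annulus_eq (hn : 1 ≤ n) {a b : ℝ} (ha : 0 ≤ a) (hab : a < b) {f k : Space n → ℝ}
    {m : ℝ → ℝ} (hf : Continuous f) (hm : ContinuousOn m (Icc a b))
    (hk : IntegrableOn k (annulus n a b))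
    (hkc : ∀ θ : sphere (0 : Space n) 1,
      ContinuousOn (fun r : ℝ => r ^ (n - 1) * k (r • (θ : Space n))) (Icc a b))
    (hd : ∀ θ : sphere (0 : Space n) 1, ∀ r ∈ Ioo a b,
      HasDerivAt (fun r : ℝ => m r * f (r • (θ : Space n))) (r ^ (n - 1) * k (r • (θ : Space n))) r) :
    ∫ x in annulus n a b, k x
      = ∫ θ, (m b * f (b • (θ : Space n)) - m a * f (a • (θ : Space n))) ∂sphereMeasure n := by
  rw [← integral_indicator (measurableSet_annulus a b), integral_polar hn
    ((integrable_indicator_iff (measurableSet_annulus a b)).2 hk)]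
  refine integral_congr_ae (Eventually.of_forall fun θ => ?_)
  have hθ : ‖(θ : Space n)‖ = 1 := by simp
  have h1 : ∫ r in Ioi (0 : ℝ), r ^ (n - 1) * (annulus n a b).indicator k (r • (θ : Space n))
      = ∫ r in Ioo a b, r ^ (n - 1) * k (r • (θ : Space n)) := by
    rw [← integral_indicator measurableSet_Ioi, ← integral_indicator measurableSet_Ioo]
    refine integral_congr_ae ?_
    -- The annulus contains its inner sphere while the interval is open; one radius is negligible.
    have hne : ∀ᵐ r : ℝ, r ≠ a := by simp [ae_iff]
    filter_upwards [hne] with r hr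
    by_cases hr0 : 0 < r
    · rw [indicator_of_mem (mem_Ioi.2 hr0)]
      have hnorm : ‖r • (θ : Space n)‖ = r := by rw [norm_smul, hθ, mul_one, Real.norm_of_nonneg hr0.le]
      by_cases hr1 : r ∈ Ioo a b
      · rw [indicator_of_mem hr1, indicator_of_mem (show r • (θ : Space n) ∈ annulus n a b from
          ⟨by rw [hnorm]; exact hr1.1.le, by rw [hnorm]; exact hr1.2⟩)]
      · rw [indicator_of_notMem hr1, indicator_of_notMem, mul_zero]
        rintro ⟨h2, h3⟩
        rw [hnorm] at h2 h3
        exact hr1 ⟨lt_of_le_of_ne h2 (Ne.symm hr), h3⟩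
    · rw [indicator_of_notMem (by simpa using hr0), indicator_of_notMem]
      exact fun h2 => hr0 (ha.trans_lt h2.1)
  simp only [h1]
  rw [← integral_Ioc_eq_integral_Ioo, ← intervalIntegral.integral_of_le hab.le]
  refine intervalIntegral.integral_eq_sub_of_hasDerivAt_of_le hab.le ?_ (hd θ) ?_
  · exact hm.mul (hf.comp (continuous_id.smul continuous_const)).continuousOn
  · exact (hkc θ).intervalIntegrable_of_Icc hab.le

lemma integral_surfaceMeasure {r : ℝ} (hr : 0 < r) {g : Space n → ℝ}
    (hg : AEStronglyMeasurable g (surfaceMeasure n r)) :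
    ∫ x, g x ∂surfaceMeasure n r = r ^ (n - 1) * ∫ θ, g (r • (θ : Space n)) ∂sphereMeasure n := by
  have hm : Measurable fun θ : sphere (0 : Space n) 1 => r • (θ : Space n) :=
    Continuous.measurable (by fun_prop)
  have hpos : 0 < r ^ (n - 1) := pow_pos hr _
  have hg' : AEStronglyMeasurable g ((sphereMeasure n).map
      fun θ : sphere (0 : Space n) 1 => r • (θ : Space n)) := by
    refine hg.mono_ac (Measure.absolutelyContinuous_of_le_smul
      (c := ENNReal.ofReal ((r ^ (n - 1))⁻¹)) ?_)
    rw [surfaceMeasure, smul_smul, ← ENNReal.ofReal_mul (inv_nonneg.2 hpos.le),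
      inv_mul_cancel₀ hpos.ne', ENNReal.ofReal_one, one_smul]
  rw [surfaceMeasure, integral_smul_measure, integral_map hm.aemeasurable hg',
    ENNReal.toReal_ofReal hpos.le, smul_eq_mul]

instance (r : ℝ) : IsFiniteMeasure (surfaceMeasure n r) := by
  unfold surfaceMeasure
  have : IsFiniteMeasure ((sphereMeasure n).map
      fun θ : sphere (0 : Space n) 1 => r • (θ : Space n)) := Measure.isFiniteMeasure_map _ _
  exact Measure.smul_finite _ ENNReal.ofReal_ne_top

lemma hasDerivAt_comp_ray {v : Space n → ℝ} (hv : ContDiff ℝ ∞ v) (θ : Space n) (r : ℝ) :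
    HasDerivAt (fun r : ℝ => v (r • θ)) (fderiv ℝ v (r • θ) θ) r := by
  have h1 : HasDerivAt (fun r : ℝ => r • θ) θ r := by
    simpa using (hasDerivAt_id r).smul_const θ
  exact (hv.differentiable (by simp) (r • θ)).hasFDerivAt.comp_hasDerivAt r h1

lemma fderiv_sq {v : Space n → ℝ} (hv : ContDiff ℝ ∞ v) (x y : Space n) :
    fderiv ℝ (fun z => v z ^ 2) x y = 2 * v x * inner ℝ y (gradient v x) := by
  have h := ((hv.differentiable (by simp) x).hasFDerivAt.pow 2).fderiv
  have h' : fderiv ℝ (fun z => v z ^ 2) x = (2 * v x ^ (2 - 1)) • fderiv ℝ v x := by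
    simpa using! h
  rw [h', real_inner_comm, inner_gradient_left']
  simp

lemma continuous_fderiv_sq {v : Space n → ℝ} (hv : ContDiff ℝ ∞ v) :
    Continuous fun x => fderiv ℝ (fun z => v z ^ 2) x x :=
  ((hv.pow 2).continuous_fderiv (by simp)).clm_apply continuous_id

/-- The boundary integral of `v²` as an integral over the ball. -/
lemma mul_integral_sq_surfaceMeasure (hn : 1 ≤ n) {r : ℝ} (hr : 0 < r) {v : Space n → ℝ}
    (hv : ContDiff ℝ ∞ v) :
    r * ∫ x, v x ^ 2 ∂surfaceMeasure n r
      = ∫ x in ball 0 r, (n * v x ^ 2 + 2 * v x * inner ℝ x (gradient v x)) := by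
  have hk : Continuous fun x : Space n => n * v x ^ 2 + fderiv ℝ (fun z => v z ^ 2) x x :=
    (continuous_const.mul (hv.continuous.pow 2)).add (continuous_fderiv_sq hv)
  have h := setIntegral_annulus_eq hn le_rfl hr (f := fun z => v z ^ 2)
    (k := fun x => n * v x ^ 2 + fderiv ℝ (fun z => v z ^ 2) x x) (m := fun r => r ^ n)
    (hv.continuous.pow 2) (continuous_pow n).continuousOn
    ((hk.continuousOn.integrableOn_compact (isCompact_closedBall 0 r)).mono_set
      ((annulus_subset_ball 0 r).trans ball_subset_closedBall))
    (fun θ => ((continuous_pow _).mul (hk.comp (continuous_id.smul continuous_const))).continuousOn)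
    (fun θ s hs => by
      have h1 := (hasDerivAt_pow n s).mul (hasDerivAt_comp_ray (hv.pow 2) (θ : Space n) s)
      refine h1.congr_deriv ?_
      have h2 : s ^ n = s ^ (n - 1) * s := by
        rw [← pow_succ, Nat.sub_add_cancel hn]
      rw [map_smul, smul_eq_mul, h2]
      ring)
  rw [annulus_zero] at h
  simp only [fderiv_sq hv] at h
  rw [h, integral_surfaceMeasure hr (g := fun x => v x ^ 2) (hv.continuous.pow 2).aestronglyMeasurable, ← mul_assoc,
    ← pow_succ', Nat.sub_add_cancel hn, ← integral_const_mul]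
  refine integral_congr_ae (Eventually.of_forall fun θ => ?_)
  -- The endpoint at the origin contributes `0 ^ n = 0`, because `n ≥ 1`.
  simp [show n ≠ 0 by omega]

/-- The change of the normalized boundary integral of `v²` between two spheres. -/
lemma sphere_integral_sub (hn : 1 ≤ n) {a b : ℝ} (ha : 0 < a) (hab : a < b) {v : Space n → ℝ}
    (hv : ContDiff ℝ ∞ v) :
    b ^ (-(n : ℤ)) * ∫ x, v x ^ 2 ∂surfaceMeasure n b
      - a ^ (-(n : ℤ)) * ∫ x, v x ^ 2 ∂surfaceMeasure n a
      = ∫ x in annulus n a b, ‖x‖ ^ (-(n : ℤ) - 1) *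
        (2 * v x * inner ℝ x (gradient v x) - v x ^ 2) := by
  have hb : 0 < b := ha.trans hab
  have hk : Continuous fun x : Space n => fderiv ℝ (fun z => v z ^ 2) x x - v x ^ 2 :=
    (continuous_fderiv_sq hv).sub (hv.continuous.pow 2)
  have hθ : ∀ θ : sphere (0 : Space n) 1, ∀ s : ℝ, 0 < s → ‖s • (θ : Space n)‖ = s := fun θ s hs => by
    rw [norm_smul, Real.norm_of_nonneg hs.le]
    simp
  have h := setIntegral_annulus_eq hn ha.le hab (f := fun z => v z ^ 2)
    (k := fun x => ‖x‖ ^ (-(n : ℤ) - 1) * (fderiv ℝ (fun z => v z ^ 2) x x - v x ^ 2))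
    -- This is `r ^ (-n) * r ^ (n - 1)`: the normalization of the boundary term times the area
    -- factor of the sphere.
    (m := fun r => r⁻¹)
    (hv.continuous.pow 2) (continuousOn_inv₀.mono fun s hs => (ha.trans_le hs.1).ne')
    (by
      have hK : IsCompact {x : Space n | a ≤ ‖x‖ ∧ ‖x‖ ≤ b} := by
        refine (isCompact_closedBall (0 : Space n) b).of_isClosed_subset
          ((isClosed_le continuous_const continuous_norm).inter
            (isClosed_le continuous_norm continuous_const)) fun x hx => ?_
        simpa using hx.2
      refine IntegrableOn.mono_set (ContinuousOn.integrableOn_compact hK ?_)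
        (fun x hx => ⟨hx.1, hx.2.le⟩)
      refine ContinuousOn.mul ?_ hk.continuousOn
      exact continuous_norm.continuousOn.zpow₀ _ fun x hx => Or.inl (ha.trans_le hx.1).ne')
    (fun θ => by
      refine (continuous_pow _).continuousOn.mul (ContinuousOn.mul ?_
        (hk.comp (continuous_id.smul continuous_const)).continuousOn)
      refine ContinuousOn.zpow₀ (continuous_norm.comp
        (continuous_id.smul continuous_const)).continuousOn _ fun s hs => Or.inl ?_
      exact (hθ θ s (ha.trans_le hs.1)).trans_ne (ha.trans_le hs.1).ne')
    (fun θ s hs => by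
      have hs0 : 0 < s := ha.trans hs.1
      have h1 := (hasDerivAt_inv hs0.ne').mul (hasDerivAt_comp_ray (hv.pow 2) (θ : Space n) s)
      refine h1.congr_deriv ?_
      rw [hθ θ s hs0, map_smul, smul_eq_mul, ← mul_assoc]
      have h2 : s ^ (n - 1) * s ^ (-(n : ℤ) - 1) = (s ^ 2)⁻¹ := by
        rw [← zpow_natCast, ← zpow_add₀ hs0.ne', ← zpow_natCast s 2, ← zpow_neg]
        congr 1
        push_cast [Nat.cast_sub hn]
        ring
      rw [h2]
      field_simp
      ring)
  simp only [fderiv_sq hv] at h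
  have hi : ∀ s : ℝ, Integrable (fun θ : sphere (0 : Space n) 1 => v (s • (θ : Space n)) ^ 2)
      (sphereMeasure n) := fun s => by
    have hc : Continuous fun θ : sphere (0 : Space n) 1 => v (s • (θ : Space n)) ^ 2 := by
      have := hv.continuous
      fun_prop
    exact hc.integrable_of_hasCompactSupport (HasCompactSupport.of_compactSpace _)
  have hz : ∀ s : ℝ, 0 < s → s ^ (-(n : ℤ)) * s ^ (n - 1) = s⁻¹ := fun s hs => by
    rw [← zpow_natCast, ← zpow_add₀ hs.ne', ← zpow_neg_one]
    congr 1
    push_cast [Nat.cast_sub hn]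
    ring
  rw [h, integral_surfaceMeasure ha (g := fun x => v x ^ 2) (hv.continuous.pow 2).aestronglyMeasurable,
    integral_surfaceMeasure hb (g := fun x => v x ^ 2) (hv.continuous.pow 2).aestronglyMeasurable, ← mul_assoc, ← mul_assoc,
    hz a ha, hz b hb, integral_sub ((hi b).const_mul _) ((hi a).const_mul _), integral_const_mul,
    integral_const_mul]

end Polar

/-! ### Density of smooth functions in `H¹` of a ball -/

section Approximation

variable {F : Type*} [NormedAddCommGroup F] [NormedSpace ℝ F] [CompleteSpace F]

lemma eLpNorm_two_sq {α : Type*} {m : MeasurableSpace α} (μ : Measure α) {G : Type*}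
    [NormedAddCommGroup G] (f : α → G) : eLpNorm f 2 μ ^ 2 = ∫⁻ x, ‖f x‖ₑ ^ 2 ∂μ := by
  have h := eLpNorm_nnreal_pow_eq_lintegral (f := f) (μ := μ) (p := 2) (by norm_num)
  simpa using h

lemma eLpNorm_two_le_iff {α β : Type*} {m : MeasurableSpace α} {m' : MeasurableSpace β}
    {μ : Measure α} {ν : Measure β} {G H : Type*} [NormedAddCommGroup G] [NormedAddCommGroup H]
    {f : α → G} {g : β → H} :
    eLpNorm f 2 μ ≤ eLpNorm g 2 ν ↔ ∫⁻ x, ‖f x‖ₑ ^ 2 ∂μ ≤ ∫⁻ x, ‖g x‖ₑ ^ 2 ∂ν := by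
  rw [← eLpNorm_two_sq, ← eLpNorm_two_sq]
  exact (ENNReal.pow_le_pow_left_iff two_ne_zero).symm

/-- Mollification does not increase the `L²` norm. -/
lemma eLpNorm_mollify_le (φ : ContDiffBump (0 : Space n)) {f : Space n → F}
    (hf : AEStronglyMeasurable f) : eLpNorm (mollify φ f) 2 volume ≤ eLpNorm f 2 volume := by
  set ρ : Space n → ℝ≥0∞ := fun t => ‖φ.normed volume t‖ₑ with hρ
  have hρm : Measurable ρ := φ.continuous_normed.measurable.enorm
  have hρ1 : ∫⁻ t, ρ t = 1 := by
    have := ofReal_integral_eq_lintegral_ofReal (φ.integrable_normed (μ := volume))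
      (Eventually.of_forall φ.nonneg_normed)
    rw [φ.integral_normed, ENNReal.ofReal_one] at this
    rw [this]
    exact lintegral_congr fun t => (Real.enorm_of_nonneg (φ.nonneg_normed t))
  -- On a probability space the `L¹` norm is at most the `L²` norm, which gives the pointwise Jensen
  -- inequality; Tonelli and translation invariance finish.
  have : IsProbabilityMeasure (volume.withDensity ρ) := ⟨by
    rw [withDensity_apply _ MeasurableSet.univ, Measure.restrict_univ, hρ1]⟩
  have hjoint : AEStronglyMeasurable (fun z : Space n × Space n => f (z.1 - z.2))
      (volume.prod volume) := hf.comp_quasiMeasurePreserving (quasiMeasurePreserving_sub _ _)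
  have hpt : ∀ x, ‖mollify φ f x‖ₑ ^ 2 ≤ ∫⁻ t, ρ t * ‖f (x - t)‖ₑ ^ 2 := fun x => by
    have hfx : AEStronglyMeasurable (fun t => f (x - t)) :=
      hf.comp_quasiMeasurePreserving (quasiMeasurePreserving_sub_left _ x)
    have hfx' : AEStronglyMeasurable (fun t => f (x - t)) (volume.withDensity ρ) :=
      hfx.mono_ac (withDensity_absolutelyContinuous _ _)
    have h1 : ‖mollify φ f x‖ₑ ≤ eLpNorm (fun t => f (x - t)) 1 (volume.withDensity ρ) := by
      rw [eLpNorm_one_eq_lintegral_enorm, lintegral_withDensity_eq_lintegral_mul₀ hρm.aemeasurable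
        hfx.enorm, mollify_apply]
      refine (enorm_integral_le_lintegral_enorm _).trans (lintegral_mono fun t => ?_)
      rw [enorm_smul]
      rfl
    have h2 := h1.trans (eLpNorm_le_eLpNorm_of_exponent_le (p := 1) (q := 2) (by norm_num) hfx')
    refine (pow_le_pow_left' h2 2).trans (le_of_eq ?_)
    rw [eLpNorm_two_sq, lintegral_withDensity_eq_lintegral_mul₀ hρm.aemeasurable
      (hfx.enorm.pow_const 2)]
    rfl
  rw [eLpNorm_two_le_iff]
  calc ∫⁻ x, ‖mollify φ f x‖ₑ ^ 2 ≤ ∫⁻ x, ∫⁻ t, ρ t * ‖f (x - t)‖ₑ ^ 2 := lintegral_mono hpt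
    _ = ∫⁻ t, ∫⁻ x, ρ t * ‖f (x - t)‖ₑ ^ 2 := by
        refine lintegral_lintegral_swap ?_
        exact (hρm.comp measurable_snd).aemeasurable.mul (hjoint.enorm.pow_const 2)
    _ = ∫⁻ t, ρ t * ∫⁻ x, ‖f x‖ₑ ^ 2 := by
        refine lintegral_congr fun t => ?_
        rw [lintegral_const_mul' _ _ enorm_ne_top,
          lintegral_sub_right_eq_self (fun x => ‖f x‖ₑ ^ 2) t]
    _ = ∫⁻ x, ‖f x‖ₑ ^ 2 := by
        rw [lintegral_mul_const _ hρm, hρ1, one_mul]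

/-- Rescaling multiplies the squared norm by `c ^ (-n) ≤ 2 ^ n`. The constant is crude; only
uniformity in `c` matters. -/
lemma eLpNorm_comp_smul_le {G : Type*} [NormedAddCommGroup G] {f : Space n → G} {c : ℝ}
    (hc : 1 / 2 ≤ c) :
    eLpNorm (fun x => f (c • x)) 2 volume ≤ 2 ^ n * eLpNorm f 2 volume := by
  have hc0 : 0 < c := by linarith
  have hemb : MeasurableEmbedding fun x : Space n => c • x :=
    (Homeomorph.smulOfNeZero c hc0.ne').measurableEmbedding
  have h1 : ∫⁻ x, ‖f (c • x)‖ₑ ^ 2 = ENNReal.ofReal |(c ^ n)⁻¹| * ∫⁻ x, ‖f x‖ₑ ^ 2 := by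
    rw [← hemb.lintegral_map (fun x => ‖f x‖ₑ ^ 2), Measure.map_addHaar_smul _ hc0.ne',
      lintegral_smul_measure]
    simp
  have h2 : ENNReal.ofReal |(c ^ n)⁻¹| ≤ 2 ^ n := by
    rw [abs_of_pos (by positivity), ← inv_pow, ENNReal.ofReal_pow (by positivity)]
    refine pow_le_pow_left' ?_ n
    rw [← ENNReal.ofReal_ofNat]
    refine ENNReal.ofReal_le_ofReal ?_
    rw [inv_le_comm₀ hc0 (by norm_num)]
    linarith
  rw [← ENNReal.pow_le_pow_left_iff two_ne_zero, mul_pow, eLpNorm_two_sq, eLpNorm_two_sq, h1]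
  gcongr
  refine h2.trans (le_self_pow (one_le_pow₀ (by norm_num)) two_ne_zero)

/-- Dilated mollifications converge in `L²`. -/
lemma tendsto_eLpNorm_mollify_comp_smul {φ : ℕ → ContDiffBump (0 : Space n)}
    (hφ : Tendsto (fun k => (φ k).rOut) atTop (𝓝 0)) (hφ1 : ∀ k, (φ k).rOut ≤ 1) {c : ℕ → ℝ}
    (hc : Tendsto c atTop (𝓝 1)) (hc' : ∀ k, 1 / 2 ≤ c k) {f : Space n → F} (hf : MemLp f 2 volume) :
    Tendsto (fun k => eLpNorm (fun x => mollify (φ k) f (c k • x) - f x) 2 volume) atTop (𝓝 0) := by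
  -- Pointwise convergence and domination settle continuous compactly supported `g`; density and the
  -- uniform bounds above extend the result to `L²`.
  have hcont : ∀ g : Space n → F, Continuous g → HasCompactSupport g →
      Tendsto (fun k => eLpNorm (fun x => mollify (φ k) g (c k • x) - g x) 2 volume) atTop (𝓝 0) := by
    intro g hg hgc
    obtain ⟨C, hC⟩ := hgc.exists_bound_of_continuous hg
    obtain ⟨M, hM0, hM⟩ := (hgc.isBounded).exists_pos_norm_le
    have hsupp : ∀ x, M < ‖x‖ → g x = 0 := fun x hx => by
      by_contra h
      exact absurd (hM x (subset_tsupport g h)) (not_le.2 hx)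
    have hlim : Tendsto (fun k => ∫⁻ x, ‖mollify (φ k) g (c k • x) - g x‖ₑ ^ 2) atTop
        (𝓝 (∫⁻ _ : Space n, 0)) := by
      refine tendsto_lintegral_of_dominated_convergence
        ((closedBall (0 : Space n) (2 * (M + 1))).indicator fun _ => ENNReal.ofReal (C + C) ^ 2)
        (fun k => ?_) (fun k => Eventually.of_forall fun x => ?_) ?_
        (Eventually.of_forall fun x => ?_)
      · have h1 := (contDiff_mollify (φ k) hg.locallyIntegrable).continuous
        have h2 : Continuous fun x => mollify (φ k) g (c k • x) := h1.comp (by fun_prop)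
        exact (h2.sub hg).enorm.measurable.pow_const 2
      · by_cases hx : x ∈ closedBall (0 : Space n) (2 * (M + 1))
        · rw [indicator_of_mem hx]
          refine pow_le_pow_left' ?_ 2
          rw [← ofReal_norm]
          exact ENNReal.ofReal_le_ofReal ((norm_sub_le _ _).trans
            (add_le_add (norm_mollify_le _ hC _) (hC x)))
        -- Since `c k ≥ 1/2`, such an `x` has `|c k x| > M + 1`, and the kernel reaches at distance
        -- at most `1`, so it does not meet the support of `g`.
        · have hx' : 2 * (M + 1) < ‖x‖ := by simpa using hx
          rw [indicator_of_notMem hx]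
          beta_reduce
          rw [hsupp x (by linarith), mollify_eq_zero]
          · simp
          · intro y hy
            refine hsupp y ?_
            have h1 : ‖c k • x‖ - ‖y‖ ≤ ‖c k • x - y‖ := norm_sub_norm_le _ _
            have h2 : ‖c k • x - y‖ < (φ k).rOut := by
              rw [← dist_eq_norm, dist_comm]
              exact hy
            have h3 : ‖c k • x‖ = c k * ‖x‖ := by
              rw [norm_smul, Real.norm_of_nonneg (by linarith [hc' k])]
            have h4 : 1 / 2 * ‖x‖ ≤ c k * ‖x‖ :=
              mul_le_mul_of_nonneg_right (hc' k) (norm_nonneg x)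
            linarith [hφ1 k]
      · rw [lintegral_indicator measurableSet_closedBall, lintegral_const]
        refine ENNReal.mul_ne_top (by simp) ?_
        rw [Measure.restrict_apply_univ]
        exact measure_closedBall_lt_top.ne
      · have h1 : Tendsto (fun k => mollify (φ k) g (c k • x)) atTop (𝓝 (g x)) := by
          refine ContDiffBump.convolution_tendsto_right (g := fun _ => g) (k := fun k => c k • x)
            hφ (Eventually.of_forall fun _ => hg.aestronglyMeasurable) ?_ ?_
            (x₀ := x)
          · exact (hg.tendsto x).comp tendsto_snd
          · simpa using hc.smul_const x
        have h2 := ((h1.sub_const (g x)).enorm)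
        rw [sub_self, enorm_zero] at h2
        simpa using ENNReal.Tendsto.pow (n := 2) h2
    rw [lintegral_zero] at hlim
    have h3 : Tendsto (fun k => (∫⁻ x, ‖mollify (φ k) g (c k • x) - g x‖ₑ ^ 2) ^ (1 / 2 : ℝ)) atTop
        (𝓝 (0 ^ (1 / 2 : ℝ))) := hlim.ennrpow_const _
    rw [ENNReal.zero_rpow_of_pos (by norm_num)] at h3
    refine h3.congr fun k => ?_
    rw [← eLpNorm_two_sq, ← ENNReal.rpow_natCast, ← ENNReal.rpow_mul]
    norm_num
  rw [ENNReal.tendsto_atTop_zero]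
  intro ε hε
  -- The three errors are `2 ^ n δ` for the mollified difference, `δ` for the continuous function,
  -- and `δ` for `g - f`.
  obtain ⟨δ, hδ0, hδ⟩ : ∃ δ : ℝ≥0∞, δ ≠ 0 ∧ (2 ^ n + 2) * δ ≤ ε := by
    refine ⟨ε / (2 ^ n + 2), (ENNReal.div_pos hε.ne' (by simp)).ne', ?_⟩
    exact ENNReal.mul_div_le
  obtain ⟨g, hgc, hfg, hg, hgm⟩ := hf.exists_hasCompactSupport_eLpNorm_sub_le (by norm_num) hδ0
  obtain ⟨N, hN⟩ := (ENNReal.tendsto_atTop_zero.1 (hcont g hg hgc)) δ hδ0.bot_lt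
  refine ⟨N, fun k hk => ?_⟩
  have hloc : LocallyIntegrable f := hf.locallyIntegrable (by norm_num)
  have hlocg : LocallyIntegrable g := hg.locallyIntegrable
  have hsplit : (fun x => mollify (φ k) f (c k • x) - f x)
      = fun x => (mollify (φ k) (f - g) (c k • x) + (mollify (φ k) g (c k • x) - g x)) + (g x - f x) := by
    funext x
    have : mollify (φ k) (f - g) (c k • x) = mollify (φ k) f (c k • x) - mollify (φ k) g (c k • x) := by
      rw [mollify_apply, mollify_apply, mollify_apply, ← integral_sub]
      · simp only [Pi.sub_apply, smul_sub]
      · exact (φ k).hasCompactSupport_normed.convolutionExists_left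
          (ContinuousLinearMap.lsmul ℝ ℝ) (φ k).continuous_normed hloc _
      · exact (φ k).hasCompactSupport_normed.convolutionExists_left
          (ContinuousLinearMap.lsmul ℝ ℝ) (φ k).continuous_normed hlocg _
    rw [this]
    abel
  have hm1 : Continuous fun x => mollify (φ k) (f - g) (c k • x) :=
    (contDiff_mollify (φ k) (hloc.sub hlocg)).continuous.comp (by fun_prop)
  have hm2 : Continuous fun x => mollify (φ k) g (c k • x) - g x :=
    ((contDiff_mollify (φ k) hlocg).continuous.comp (by fun_prop)).sub hg
  rw [hsplit]
  calc _ ≤ eLpNorm (fun x => mollify (φ k) (f - g) (c k • x) + (mollify (φ k) g (c k • x) - g x)) 2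
          volume + eLpNorm (fun x => g x - f x) 2 volume :=
        eLpNorm_add_le (hm1.add hm2).aestronglyMeasurable
          (hg.aestronglyMeasurable.sub hf.aestronglyMeasurable) (by norm_num)
    _ ≤ (eLpNorm (fun x => mollify (φ k) (f - g) (c k • x)) 2 volume
          + eLpNorm (fun x => mollify (φ k) g (c k • x) - g x) 2 volume)
          + eLpNorm (fun x => g x - f x) 2 volume := by
        gcongr
        exact eLpNorm_add_le hm1.aestronglyMeasurable hm2.aestronglyMeasurable (by norm_num)
    _ ≤ (2 ^ n * δ + δ) + δ := by
        gcongr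
        · refine (eLpNorm_comp_smul_le (hc' k)).trans ?_
          gcongr
          exact (eLpNorm_mollify_le (φ k)
            (hf.aestronglyMeasurable.sub hg.aestronglyMeasurable)).trans hfg
        · exact hN k hk
        · rw [← eLpNorm_neg]
          refine le_trans (le_of_eq ?_) hfg
          congr 1
          funext x
          simp
    _ = (2 ^ n + 2) * δ := by ring
    _ ≤ ε := hδ

/-- The function is merely locally integrable, so the derivative falls on the kernel. -/
lemma fderiv_mollify_apply (φ : ContDiffBump (0 : Space n)) {f : Space n → ℝ}
    (hf : LocallyIntegrable f) (x v : Space n) :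
    fderiv ℝ (mollify φ f) x v = ∫ t, f t * fderiv ℝ (φ.normed volume) (x - t) v := by
  have e : mollify φ f = convolution f (φ.normed volume) (ContinuousLinearMap.lsmul ℝ ℝ).flip volume := by
    rw [convolution_flip]
    rfl
  have hcs : HasCompactSupport (φ.normed (volume : Measure (Space n))) := φ.hasCompactSupport_normed
  have hcd : ContDiff ℝ 1 (φ.normed (volume : Measure (Space n))) := φ.contDiff_normed
  have h := (hcs.hasFDerivAt_convolution_right
    (ContinuousLinearMap.lsmul ℝ ℝ : ℝ →L[ℝ] ℝ →L[ℝ] ℝ).flip hf hcd x).fderiv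
  rw [e, h, convolution_precompR_apply _ hf (hcs.fderiv ℝ)
    (hcd.continuous_fderiv one_ne_zero), convolution_def]
  refine integral_congr_ae (Eventually.of_forall fun t => ?_)
  simp [mul_comm]

/-- Away from the boundary, the gradient of a mollification is the mollification of the weak
gradient. -/
lemma IsWeakGradient.gradient_mollify {U : Set (Space n)} {u : Space n → ℝ} {G : Space n → Space n} (h : IsWeakGradient U u G)
    (hu : LocallyIntegrable (U.indicator u)) (hG : LocallyIntegrable (U.indicator G))
    (φ : ContDiffBump (0 : Space n)) {x : Space n} (hx : closedBall x φ.rOut ⊆ U) :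
    gradient (mollify φ (U.indicator u)) x = mollify φ (U.indicator G) x := by
  refine ext_inner_right ℝ fun v => ?_
  -- The reflected kernel is itself a test function in `U`, because its closed ball lies in `U`;
  -- reflection changes the sign of its derivative.
  set ψ : Space n → ℝ := fun t => φ.normed volume (x - t) with hψ
  have hsupp : ∀ t, t ∉ closedBall x φ.rOut → ψ t = 0 := fun t ht => by
    simp only [hψ]
    rw [← Function.notMem_support, φ.support_normed_eq]
    intro h2
    exact ht (by simpa [dist_eq_norm, norm_sub_rev] using (mem_ball.1 h2).le)
  have hψc : ContDiff ℝ ∞ ψ := φ.contDiff_normed.comp (contDiff_const.sub contDiff_id)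
  have hts : tsupport ψ ⊆ closedBall x φ.rOut :=
    closure_minimal (fun t ht => by by_contra h2; exact ht (hsupp t h2)) isClosed_closedBall
  have hψt : IsTest U ψ := ⟨hψc, (isCompact_closedBall x φ.rOut).of_isClosed_subset
    (isClosed_tsupport _) hts, hts.trans hx⟩
  have hd : ∀ t, fderiv ℝ ψ t v = -fderiv ℝ (φ.normed volume) (x - t) v := fun t => by
    have h1 : HasFDerivAt ψ ((fderiv ℝ (φ.normed volume) (x - t)).comp
        (-ContinuousLinearMap.id ℝ (Space n))) t :=
      (((φ.contDiff_normed (n := 1)).differentiable one_ne_zero) (x - t)).hasFDerivAt.comp t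
        ((hasFDerivAt_id t).const_sub x)
    rw [h1.fderiv]
    simp
  have key := h.integral_mul_divergence (hψt.smul_right (contDiff_const (c := v)))
  rw [inner_gradient_left', fderiv_mollify_apply φ hu, mollify_apply_swap]
  have h1 : ∫ t, U.indicator u t * fderiv ℝ (φ.normed volume) (x - t) v
      = -∫ t, u t * divergence (fun y => ψ y • v) t := by
    rw [← integral_neg]
    refine integral_congr_ae (Eventually.of_forall fun t => ?_)
    simp only
    rw [divergence_smul_const (hψt.differentiable t)]
    by_cases ht : t ∈ U
    · rw [indicator_of_mem ht, hd]
      ring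
    · have h2 := hd t
      rw [hψt.fderiv_eq_zero ht] at h2 ⊢
      simp [ht]
  have hI : Integrable fun t => φ.normed volume (x - t) • U.indicator G t :=
    (hψt.mono (subset_univ U)).integrable_smul (hG.locallyIntegrableOn univ)
  rw [h1, key, neg_neg, real_inner_comm, ← integral_inner hI]
  refine integral_congr_ae (Eventually.of_forall fun t => ?_)
  simp only [inner_smul_right, hψ]
  by_cases ht : t ∈ U
  · rw [indicator_of_mem ht, real_inner_comm]
  · rw [show φ.normed volume (x - t) = 0 from hψt.comp_apply ht]
    simp

set_option maxHeartbeats 800000 in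
/-- Smooth functions are dense in `H¹(B_r)`. -/
lemma exists_smooth_approx {r : ℝ} (hr : 0 < r) {u : Space n → ℝ} {G : Space n → Space n}
    (h : IsWeakGradient (ball 0 r) u G) (hu : MemLp u 2 (volume.restrict (ball 0 r)))
    (hG : MemLp G 2 (volume.restrict (ball 0 r))) :
    ∃ v : ℕ → Space n → ℝ, (∀ k, ContDiff ℝ ∞ (v k)) ∧
      Tendsto (fun k => eLpNorm (fun x => v k x - u x) 2 (volume.restrict (ball 0 r)))
        atTop (𝓝 0) ∧
      Tendsto (fun k => eLpNorm (fun x => gradient (v k) x - G x) 2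
        (volume.restrict (ball 0 r))) atTop (𝓝 0) := by
  set B : Set (Space n) := ball 0 r
  have hB : MeasurableSet B := measurableSet_ball
  have hu' : MemLp (B.indicator u) 2 volume := (memLp_indicator_iff_restrict hB).2 hu
  have hG' : MemLp (B.indicator G) 2 volume := (memLp_indicator_iff_restrict hB).2 hG
  have hul : LocallyIntegrable (B.indicator u) := hu'.locallyIntegrable one_le_two
  have hGl : LocallyIntegrable (B.indicator G) := hG'.locallyIntegrable one_le_two
  set m : ℝ := min r 1 with hm
  have hm0 : 0 < m := lt_min hr one_pos
  have hδ : ∀ k : ℕ, 0 < m / (2 * ((k : ℝ) + 2)) := fun k => by positivity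
  let φ : ℕ → ContDiffBump (0 : Space n) := fun k =>
    ⟨m / (2 * ((k : ℝ) + 2)) / 2, m / (2 * ((k : ℝ) + 2)), half_pos (hδ k), half_lt_self (hδ k)⟩
  -- Shrinking the argument by `c k` opens a gap `r / (k + 2)` to the sphere, larger than the
  -- mollification radius, which is at most `r / (2 (k + 2))`. Hence mollification sees only points
  -- of the ball, and no extension of `u` is needed.
  let c : ℕ → ℝ := fun k => 1 - 1 / ((k : ℝ) + 2)
  have hinv : Tendsto (fun k : ℕ => 1 / ((k : ℝ) + 2)) atTop (𝓝 0) := by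
    have := (tendsto_one_div_add_atTop_nhds_zero_nat (𝕜 := ℝ)).comp (tendsto_add_atTop_nat 1)
    refine this.congr fun k => ?_
    simp only [Function.comp_apply]
    push_cast
    ring
  have hφ : Tendsto (fun k => (φ k).rOut) atTop (𝓝 0) := by
    have := hinv.const_mul (m / 2)
    rw [mul_zero] at this
    refine this.congr fun k => ?_
    change _ = m / (2 * ((k : ℝ) + 2))
    field_simp
  have hk2 : ∀ k : ℕ, 1 / ((k : ℝ) + 2) ≤ 1 / 2 := fun k =>
    one_div_le_one_div_of_le (by norm_num) (by linarith [k.cast_nonneg (α := ℝ)])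
  have hrel : ∀ k : ℕ, (φ k).rOut = m / 2 * (1 / ((k : ℝ) + 2)) := fun k => by
    change m / (2 * ((k : ℝ) + 2)) = _
    field_simp
  have hpos : ∀ k : ℕ, 0 < 1 / ((k : ℝ) + 2) := fun k => by positivity
  have hφ1 : ∀ k, (φ k).rOut ≤ 1 := fun k => by
    rw [hrel]
    nlinarith [hk2 k, hpos k, min_le_right r 1]
  have hc : Tendsto c atTop (𝓝 1) := by simpa [c] using hinv.const_sub 1
  have hc' : ∀ k, 1 / 2 ≤ c k := fun k => by
    change 1 / 2 ≤ 1 - 1 / ((k : ℝ) + 2)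
    linarith [hk2 k]
  have hsub : ∀ k, ∀ x ∈ B, closedBall (c k • x) (φ k).rOut ⊆ B := fun k x hx y hy => by
    have hx' : ‖x‖ < r := by simpa [B] using hx
    have h1 : ‖y - c k • x‖ ≤ (φ k).rOut := by simpa [dist_eq_norm] using hy
    have h2 : ‖y‖ ≤ ‖y - c k • x‖ + ‖c k • x‖ := by
      simpa using norm_add_le (y - c k • x) (c k • x)
    have h3 : ‖c k • x‖ = (1 - 1 / ((k : ℝ) + 2)) * ‖x‖ := by
      rw [norm_smul, Real.norm_of_nonneg (by linarith [hc' k])]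
    have h4 : (1 - 1 / ((k : ℝ) + 2)) * ‖x‖ ≤ (1 - 1 / ((k : ℝ) + 2)) * r :=
      mul_le_mul_of_nonneg_left hx'.le (by linarith [hk2 k])
    have h5 : m / 2 * (1 / ((k : ℝ) + 2)) < r * (1 / ((k : ℝ) + 2)) :=
      mul_lt_mul_of_pos_right (by linarith [min_le_left r 1]) (hpos k)
    have : ‖y‖ < r := by
      rw [hrel] at h1
      linarith
    simpa [B] using this
  have hvs : ∀ k, ContDiff ℝ ∞ fun x => mollify (φ k) (B.indicator u) (c k • x) := fun k =>
    (contDiff_mollify (φ k) hul).comp (contDiff_const_smul (c k))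
  have hgrad : ∀ k, ∀ x ∈ B, gradient (fun x => mollify (φ k) (B.indicator u) (c k • x)) x
      = c k • mollify (φ k) (B.indicator G) (c k • x) := fun k x hx => by
    rw [← h.gradient_mollify hul hGl (φ k) (hsub k x hx)]
    refine ext_inner_right ℝ fun w => ?_
    rw [inner_smul_left, inner_gradient_left', inner_gradient_left']
    have h1 : HasFDerivAt (fun x => mollify (φ k) (B.indicator u) (c k • x))
        ((fderiv ℝ (mollify (φ k) (B.indicator u)) (c k • x)).comp
          (c k • ContinuousLinearMap.id ℝ (Space n))) x :=
      ((contDiff_mollify (φ k) hul).differentiable (by simp) (c k • x)).hasFDerivAt.comp x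
        ((hasFDerivAt_id x).const_smul (c k))
    rw [h1.fderiv]
    simp
  have hcs : ∀ (a : ℝ) (f : Space n → Space n),
      eLpNorm (fun x => a • f x) 2 volume = ‖a‖ₑ * eLpNorm f 2 volume :=
    fun a f => eLpNorm_const_smul a f 2 volume
  have hU := tendsto_eLpNorm_mollify_comp_smul hφ hφ1 hc hc' hu'
  have hP := tendsto_eLpNorm_mollify_comp_smul hφ hφ1 hc hc' hG'
  refine ⟨fun k x => mollify (φ k) (B.indicator u) (c k • x), hvs, ?_, ?_⟩
  · refine tendsto_of_tendsto_of_tendsto_of_le_of_le tendsto_const_nhds hU (fun _ => zero_le)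
      fun k => ?_
    refine le_trans (le_of_eq ?_) (eLpNorm_mono_measure _ (Measure.restrict_le_self (s := B)))
    refine eLpNorm_congr_ae ?_
    filter_upwards [ae_restrict_mem hB] with x hx
    rw [indicator_of_mem hx]
  -- The second term pays for the factor `c k` that the chain rule puts in front of the gradient.
  · have hfin : Tendsto (fun k => eLpNorm (fun x => mollify (φ k) (B.indicator G) (c k • x)
        - B.indicator G x) 2 volume + ‖c k - 1‖ₑ * eLpNorm (B.indicator G) 2 volume) atTop (𝓝 0) := by
      have h1 : Tendsto (fun k => ‖c k - 1‖ₑ) atTop (𝓝 0) := by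
        have := (hc.sub_const 1).enorm
        rwa [sub_self, enorm_zero] at this
      have h2 := ENNReal.Tendsto.mul_const h1 (Or.inr hG'.eLpNorm_ne_top)
      rw [zero_mul] at h2
      simpa using hP.add h2
    refine tendsto_of_tendsto_of_tendsto_of_le_of_le tendsto_const_nhds hfin (fun _ => zero_le)
      fun k => ?_
    have hmc : Continuous fun x => mollify (φ k) (B.indicator G) (c k • x) :=
      (contDiff_mollify (φ k) hGl).continuous.comp (by fun_prop)
    have hck : ‖c k‖ₑ ≤ 1 := by
      rw [← ofReal_norm, Real.norm_of_nonneg (by linarith [hc' k])]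
      refine ENNReal.ofReal_le_one.2 ?_
      change 1 - 1 / ((k : ℝ) + 2) ≤ 1
      linarith [hpos k]
    calc _ = eLpNorm (fun x => c k • (mollify (φ k) (B.indicator G) (c k • x) - B.indicator G x)
          + (c k - 1) • B.indicator G x) 2 (volume.restrict B) := by
          refine eLpNorm_congr_ae ?_
          filter_upwards [ae_restrict_mem hB] with x hx
          rw [hgrad k x hx, indicator_of_mem hx]
          module
      _ ≤ eLpNorm (fun x => c k • (mollify (φ k) (B.indicator G) (c k • x) - B.indicator G x)
          + (c k - 1) • B.indicator G x) 2 volume :=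
          eLpNorm_mono_measure _ Measure.restrict_le_self
      _ ≤ eLpNorm (fun x => c k • (mollify (φ k) (B.indicator G) (c k • x) - B.indicator G x)) 2 volume
          + eLpNorm (fun x => (c k - 1) • B.indicator G x) 2 volume :=
          eLpNorm_add_le ((hmc.aestronglyMeasurable.sub hG'.1).const_smul (c k))
            (hG'.1.const_smul (c k - 1)) one_le_two
      _ ≤ _ := by
          rw [hcs, hcs]
          gcongr
          exact mul_le_of_le_one_left' hck

end Approximation

/-! ### Traces on spheres -/

section Trace

lemma sq_toReal_eLpNorm {F : Type*} [NormedAddCommGroup F] {μ : Measure (Space n)} {f : Space n → F}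
    (hf : MemLp f 2 μ) : (eLpNorm f 2 μ).toReal ^ 2 = ∫ x, ‖f x‖ ^ 2 ∂μ := by
  rw [← ENNReal.toReal_pow, eLpNorm_two_sq, lintegral_enorm_sq hf,
    ENNReal.toReal_ofReal (integral_nonneg fun x => by positivity)]

/-- Products of `L²`-convergent sequences converge in mean. -/
lemma tendsto_integral_mul_of_tendsto_eLpNorm {μ : Measure (Space n)} {f g : Space n → ℝ}
    {fk gk : ℕ → Space n → ℝ} (hf : MemLp f 2 μ) (hg : MemLp g 2 μ) (hfk : ∀ k, MemLp (fk k) 2 μ)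
    (hgk : ∀ k, MemLp (gk k) 2 μ)
    (h1 : Tendsto (fun k => eLpNorm (fun x => fk k x - f x) 2 μ) atTop (𝓝 0))
    (h2 : Tendsto (fun k => eLpNorm (fun x => gk k x - g x) 2 μ) atTop (𝓝 0)) :
    Tendsto (fun k => ∫ x, fk k x * gk k x ∂μ) atTop (𝓝 (∫ x, f x * g x ∂μ)) := by
  have t1 := (Lp.tendsto_Lp_iff_tendsto_eLpNorm'' fk hfk f hf).2 h1
  have t2 := (Lp.tendsto_Lp_iff_tendsto_eLpNorm'' gk hgk g hg).2 h2
  have key : ∀ (a b : Space n → ℝ) (ha : MemLp a 2 μ) (hb : MemLp b 2 μ),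
      inner ℝ (ha.toLp a) (hb.toLp b) = ∫ x, a x * b x ∂μ := fun a b ha hb => by
    rw [L2.inner_def]
    refine integral_congr_ae ?_
    filter_upwards [ha.coeFn_toLp, hb.coeFn_toLp] with x hx hy
    rw [hx, hy]
    simp [mul_comm]
  have t3 := t1.inner t2 (𝕜 := ℝ)
  rw [key] at t3
  exact t3.congr fun k => key _ _ _ _

lemma eLpNorm_inner_le {μ : Measure (Space n)} {w G : Space n → Space n} {C : ℝ}
    (hw : ∀ᵐ x ∂μ, ‖w x‖ ≤ C) :
    eLpNorm (fun x => inner ℝ (w x) (G x)) 2 μ ≤ ENNReal.ofReal C * eLpNorm G 2 μ := by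
  refine eLpNorm_le_mul_eLpNorm_of_ae_le_mul ?_ 2
  filter_upwards [hw] with x hx
  exact (norm_inner_le_norm _ _).trans (mul_le_mul_of_nonneg_right hx (norm_nonneg _))

lemma tendsto_eLpNorm_inner {μ : Measure (Space n)} {w G : Space n → Space n} {C : ℝ}
    (hw : ∀ᵐ x ∂μ, ‖w x‖ ≤ C) {Gk : ℕ → Space n → Space n}
    (h : Tendsto (fun k => eLpNorm (fun x => Gk k x - G x) 2 μ) atTop (𝓝 0)) :
    Tendsto (fun k => eLpNorm (fun x => inner ℝ (w x) (Gk k x) - inner ℝ (w x) (G x)) 2 μ)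
      atTop (𝓝 0) := by
  have h1 := ENNReal.Tendsto.const_mul (a := ENNReal.ofReal C) h (Or.inr ENNReal.ofReal_ne_top)
  rw [mul_zero] at h1
  refine tendsto_of_tendsto_of_tendsto_of_le_of_le tendsto_const_nhds h1 (fun _ => zero_le)
    fun k => ?_
  simp only [← inner_sub_right]
  exact eLpNorm_inner_le hw

lemma memLp_inner {μ : Measure (Space n)} {w G : Space n → Space n} {C : ℝ}
    (hw : ∀ᵐ x ∂μ, ‖w x‖ ≤ C) (hwm : AEStronglyMeasurable w μ) (hG : MemLp G 2 μ) :
    MemLp (fun x => inner ℝ (w x) (G x)) 2 μ :=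
  ⟨hwm.inner hG.1, (eLpNorm_inner_le hw).trans_lt
    (ENNReal.mul_lt_top ENNReal.ofReal_lt_top hG.eLpNorm_lt_top)⟩

lemma _root_.Continuous.memLp_of_ae_norm_le {F : Type*} [NormedAddCommGroup F] {f : Space n → F}
    (hf : Continuous f) {μ : Measure (Space n)} [IsFiniteMeasure μ] {r : ℝ}
    (h : ∀ᵐ x ∂μ, ‖x‖ ≤ r) : MemLp f 2 μ := by
  obtain ⟨C, hC⟩ := (isCompact_closedBall (0 : Space n) r).exists_bound_of_continuousOn hf.continuousOn
  refine MemLp.of_bound hf.aestronglyMeasurable C ?_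
  filter_upwards [h] with x hx
  exact hC x (by simpa using hx)

lemma ae_ball_norm_le (r : ℝ) : ∀ᵐ x ∂volume.restrict (ball (0 : Space n) r), ‖x‖ ≤ r := by
  filter_upwards [ae_restrict_mem measurableSet_ball] with x hx
  exact (by simpa using hx : ‖x‖ < r).le

instance (r : ℝ) : IsFiniteMeasure (volume.restrict (ball (0 : Space n) r)) :=
  ⟨by rw [Measure.restrict_apply_univ]; exact measure_ball_lt_top⟩

lemma ae_surfaceMeasure_norm_le {r : ℝ} (hr : 0 < r) : ∀ᵐ x ∂surfaceMeasure n r, ‖x‖ ≤ r := by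
  refine Measure.ae_smul_measure ?_ _
  rw [ae_map_iff (Continuous.aemeasurable (by fun_prop))
    (measurableSet_le measurable_norm measurable_const)]
  refine Eventually.of_forall fun θ => ?_
  rw [norm_smul, Real.norm_of_nonneg hr.le]
  simp

variable {u : Space n → ℝ} {G : Space n → Space n} {r : ℝ}

/-- The square integral of a trace over the sphere, as an integral over the ball. -/
lemma HasTrace.mul_integral_sq (hn : 1 ≤ n) (hr : 0 < r) (h : IsWeakGradient (ball 0 r) u G)
    (hu : MemLp u 2 (volume.restrict (ball 0 r))) (hG : MemLp G 2 (volume.restrict (ball 0 r)))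
    {g : Space n → ℝ} (hg : HasTrace u r g) :
    r * ∫ x, g x ^ 2 ∂surfaceMeasure n r
      = n * (∫ x in ball 0 r, u x * u x) + 2 * ∫ x in ball 0 r, u x * inner ℝ x (G x) := by
  obtain ⟨hg2, v, hv, h1, h2, h3⟩ := hg
  have h2' : Tendsto (fun k => eLpNorm (fun x => gradient (v k) x - G x) 2
      (volume.restrict (ball 0 r))) atTop (𝓝 0) := by
    refine h2.congr fun k => eLpNorm_congr_ae ?_
    filter_upwards [h.weakGradient_ae_eq isOpen_ball] with x hx
    rw [hx]
  have hvs : ∀ k, MemLp (v k) 2 (surfaceMeasure n r) := fun k =>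
    (hv k).continuous.memLp_of_ae_norm_le (ae_surfaceMeasure_norm_le hr)
  have hvb : ∀ k, MemLp (v k) 2 (volume.restrict (ball 0 r)) := fun k =>
    (hv k).continuous.memLp_of_ae_norm_le (ae_ball_norm_le r)
  have hgb : ∀ k, MemLp (gradient (v k)) 2 (volume.restrict (ball 0 r)) := fun k =>
    (contDiff_gradient (hv k)).continuous.memLp_of_ae_norm_le (ae_ball_norm_le r)
  have hw := ae_ball_norm_le (n := n) r
  have hwm : AEStronglyMeasurable (fun x : Space n => x) (volume.restrict (ball 0 r)) :=
    continuous_id.aestronglyMeasurable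
  have t1 := (tendsto_integral_mul_of_tendsto_eLpNorm hg2 hg2 hvs hvs h3 h3).const_mul r
  have t2 := (tendsto_integral_mul_of_tendsto_eLpNorm hu hu hvb hvb h1 h1).const_mul (n : ℝ)
  have t3 := (tendsto_integral_mul_of_tendsto_eLpNorm hu (memLp_inner hw hwm hG) hvb
    (fun k => memLp_inner hw hwm (hgb k)) h1 (tendsto_eLpNorm_inner hw h2')).const_mul (2 : ℝ)
  have t4 := t2.add t3
  simp only [← sq] at t1 ⊢
  simp only [← sq] at t4
  -- The right side involves only `u` and `G`, so the integral of the squared trace does not depend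
  -- on which trace is chosen.
  refine tendsto_nhds_unique t1 (t4.congr fun k => ?_)
  rw [mul_integral_sq_surfaceMeasure hn hr (hv k), ← integral_const_mul, ← integral_const_mul,
    ← integral_add]
  · refine integral_congr_ae (Eventually.of_forall fun x => ?_)
    ring
  · exact (hvb k).integrable_sq.const_mul _
  · exact ((hvb k).integrable_mul (memLp_inner hw hwm (hgb k))).const_mul _

/-- The trace inequality: in the identity for `r ∫ w² dσ` the mixed term is at most `r (w² + |∇w|²)`
in the ball. -/
lemma integral_sq_surfaceMeasure_le (hn : 1 ≤ n) (hr : 0 < r) {w : Space n → ℝ}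
    (hw : ContDiff ℝ ∞ w) :
    ∫ x, ‖w x‖ ^ 2 ∂surfaceMeasure n r ≤ (n / r + 1) * ((∫ x in ball 0 r, ‖w x‖ ^ 2)
      + ∫ x in ball 0 r, ‖gradient w x‖ ^ 2) := by
  have hwb : MemLp w 2 (volume.restrict (ball 0 r)) :=
    hw.continuous.memLp_of_ae_norm_le (ae_ball_norm_le r)
  have hgb : MemLp (gradient w) 2 (volume.restrict (ball 0 r)) :=
    (contDiff_gradient hw).continuous.memLp_of_ae_norm_le (ae_ball_norm_le r)
  have hx := ae_ball_norm_le (n := n) r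
  have hwm : AEStronglyMeasurable (fun x : Space n => x) (volume.restrict (ball 0 r)) :=
    continuous_id.aestronglyMeasurable
  have e := mul_integral_sq_surfaceMeasure hn hr hw
  have i1 := hwb.integrable_norm_pow (p := 2) (by norm_num)
  have i2 := hgb.integrable_norm_pow (p := 2) (by norm_num)
  have hle : ∫ x in ball 0 r, (n * w x ^ 2 + 2 * w x * inner ℝ x (gradient w x))
      ≤ ∫ x in ball 0 r, ((n + r) * ‖w x‖ ^ 2 + r * ‖gradient w x‖ ^ 2) := by
    refine integral_mono_ae ?_ ((i1.const_mul _).add (i2.const_mul _)) ?_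
    · refine (hwb.integrable_sq.const_mul _).add ?_
      refine ((hwb.integrable_mul (memLp_inner hx hwm hgb)).const_mul 2).congr
        (Eventually.of_forall fun x => ?_)
      simp only [Pi.mul_apply]
      ring
    · filter_upwards [hx] with x hx
      have h1 : |inner ℝ x (gradient w x)| ≤ r * ‖gradient w x‖ :=
        (abs_real_inner_le_norm _ _).trans (mul_le_mul_of_nonneg_right hx (norm_nonneg _))
      have h2 : 2 * w x * inner ℝ x (gradient w x) ≤ 2 * |w x| * (r * ‖gradient w x‖) := by
        calc 2 * w x * inner ℝ x (gradient w x) ≤ |2 * w x * inner ℝ x (gradient w x)| := le_abs_self _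
          _ = 2 * |w x| * |inner ℝ x (gradient w x)| := by rw [abs_mul, abs_mul, abs_two]
          _ ≤ _ := by gcongr
      have h3 : 2 * |w x| * (r * ‖gradient w x‖) ≤ r * (|w x| ^ 2 + ‖gradient w x‖ ^ 2) := by
        nlinarith [sq_nonneg (|w x| - ‖gradient w x‖)]
      rw [Real.norm_eq_abs]
      have h4 := sq_abs (w x)
      nlinarith
  rw [integral_add (i1.const_mul _) (i2.const_mul _), integral_const_mul, integral_const_mul, ← e] at hle
  have hG0 : 0 ≤ ∫ x in ball 0 r, ‖gradient w x‖ ^ 2 := integral_nonneg fun x => by positivity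
  simp only [Real.norm_eq_abs, sq_abs] at hle ⊢
  rw [← mul_le_mul_iff_right₀ hr]
  refine hle.trans (le_of_sub_nonneg ?_)
  have : r * ((n / r + 1) * ((∫ x in ball 0 r, w x ^ 2) + ∫ x in ball 0 r, ‖gradient w x‖ ^ 2))
      - ((n + r) * (∫ x in ball 0 r, w x ^ 2) + r * ∫ x in ball 0 r, ‖gradient w x‖ ^ 2)
      = n * ∫ x in ball 0 r, ‖gradient w x‖ ^ 2 := by
    field_simp
    ring
  rw [this]
  positivity

/-- Functions in `H¹(B_r)` have a trace on `∂B_r`. -/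
lemma exists_hasTrace (hn : 1 ≤ n) (hr : 0 < r) (h : IsWeakGradient (ball 0 r) u G)
    (hu : MemLp u 2 (volume.restrict (ball 0 r))) (hG : MemLp G 2 (volume.restrict (ball 0 r))) :
    ∃ g : Space n → ℝ, HasTrace u r g := by
  obtain ⟨v, hv, h1, h2⟩ := exists_smooth_approx hr h hu hG
  have hvs : ∀ w : Space n → ℝ, ContDiff ℝ ∞ w → MemLp w 2 (surfaceMeasure n r) := fun w hw =>
    hw.continuous.memLp_of_ae_norm_le (ae_surfaceMeasure_norm_le hr)
  have hvb : ∀ w : Space n → ℝ, ContDiff ℝ ∞ w → MemLp w 2 (volume.restrict (ball 0 r)) :=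
    fun w hw => hw.continuous.memLp_of_ae_norm_le (ae_ball_norm_le r)
  have hgb : ∀ w : Space n → ℝ, ContDiff ℝ ∞ w →
      MemLp (gradient w) 2 (volume.restrict (ball 0 r)) :=
    fun w hw => (contDiff_gradient hw).continuous.memLp_of_ae_norm_le (ae_ball_norm_le r)
  have t1 := (Lp.tendsto_Lp_iff_tendsto_eLpNorm'' v (fun k => hvb _ (hv k)) u hu).2 h1
  have t2 := (Lp.tendsto_Lp_iff_tendsto_eLpNorm'' (fun k => gradient (v k)) (fun k => hgb _ (hv k)) G
    hG).2 h2
  have c1 := cauchySeq_iff_tendsto_dist_atTop_0.1 t1.cauchySeq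
  have c2 := cauchySeq_iff_tendsto_dist_atTop_0.1 t2.cauchySeq
  have hdist : ∀ {F : Type} [NormedAddCommGroup F] {μ : Measure (Space n)} {f g : Space n → F}
      (hf : MemLp f 2 μ) (hg : MemLp g 2 μ), dist (hf.toLp f) (hg.toLp g) ^ 2
        = ∫ x, ‖f x - g x‖ ^ 2 ∂μ := by
    intro F _ μ f g hf hg
    rw [dist_eq_norm, ← MemLp.toLp_sub, Lp.norm_toLp, sq_toReal_eLpNorm (hf.sub hg)]
    rfl
  -- The trace inequality for differences makes the restrictions to the sphere Cauchy in `L²`; their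
  -- limit is the trace.
  have hcau : CauchySeq fun k => (hvs _ (hv k)).toLp (v k) := by
    rw [cauchySeq_iff_tendsto_dist_atTop_0]
    have hC : (1 : ℝ) ≤ n / r + 1 := by
      have : (0 : ℝ) ≤ n / r := by positivity
      linarith
    have hlim := (c1.add c2).const_mul (n / r + 1 : ℝ)
    rw [add_zero, mul_zero] at hlim
    refine squeeze_zero (fun _ => dist_nonneg) (fun m => ?_) hlim
    rw [← pow_le_pow_iff_left₀ dist_nonneg (by positivity) two_ne_zero, hdist]
    have hw : ContDiff ℝ ∞ fun x => v m.1 x - v m.2 x := (hv m.1).sub (hv m.2)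
    have hgr : ∀ x, gradient (fun x => v m.1 x - v m.2 x) x = gradient (v m.1) x - gradient (v m.2) x := by
      intro x
      refine ext_inner_right ℝ fun y => ?_
      rw [inner_sub_left, inner_gradient_left', inner_gradient_left', inner_gradient_left',
        fderiv_fun_sub ((hv m.1).differentiable (by simp) x) ((hv m.2).differentiable (by simp) x)]
      rfl
    refine (integral_sq_surfaceMeasure_le hn hr hw).trans ?_
    simp only [hgr]
    rw [← hdist (hvb _ (hv m.1)) (hvb _ (hv m.2)), ← hdist (hgb _ (hv m.1)) (hgb _ (hv m.2)), mul_pow]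
    have d1 := dist_nonneg (x := (hvb _ (hv m.1)).toLp (v m.1)) (y := (hvb _ (hv m.2)).toLp (v m.2))
    have d2 := dist_nonneg (x := (hgb _ (hv m.1)).toLp (gradient (v m.1)))
      (y := (hgb _ (hv m.2)).toLp (gradient (v m.2)))
    refine mul_le_mul (le_self_pow₀ hC two_ne_zero) ?_ (by positivity) (by positivity)
    nlinarith [mul_nonneg d1 d2]
  obtain ⟨g, hg⟩ := cauchySeq_tendsto_of_complete hcau
  have hgm : MemLp g 2 (surfaceMeasure n r) := Lp.memLp g
  refine ⟨g, hgm, v, hv, h1, ?_, ?_⟩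
  · refine h2.congr fun k => eLpNorm_congr_ae ?_
    filter_upwards [h.weakGradient_ae_eq isOpen_ball] with x hx
    rw [hx]
  · refine (Lp.tendsto_Lp_iff_tendsto_eLpNorm'' v (fun k => hvs _ (hv k)) g hgm).1 ?_
    rwa [Lp.toLp_coeFn]

/-- The change between two radii of the normalized boundary integrals, written over the balls. -/
lemma boundary_integral_sub (hn : 1 ≤ n) {a b : ℝ} (ha : 0 < a) (hab : a < b)
    (h : IsWeakGradient (ball 0 b) u G) (hu : MemLp u 2 (volume.restrict (ball 0 b)))
    (hG : MemLp G 2 (volume.restrict (ball 0 b))) {ga gb : Space n → ℝ} (hga : HasTrace u a ga)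
    (hgb : HasTrace u b gb) :
    b ^ (-(n : ℤ)) * (∫ x, gb x ^ 2 ∂surfaceMeasure n b)
      - a ^ (-(n : ℤ)) * (∫ x, ga x ^ 2 ∂surfaceMeasure n a)
      = ∫ x in annulus n a b, ‖x‖ ^ (-(n : ℤ) - 1) * (2 * (u x * inner ℝ x (G x)) - u x * u x) := by
  have hb : 0 < b := ha.trans hab
  obtain ⟨v, hv, h1, h2⟩ := exists_smooth_approx hb h hu hG
  have hmono : ∀ {F : Type} [NormedAddCommGroup F] {s : Set (Space n)} (hs : s ⊆ ball 0 b)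
      {f : ℕ → Space n → F},
      Tendsto (fun k => eLpNorm (f k) 2 (volume.restrict (ball 0 b))) atTop (𝓝 0) →
      Tendsto (fun k => eLpNorm (f k) 2 (volume.restrict s)) atTop (𝓝 0) := by
    intro F _ s hs f hf
    exact tendsto_of_tendsto_of_tendsto_of_le_of_le tendsto_const_nhds hf (fun _ => zero_le)
      fun k => eLpNorm_mono_measure _ (Measure.restrict_mono hs le_rfl)
  have hvb : ∀ k, MemLp (v k) 2 (volume.restrict (ball 0 b)) := fun k =>
    (hv k).continuous.memLp_of_ae_norm_le (ae_ball_norm_le b)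
  have hgrb : ∀ k, MemLp (gradient (v k)) 2 (volume.restrict (ball 0 b)) := fun k =>
    (contDiff_gradient (hv k)).continuous.memLp_of_ae_norm_le (ae_ball_norm_le b)
  have hbound : ∀ {s : Set (Space n)}, s ⊆ ball 0 b → MeasurableSet s →
      ∀ᵐ x ∂volume.restrict s, ‖x‖ ≤ b := fun hs hm => by
    filter_upwards [ae_restrict_mem hm] with x hx
    exact (by simpa using hs hx : ‖x‖ < b).le
  -- One sequence approximating `u` in the large ball serves all spheres inside. Its restrictions
  -- need not be compared with the given trace: the square integrals converge because both are
  -- expressed by the same integrals over the ball.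
  have hsphere : ∀ s, 0 < s → s ≤ b → ∀ g, HasTrace u s g →
      Tendsto (fun k => ∫ x, v k x ^ 2 ∂surfaceMeasure n s) atTop
        (𝓝 (∫ x, g x ^ 2 ∂surfaceMeasure n s)) := by
    intro s hs hsb g hg
    have hsub : ball (0 : Space n) s ⊆ ball 0 b := ball_subset_ball hsb
    have hr := Measure.restrict_mono (μ := volume) hsub le_rfl
    have hw := hbound hsub measurableSet_ball
    have hwm : AEStronglyMeasurable (fun x : Space n => x) (volume.restrict (ball 0 s)) :=
      continuous_id.aestronglyMeasurable
    have e1 := hg.mul_integral_sq hn hs (h.mono hsub) (hu.mono_measure hr) (hG.mono_measure hr)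
    have t2 := (tendsto_integral_mul_of_tendsto_eLpNorm (hu.mono_measure hr) (hu.mono_measure hr)
      (fun k => (hvb k).mono_measure hr) (fun k => (hvb k).mono_measure hr) (hmono hsub h1)
      (hmono hsub h1)).const_mul (n : ℝ)
    have t3 := (tendsto_integral_mul_of_tendsto_eLpNorm (hu.mono_measure hr)
      (memLp_inner hw hwm (hG.mono_measure hr)) (fun k => (hvb k).mono_measure hr)
      (fun k => memLp_inner hw hwm ((hgrb k).mono_measure hr)) (hmono hsub h1)
      (tendsto_eLpNorm_inner hw (hmono hsub h2))).const_mul (2 : ℝ)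
    have t4 := (t2.add t3).const_mul s⁻¹
    rw [← e1, inv_mul_cancel_left₀ hs.ne'] at t4
    refine t4.congr fun k => ?_
    rw [← integral_const_mul, ← integral_const_mul, ← integral_add, inv_mul_eq_iff_eq_mul₀ hs.ne',
      mul_integral_sq_surfaceMeasure hn hs (hv k)]
    · refine integral_congr_ae (Eventually.of_forall fun x => ?_)
      ring
    · exact (((hvb k).mono_measure hr).integrable_mul ((hvb k).mono_measure hr)).const_mul _
    · exact (((hvb k).mono_measure hr).integrable_mul
        (memLp_inner hw hwm ((hgrb k).mono_measure hr))).const_mul _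
  have hsub := annulus_subset_ball (n := n) a b
  have hr := Measure.restrict_mono (μ := volume) hsub le_rfl
  have hrest : ∀ᵐ x ∂volume.restrict (annulus n a b), x ∈ annulus n a b :=
    ae_restrict_mem (measurableSet_annulus a b)
  -- The singular weight is bounded on the annulus, so multiplication by it preserves `L²`
  -- convergence.
  have hzp : ∀ x ∈ annulus n a b, ‖x‖ ^ (-(n : ℤ) - 1) ≤ a ^ (-(n : ℤ) - 1) := fun x hx => by
    rw [show -(n : ℤ) - 1 = -((n + 1 : ℕ) : ℤ) by push_cast; ring, zpow_neg, zpow_neg, zpow_natCast,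
      zpow_natCast]
    gcongr
    exact hx.1
  set C := a ^ (-(n : ℤ) - 1)
  have hC : 0 < C := zpow_pos ha _
  have hw1 : ∀ᵐ x ∂volume.restrict (annulus n a b), ‖‖x‖ ^ (-(n : ℤ) - 1) • x‖ ≤ C * b := by
    filter_upwards [hrest] with x hx
    rw [norm_smul, Real.norm_of_nonneg (zpow_nonneg (norm_nonneg x) _)]
    exact mul_le_mul (hzp x hx) hx.2.le (norm_nonneg x) hC.le
  have hwm1 : AEStronglyMeasurable (fun x : Space n => ‖x‖ ^ (-(n : ℤ) - 1) • x)
      (volume.restrict (annulus n a b)) :=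
    ((measurable_norm.pow_const _).smul measurable_id).aestronglyMeasurable
  have hmul : ∀ f : Space n → ℝ,
      eLpNorm (fun x => ‖x‖ ^ (-(n : ℤ) - 1) * f x) 2 (volume.restrict (annulus n a b))
        ≤ ENNReal.ofReal C * eLpNorm f 2 (volume.restrict (annulus n a b)) := fun f => by
    refine eLpNorm_le_mul_eLpNorm_of_ae_le_mul ?_ 2
    filter_upwards [hrest] with x hx
    rw [norm_mul, Real.norm_of_nonneg (zpow_nonneg (norm_nonneg x) _)]
    exact mul_le_mul_of_nonneg_right (hzp x hx) (norm_nonneg _)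
  have hmem : ∀ f : Space n → ℝ, MemLp f 2 (volume.restrict (annulus n a b)) →
      MemLp (fun x => ‖x‖ ^ (-(n : ℤ) - 1) * f x) 2 (volume.restrict (annulus n a b)) := fun f hf =>
    ⟨(measurable_norm.pow_const _).aestronglyMeasurable.mul hf.1,
      (hmul f).trans_lt (ENNReal.mul_lt_top ENNReal.ofReal_lt_top hf.eLpNorm_lt_top)⟩
  have hmulT : Tendsto (fun k => eLpNorm (fun x => ‖x‖ ^ (-(n : ℤ) - 1) * v k x
      - ‖x‖ ^ (-(n : ℤ) - 1) * u x) 2 (volume.restrict (annulus n a b))) atTop (𝓝 0) := by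
    have h1' := ENNReal.Tendsto.const_mul (a := ENNReal.ofReal C) (hmono hsub h1)
      (Or.inr ENNReal.ofReal_ne_top)
    rw [mul_zero] at h1'
    refine tendsto_of_tendsto_of_tendsto_of_le_of_le tendsto_const_nhds h1' (fun _ => zero_le)
      fun k => ?_
    simp only [← mul_sub]
    exact hmul _
  have hua := hu.mono_measure hr
  have hGa := hG.mono_measure hr
  have hva := fun k => (hvb k).mono_measure hr
  have hgva := fun k => (hgrb k).mono_measure hr
  have t2 := (tendsto_integral_mul_of_tendsto_eLpNorm hua (memLp_inner hw1 hwm1 hGa) hva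
    (fun k => memLp_inner hw1 hwm1 (hgva k)) (hmono hsub h1)
    (tendsto_eLpNorm_inner hw1 (hmono hsub h2))).const_mul (2 : ℝ)
  have t3 := tendsto_integral_mul_of_tendsto_eLpNorm hua (hmem u hua) hva (fun k => hmem _ (hva k))
    (hmono hsub h1) hmulT
  have t4 := t2.sub t3
  have t5 := ((hsphere b hb le_rfl gb hgb).const_mul (b ^ (-(n : ℤ)))).sub
    ((hsphere a ha hab.le ga hga).const_mul (a ^ (-(n : ℤ))))
  have comb : ∀ (f : Space n → ℝ) (H : Space n → Space n),
      MemLp f 2 (volume.restrict (annulus n a b)) → MemLp H 2 (volume.restrict (annulus n a b)) →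
      2 * (∫ x in annulus n a b, f x * inner ℝ (‖x‖ ^ (-(n : ℤ) - 1) • x) (H x))
        - ∫ x in annulus n a b, f x * (‖x‖ ^ (-(n : ℤ) - 1) * f x)
      = ∫ x in annulus n a b, ‖x‖ ^ (-(n : ℤ) - 1) * (2 * (f x * inner ℝ x (H x)) - f x * f x) := by
    intro f H hf hH
    rw [← integral_const_mul, ← integral_sub]
    · refine integral_congr_ae (Eventually.of_forall fun x => ?_)
      simp only [inner_smul_left]
      simp
      ring
    · exact (hf.integrable_mul (memLp_inner hw1 hwm1 hH)).const_mul _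
    · exact hf.integrable_mul (hmem f hf)
  rw [comb u G hua hGa] at t4
  refine tendsto_nhds_unique t5 (t4.congr fun k => ?_)
  rw [comb _ _ (hva k) (hgva k), sphere_integral_sub hn ha hab (hv k)]
  refine integral_congr_ae (Eventually.of_forall fun x => ?_)
  ring

end Trace

/-! ### Construction of the radial cutoffs -/

section RadialFunctions

/-- The norm is smooth away from the origin, and near the origin the composition is constant. -/
lemma contDiff_comp_norm {g : ℝ → ℝ} (hg : ContDiff ℝ ∞ g) {c : ℝ} (hc : 0 < c) {y : ℝ}
    (h0 : ∀ s, s < c → g s = y) : ContDiff ℝ ∞ fun x : Space n => g ‖x‖ := by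
  rw [contDiff_iff_contDiffAt]
  intro x
  by_cases hx : x = 0
  · refine (contDiffAt_const (c := y)).congr_of_eventuallyEq ?_
    filter_upwards [(continuous_norm.tendsto x).eventually_lt_const (by simpa [hx] using hc)] with z hz
    exact h0 _ hz
  · exact hg.contDiffAt.comp x (contDiffAt_norm ℝ hx)

lemma hasFDerivAt_norm {x : Space n} (hx : x ≠ 0) :
    HasFDerivAt (fun z : Space n => ‖z‖) (‖x‖⁻¹ • innerSL ℝ x) x := by
  have hx' : ‖x‖ ≠ 0 := norm_ne_zero_iff.2 hx
  have h := (hasStrictFDerivAt_norm_sq x).hasFDerivAt.sqrt (pow_ne_zero 2 hx')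
  simp only [Real.sqrt_sq (norm_nonneg _)] at h
  refine h.congr_fderiv ?_
  ext v
  simp
  field_simp

/-- The radial cutoff with radial derivative `g`. -/
lemma isRadialCutoff_integral {Ω : Set (Space n)} {b c d : ℝ} {g : ℝ → ℝ} (hb : ball 0 b ⊆ Ω)
    (hg : ContDiff ℝ ∞ g) (hc : 0 < c) (hd : d < b) (h0 : ∀ s, s < c → g s = 0)
    (h1 : ∀ s, d ≤ s → g s = 0) :
    IsRadialCutoff Ω (fun x => ∫ s in b..‖x‖, g s) (fun x => ‖x‖⁻¹ * g ‖x‖) := by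
  have hgc := hg.continuous
  have hder : ∀ r, HasDerivAt (fun r => ∫ s in b..r, g s) (g r) r := fun r =>
    intervalIntegral.integral_hasDerivAt_right (hgc.intervalIntegrable _ _)
      (hgc.stronglyMeasurableAtFilter _ _) hgc.continuousAt
  have hq : ContDiff ℝ ∞ fun r => ∫ s in b..r, g s := by
    rw [contDiff_infty_iff_deriv]
    refine ⟨fun r => (hder r).differentiableAt, ?_⟩
    rwa [funext fun r => (hder r).deriv]
  have hq0 : ∀ r, r < c → ∫ s in b..r, g s = ∫ s in b..c, g s := fun r hr => by
    have : ∫ s in c..r, g s = 0 := by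
      rw [intervalIntegral.integral_of_ge hr.le, neg_eq_zero, integral_Ioc_eq_integral_Ioo]
      exact setIntegral_eq_zero_of_forall_eq_zero fun s hs => h0 s hs.2
    rw [← intervalIntegral.integral_add_adjacent_intervals (hgc.intervalIntegrable b c)
      (hgc.intervalIntegrable c r), this, add_zero]
  have hqd : ∀ r, d ≤ r → ∫ s in b..r, g s = 0 := fun r hr => by
    refine intervalIntegral.integral_zero_ae (Eventually.of_forall fun s hs => h1 s ?_)
    rw [mem_uIoc] at hs
    rcases hs with hs | hs
    · linarith [hs.1]
    · linarith [hs.1]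
  have hη := contDiff_comp_norm (n := n) hq hc hq0
  have hsub : tsupport (fun x : Space n => ∫ s in b..‖x‖, g s) ⊆ closedBall 0 d := by
    refine closure_minimal (fun x hx => ?_) isClosed_closedBall
    by_contra h
    exact hx (hqd _ (le_of_lt (by simpa using h)))
  refine ⟨⟨hη, (isCompact_closedBall (0 : Space n) d).of_isClosed_subset (isClosed_tsupport _) hsub,
    hsub.trans ((closedBall_subset_ball hd).trans hb)⟩, ?_, fun x v => ?_⟩
  · rw [contDiff_iff_contDiffAt]
    intro x
    by_cases hx : x = 0
    · refine (contDiffAt_const (c := (0 : ℝ))).congr_of_eventuallyEq ?_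
      filter_upwards [(continuous_norm.tendsto x).eventually_lt_const (by simpa [hx] using hc)]
        with z hz
      rw [h0 _ hz, mul_zero]
    · exact ((contDiffAt_norm ℝ hx).inv (norm_ne_zero_iff.2 hx)).mul
        (hg.contDiffAt.comp x (contDiffAt_norm ℝ hx))
  · by_cases hx : x = 0
    · have : (fun x : Space n => ∫ s in b..‖x‖, g s) =ᶠ[𝓝 x] fun _ => ∫ s in b..c, g s := by
        filter_upwards [(continuous_norm.tendsto x).eventually_lt_const (by simpa [hx] using hc)]
          with z hz
        exact hq0 _ hz
      rw [this.fderiv_eq, hx]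
      simp
    · have h2 : HasFDerivAt (fun x : Space n => ∫ s in b..‖x‖, g s)
          (g ‖x‖ • (‖x‖⁻¹ • innerSL ℝ x)) x :=
        (hder ‖x‖).comp_hasFDerivAt x (hasFDerivAt_norm hx)
      rw [h2.fderiv]
      simp
      ring

/-- A smooth approximation of the indicator of `[a, b)`. -/
def stepApprox (a b N s : ℝ) : ℝ :=
  Real.smoothTransition (N * (s - a) + 1) * Real.smoothTransition (N * (b - s) - 1)

variable {a b N : ℝ}

lemma contDiff_stepApprox : ContDiff ℝ ∞ (stepApprox a b N) := by
  have h : ContDiff ℝ ∞ Real.smoothTransition := Real.smoothTransition.contDiff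
  unfold stepApprox
  exact (h.comp (by fun_prop)).mul (h.comp (by fun_prop))

lemma stepApprox_nonneg (s : ℝ) : 0 ≤ stepApprox a b N s :=
  mul_nonneg (Real.smoothTransition.nonneg _) (Real.smoothTransition.nonneg _)

lemma stepApprox_le_one (s : ℝ) : stepApprox a b N s ≤ 1 :=
  mul_le_one₀ (Real.smoothTransition.le_one _) (Real.smoothTransition.nonneg _)
    (Real.smoothTransition.le_one _)

/-- For `N ≥ 2 / a` the transition below `a` is completed above `a / 2`; this keeps the cutoff
constant near the origin and the weight `s⁻ⁿ` bounded. -/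
lemma stepApprox_eq_zero_of_lt (ha : 0 < a) (hN : 2 / a ≤ N) {s : ℝ} (hs : s < a / 2) :
    stepApprox a b N s = 0 := by
  have h0 : 0 < 2 / a := by positivity
  have h1 : 2 / a * (a - s) ≤ N * (a - s) := mul_le_mul_of_nonneg_right hN (by linarith)
  have h2 : 2 / a * (a / 2) ≤ 2 / a * (a - s) := mul_le_mul_of_nonneg_left (by linarith) h0.le
  have h3 : 2 / a * (a / 2) = 1 := by field_simp
  rw [stepApprox, Real.smoothTransition.zero_of_nonpos (by linarith), zero_mul]

/-- The approximation vanishes strictly before `b`, so the cutoff has compact support in the open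
ball even when that ball touches the boundary of `Ω`. -/
lemma stepApprox_eq_zero_of_le (hN : 0 < N) {s : ℝ} (hs : b - 1 / N ≤ s) :
    stepApprox a b N s = 0 := by
  have h1 : N * (b - s) ≤ N * (1 / N) := mul_le_mul_of_nonneg_left (by linarith) hN.le
  have h2 : N * (1 / N) = 1 := by field_simp
  rw [stepApprox, Real.smoothTransition.zero_of_nonpos (x := N * (b - s) - 1) (by linarith), mul_zero]

/-- The shifts `+1` and `-1` put both transitions to the left of `a` and `b`, so the values at the
endpoints are right and convergence holds at every point. This matters because `μ` may charge
spheres. -/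
lemma tendsto_stepApprox {N : ℕ → ℝ} (hN : Tendsto N atTop atTop) (s : ℝ) :
    Tendsto (fun k => stepApprox a b (N k) s) atTop (𝓝 ((Ico a b).indicator (fun _ => 1) s)) := by
  refine tendsto_const_nhds.congr' ?_
  by_cases hsa : s < a
  · rw [indicator_of_notMem (fun h => absurd h.1 (not_le.2 hsa))]
    filter_upwards [hN.eventually_ge_atTop (1 / (a - s))] with k hk
    have h1 : 1 / (a - s) * (a - s) ≤ N k * (a - s) := mul_le_mul_of_nonneg_right hk (by linarith)
    rw [one_div_mul_cancel (by linarith)] at h1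
    rw [stepApprox, Real.smoothTransition.zero_of_nonpos (by linarith), zero_mul]
  push Not at hsa
  by_cases hsb : s < b
  · rw [indicator_of_mem (mem_Ico.2 ⟨hsa, hsb⟩)]
    filter_upwards [hN.eventually_ge_atTop (2 / (b - s)), hN.eventually_ge_atTop 0] with k hk hk0
    have h1 : 2 / (b - s) * (b - s) ≤ N k * (b - s) := mul_le_mul_of_nonneg_right hk (by linarith)
    rw [div_mul_cancel₀ _ (by linarith)] at h1
    rw [stepApprox, Real.smoothTransition.one_of_one_le (by nlinarith),
      Real.smoothTransition.one_of_one_le (by linarith), mul_one]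
  · push Not at hsb
    rw [indicator_of_notMem (fun h => absurd h.2 (not_lt.2 hsb))]
    filter_upwards [hN.eventually_ge_atTop 0] with k hk
    rw [stepApprox, Real.smoothTransition.zero_of_nonpos (x := N k * (b - s) - 1) (by nlinarith),
      mul_zero]

/-- The radial density `s⁻ⁿ` times the approximate indicator. -/
def stepDensity (n : ℕ) (a b N s : ℝ) : ℝ := s ^ (-(n : ℤ)) * stepApprox a b N s

lemma stepDensity_nonneg (ha : 0 < a) (hN : 2 / a ≤ N) (s : ℝ) : 0 ≤ stepDensity n a b N s := by
  by_cases hs : s < a / 2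
  · rw [stepDensity, stepApprox_eq_zero_of_lt ha hN hs, mul_zero]
  · exact mul_nonneg (zpow_nonneg (by linarith) _) (stepApprox_nonneg s)

lemma stepDensity_eq_zero_of_lt (ha : 0 < a) (hN : 2 / a ≤ N) {s : ℝ} (hs : s < a / 2) :
    stepDensity n a b N s = 0 := by
  rw [stepDensity, stepApprox_eq_zero_of_lt ha hN hs, mul_zero]

lemma stepDensity_eq_zero_of_le (hN : 0 < N) {s : ℝ} (hs : b - 1 / N ≤ s) :
    stepDensity n a b N s = 0 := by
  rw [stepDensity, stepApprox_eq_zero_of_le hN hs, mul_zero]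

lemma stepDensity_le (ha : 0 < a) (hN : 2 / a ≤ N) (s : ℝ) :
    stepDensity n a b N s ≤ (a / 2) ^ (-(n : ℤ)) := by
  by_cases hs : s < a / 2
  · rw [stepDensity_eq_zero_of_lt ha hN hs]
    positivity
  · push Not at hs
    have h2 : 0 < a / 2 := by positivity
    have h1 : s ^ (-(n : ℤ)) ≤ (a / 2) ^ (-(n : ℤ)) := by
      rw [zpow_neg, zpow_neg, zpow_natCast, zpow_natCast]
      gcongr
    exact (mul_le_of_le_one_right (zpow_nonneg (h2.le.trans hs) _) (stepApprox_le_one s)).trans h1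

lemma contDiff_stepDensity (ha : 0 < a) (hN : 2 / a ≤ N) : ContDiff ℝ ∞ (stepDensity n a b N) := by
  rw [contDiff_iff_contDiffAt]
  intro s
  by_cases hs : s < a / 2
  · refine (contDiffAt_const (c := (0 : ℝ))).congr_of_eventuallyEq ?_
    filter_upwards [Iio_mem_nhds hs] with z hz
    exact stepDensity_eq_zero_of_lt ha hN hz
  · have hs0 : s ≠ 0 := by
      intro h
      rw [h] at hs
      exact hs (by positivity)
    refine ContDiffAt.mul ?_ contDiff_stepApprox.contDiffAt
    have h1 : (fun s : ℝ => s ^ (-(n : ℤ))) = fun s => (s ^ n)⁻¹ := by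
      funext s
      rw [zpow_neg, zpow_natCast]
    change ContDiffAt ℝ ∞ (fun s : ℝ => s ^ (-(n : ℤ))) s
    rw [h1]
    exact (contDiffAt_id.pow n).inv (pow_ne_zero n hs0)

/-- The radial primitives converge to that of `s⁻ⁿ` on `[a, b)`. -/
lemma tendsto_integral_stepDensity (ha : 0 < a) (hab : a < b) {N : ℕ → ℝ}
    (hN : Tendsto N atTop atTop) (hN' : ∀ k, 2 / a ≤ N k) (r : ℝ) :
    Tendsto (fun k => ((n : ℝ) - 1) * ∫ s in b..r, stepDensity n a b (N k) s) atTop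
      (𝓝 (b ^ (1 - (n : ℤ)) - (max a (min r b)) ^ (1 - (n : ℤ)))) := by
  have hb : 0 < b := ha.trans hab
  have hlim : Tendsto (fun k => ∫ s in b..r, stepDensity n a b (N k) s) atTop
      (𝓝 (∫ s in b..r, s ^ (-(n : ℤ)) * (Ico a b).indicator (fun _ => 1) s)) := by
    refine intervalIntegral.tendsto_integral_filter_of_dominated_convergence
      (fun _ => (a / 2) ^ (-(n : ℤ))) (Eventually.of_forall fun k =>
        (contDiff_stepDensity ha (hN' k)).continuous.aestronglyMeasurable)
      (Eventually.of_forall fun k => Eventually.of_forall fun s _ => ?_)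
      intervalIntegrable_const (Eventually.of_forall fun s _ => ?_)
    · rw [Real.norm_of_nonneg (stepDensity_nonneg ha (hN' k) s)]
      exact stepDensity_le ha (hN' k) s
    · exact (tendsto_stepApprox hN s).const_mul _
  have hpos : ∀ s : ℝ, 0 < max a (min s b) := fun s => ha.trans_le (le_max_left _ _)
  have h_int : ∫ s in b..r, ((n : ℝ) - 1) * (s ^ (-(n : ℤ)) * (Ico a b).indicator (fun _ => 1) s)
      = b ^ (1 - (n : ℤ)) - (max a (min r b)) ^ (1 - (n : ℤ)) := by
    have h := MeasureTheory.integral_eq_of_hasDerivAt_off_countable (a := b) (b := r)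
      -- Clamping to `[a, b]` gives a continuous primitive, differentiable except at `a` and `b`.
      -- For `n = 1` the factor `n - 1` and the differences of powers vanish together.
      (fun s => -(max a (min s b)) ^ (1 - (n : ℤ)))
      (fun s => ((n : ℝ) - 1) * (s ^ (-(n : ℤ)) * (Ico a b).indicator (fun _ => 1) s))
      (s := {a, b}) (Set.countable_insert.2 (countable_singleton b))
      (by
        refine (ContinuousOn.zpow₀ (f := fun s => max a (min s b)) (by fun_prop) _ fun s _ =>
          Or.inl (hpos s).ne').neg)
      (fun s hs => by
        have hsa : s ≠ a := fun h => hs.2 (by simp [h])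
        have hsb : s ≠ b := fun h => hs.2 (by simp [h])
        rcases lt_or_gt_of_ne hsa with h1 | h1
        · rw [indicator_of_notMem (fun h => absurd h.1 (not_le.2 h1)), mul_zero, mul_zero]
          refine (hasDerivAt_const s (-a ^ (1 - (n : ℤ)))).congr_of_eventuallyEq ?_
          filter_upwards [Iio_mem_nhds h1] with z hz
          rw [max_eq_left ((min_le_left z b).trans (le_of_lt hz))]
        · rcases lt_or_gt_of_ne hsb with h2 | h2
          · rw [indicator_of_mem (mem_Ico.2 ⟨h1.le, h2⟩)]
            have h3 := (hasDerivAt_zpow (1 - (n : ℤ)) s (Or.inl (ha.trans h1).ne')).neg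
            refine (h3.congr_deriv ?_).congr_of_eventuallyEq ?_
            · push_cast
              rw [show (1 : ℤ) - n - 1 = -n by ring]
              ring
            · filter_upwards [Ioo_mem_nhds h1 h2] with z hz
              rw [min_eq_left hz.2.le, max_eq_right hz.1.le]
              rfl
          · rw [indicator_of_notMem (fun h => absurd h.2 (not_lt.2 h2.le)), mul_zero, mul_zero]
            refine (hasDerivAt_const s (-b ^ (1 - (n : ℤ)))).congr_of_eventuallyEq ?_
            filter_upwards [Ioi_mem_nhds h2] with z hz
            rw [min_eq_right (le_of_lt hz), max_eq_right hab.le])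
      (by
        refine (intervalIntegrable_const (c := ‖((n : ℝ) - 1)‖ * a ^ (-(n : ℤ)))).mono_fun' ?_ ?_
        · refine Measurable.aestronglyMeasurable ?_
          exact ((measurable_id.pow_const _).mul
            (measurable_const.indicator measurableSet_Ico)).const_mul _
        · refine Eventually.of_forall fun s => ?_
          beta_reduce
          rw [norm_mul]
          refine mul_le_mul_of_nonneg_left ?_ (norm_nonneg _)
          by_cases hs : s ∈ Ico a b
          · rw [indicator_of_mem hs, mul_one,
              Real.norm_of_nonneg (zpow_nonneg (ha.le.trans hs.1) _), zpow_neg, zpow_neg,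
              zpow_natCast, zpow_natCast]
            gcongr
            exact hs.1
          · rw [indicator_of_notMem hs, mul_zero, norm_zero]
            positivity)
    rw [h, min_self, max_eq_right hab.le]
    ring
  rw [← h_int, intervalIntegral.integral_const_mul]
  exact hlim.const_mul _

end RadialFunctions

/-! ### The monotonicity formula -/

lemma mul_norm_sq_mul_div (k : ℝ) (x y : Space n) :
    k * ‖x‖ ^ 2 * (inner ℝ x y ^ 2 / ‖x‖ ^ 2) = k * inner ℝ x y ^ 2 := by
  by_cases hx : x = 0
  · simp [hx]
  · have : ‖x‖ ≠ 0 := norm_ne_zero_iff.2 hx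
    field_simp

lemma integrableOn_zpow_mul {m : Measure (Space n)} {a b : ℝ} (ha : 0 < a) {f : Space n → ℝ}
    (hf : IntegrableOn f (annulus n a b) m) :
    IntegrableOn (fun x => ‖x‖ ^ (-(n : ℤ) - 1) * f x) (annulus n a b) m := by
  refine Integrable.bdd_mul (c := a ^ (-(n : ℤ) - 1)) hf
    (measurable_norm.pow_const _).aestronglyMeasurable ?_
  filter_upwards [ae_restrict_mem (measurableSet_annulus a b)] with x hx
  rw [Real.norm_of_nonneg (zpow_nonneg (norm_nonneg x) _),
    show -(n : ℤ) - 1 = -((n + 1 : ℕ) : ℤ) by push_cast; ring, zpow_neg, zpow_neg,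
    zpow_natCast, zpow_natCast]
  gcongr
  exact hx.1

lemma setIntegral_indicator_subset {m : Measure (Space n)} {s t : Set (Space n)}
    (hs : MeasurableSet s) (hst : s ⊆ t) (f : Space n → ℝ) :
    ∫ x in t, s.indicator f x ∂m = ∫ x in s, f x ∂m := by
  rw [setIntegral_indicator hs, inter_eq_self_of_subset_right hst]

lemma integrableOn_indicator_subset {m : Measure (Space n)} {s t : Set (Space n)}
    (hs : MeasurableSet s) {f : Space n → ℝ} (hf : IntegrableOn f s m) :
    IntegrableOn (s.indicator f) t m :=
  ((integrable_indicator_iff hs).2 hf).integrableOn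

namespace IsRepresented

variable {Ω E : Set (Space n)} {u : Space n → ℝ} {p : Space n → Space n} {μ : Measure (Space n)}
  {σ : Space n → Space n} (R : IsRepresented Ω u E p μ σ)
include R

lemma integrable_mul_norm : Integrable (fun x => ‖u x‖ * ‖p x‖) (volume.restrict Ω) :=
  R.admissible.memH1.1.norm.integrable_mul R.memLp.norm

/-- The sum of the inner and the outer variation. -/
lemma total_variation (hn : 1 ≤ n) (hmin : IsMinimizingPair Ω u E) {η κ : Space n → ℝ}
    (hη : IsRadialCutoff Ω η κ) :
    (∫ x in Ω, ((((n : ℝ) - 1) * η x + κ x * ‖x‖ ^ 2) * ‖p x‖ ^ 2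
        - κ x * (2 * inner ℝ x (p x) ^ 2 - u x * inner ℝ x (p x))))
      + ∫ x, ((((n : ℝ) - 1) * η x + κ x * ‖x‖ ^ 2) - κ x * inner ℝ x (σ x) ^ 2) ∂μ = 0 := by
  have h1 := R.inner_variation hη hn hmin
  have h2 := R.outer_variation hη hmin
  obtain ⟨C, hC, hb1, hb2⟩ := hη.exists_bound
  obtain ⟨C', hC', hb3⟩ := hη.isTest_gradient.bounded
  have hm : ∀ f : Space n → ℝ, Continuous f → AEStronglyMeasurable f (volume.restrict Ω) :=
    fun f hf => hf.aestronglyMeasurable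
  have hηc := hη.isTest.continuous
  have hκc := hη.contDiff.continuous
  have hxp : AEStronglyMeasurable (fun x => inner ℝ x (p x)) (volume.restrict Ω) :=
    aestronglyMeasurable_id.inner R.memLp.1
  have i1 : Integrable (fun x => ((((n : ℝ) - 2) * η x + κ x * ‖x‖ ^ 2) * ‖p x‖ ^ 2
      + -2 * (κ x * ‖x‖ ^ 2) * (inner ℝ x (p x) ^ 2 / ‖x‖ ^ 2))) (volume.restrict Ω) := by
    refine (R.integrable_norm_sq.bdd_mul (c := |(n : ℝ) - 2| * C + C) (hm _ (by fun_prop))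
      (Eventually.of_forall fun x => ?_)).add
      (R.integrable_inner_sq_gradient.bdd_mul (c := 2 * C) (hm _ (by fun_prop))
      (Eventually.of_forall fun x => ?_))
    · refine (norm_add_le _ _).trans (add_le_add ?_ (hb2 x))
      rw [norm_mul]
      exact mul_le_mul_of_nonneg_left (hb1 x) (abs_nonneg _)
    · rw [norm_mul]
      refine mul_le_mul (by simp) (hb2 x) (norm_nonneg _) (by norm_num)
  have i2 : Integrable (fun x => η x * ‖p x‖ ^ 2 + u x * (κ x * inner ℝ x (p x)))
      (volume.restrict Ω) := by
    refine (R.integrable_norm_sq.bdd_mul (c := C) (hm _ hηc)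
      (Eventually.of_forall fun x => hb1 x)).add ?_
    refine (R.integrable_mul_norm.const_mul C').mono'
      (R.admissible.memH1.1.1.mul ((hm _ hκc).mul hxp)) (Eventually.of_forall fun x => ?_)
    rw [norm_mul, ← real_inner_smul_left]
    have := (norm_inner_le_norm (𝕜 := ℝ) (κ x • x) (p x)).trans
      (mul_le_mul_of_nonneg_right (hb3 x) (norm_nonneg (p x)))
    calc ‖u x‖ * ‖inner ℝ (κ x • x) (p x)‖ ≤ ‖u x‖ * (C' * ‖p x‖) :=
          mul_le_mul_of_nonneg_left this (norm_nonneg _)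
      _ = C' * (‖u x‖ * ‖p x‖) := by ring
  -- The outer variation supplies the missing `η |p|²`, raising `n - 2` to the factor `n - 1` of the
  -- perimeter term.
  have e1 : ∫ x in Ω, ((((n : ℝ) - 1) * η x + κ x * ‖x‖ ^ 2) * ‖p x‖ ^ 2
        - κ x * (2 * inner ℝ x (p x) ^ 2 - u x * inner ℝ x (p x)))
      = (∫ x in Ω, ((((n : ℝ) - 2) * η x + κ x * ‖x‖ ^ 2) * ‖p x‖ ^ 2
        + -2 * (κ x * ‖x‖ ^ 2) * (inner ℝ x (p x) ^ 2 / ‖x‖ ^ 2)))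
        + ∫ x in Ω, (η x * ‖p x‖ ^ 2 + u x * (κ x * inner ℝ x (p x))) := by
    rw [← integral_add i1 i2]
    refine integral_congr_ae (Eventually.of_forall fun x => ?_)
    have := mul_norm_sq_mul_div (κ x) x (p x)
    beta_reduce
    linear_combination 2 * this
  have e2 : ∫ x, ((((n : ℝ) - 1) * η x + κ x * ‖x‖ ^ 2) - κ x * inner ℝ x (σ x) ^ 2) ∂μ
      = ∫ x, ((((n : ℝ) - 1) * η x + κ x * ‖x‖ ^ 2) * 1
        + -(κ x * ‖x‖ ^ 2) * (inner ℝ x (σ x) ^ 2 / ‖x‖ ^ 2)) ∂μ := by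
    refine integral_congr_ae (Eventually.of_forall fun x => ?_)
    have := mul_norm_sq_mul_div (κ x) x (σ x)
    beta_reduce
    linear_combination this
  rw [e1, e2, h2, add_zero, h1]

lemma memLp_inner_gradient {b : ℝ} (hb : ball 0 b ⊆ Ω) :
    MemLp (fun x => inner ℝ x (p x)) 2 (volume.restrict (ball 0 b)) :=
  memLp_inner (ae_ball_norm_le b) continuous_id.aestronglyMeasurable
    (R.memLp.mono_measure (Measure.restrict_mono hb le_rfl))

lemma memLp_ball {b : ℝ} (hb : ball 0 b ⊆ Ω) : MemLp u 2 (volume.restrict (ball 0 b)) :=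
  R.admissible.memH1.1.mono_measure (Measure.restrict_mono hb le_rfl)

lemma integrable_inner_sq_annulus (a b : ℝ) :
    IntegrableOn (fun x => inner ℝ x (σ x) ^ 2) (annulus n a b) μ := by
  have := R.isPerimeterMeasure.finite
  refine Integrable.of_bound ((measurable_id.inner R.isPerimeterMeasure.measurable).pow_const
    2).aestronglyMeasurable (b ^ 2) ?_
  filter_upwards [ae_restrict_mem (measurableSet_annulus a b),
    ae_restrict_of_ae R.isPerimeterMeasure.norm_eq_one] with x hx hσ
  rw [Real.norm_of_nonneg (sq_nonneg _), ← sq_abs]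
  refine pow_le_pow_left₀ (abs_nonneg _) ((abs_real_inner_le_norm x (σ x)).trans ?_) 2
  rw [hσ, mul_one]
  exact hx.2.le

/-- The change of the normalized energy between two radii. -/
lemma energy_sub (hn : 1 ≤ n) (hmin : IsMinimizingPair Ω u E) {a b : ℝ} (ha : 0 < a) (hab : a < b)
    (hb : ball 0 b ⊆ Ω) :
    b ^ (1 - (n : ℤ)) * ((∫ x in ball 0 b, ‖p x‖ ^ 2) + μ.real (ball 0 b))
      - a ^ (1 - (n : ℤ)) * ((∫ x in ball 0 a, ‖p x‖ ^ 2) + μ.real (ball 0 a))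
      = (∫ x in annulus n a b, ‖x‖ ^ (-(n : ℤ) - 1) *
          (2 * inner ℝ x (p x) ^ 2 - u x * inner ℝ x (p x)))
        + ∫ x in annulus n a b, ‖x‖ ^ (-(n : ℤ) - 1) * inner ℝ x (σ x) ^ 2 ∂μ := by
  have := R.isPerimeterMeasure.finite
  have hb0 : 0 < b := ha.trans hab
  let N : ℕ → ℝ := fun k => k + 2 / a
  have hN : Tendsto N atTop atTop := tendsto_atTop_add_const_right _ _ tendsto_natCast_atTop_atTop
  have hN' : ∀ k, 2 / a ≤ N k := fun k => le_add_of_nonneg_left k.cast_nonneg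
  have hN0 : ∀ k, 0 < N k := fun k => (show 0 < 2 / a by positivity).trans_le (hN' k)
  let g : ℕ → ℝ → ℝ := fun k => stepDensity n a b (N k)
  let η : ℕ → Space n → ℝ := fun k x => ∫ s in b..‖x‖, g k s
  let κ : ℕ → Space n → ℝ := fun k x => ‖x‖⁻¹ * g k ‖x‖
  have hcut : ∀ k, IsRadialCutoff Ω (η k) (κ k) := fun k =>
    isRadialCutoff_integral hb (contDiff_stepDensity ha (hN' k)) (half_pos ha)
      (sub_lt_self b (one_div_pos.2 (hN0 k)))
      (fun s hs => stepDensity_eq_zero_of_lt ha (hN' k) hs)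
      (fun s hs => stepDensity_eq_zero_of_le (hN0 k) hs)
  set M : ℝ := (a / 2) ^ (-(n : ℤ)) with hM
  have hM0 : 0 < M := zpow_pos (half_pos ha) _
  have hg0 : ∀ k s, 0 ≤ g k s := fun k s => stepDensity_nonneg ha (hN' k) s
  have hgM : ∀ k s, g k s ≤ M := fun k s => stepDensity_le ha (hN' k) s
  have hgb : ∀ k s, b ≤ s → g k s = 0 := fun k s hs =>
    stepDensity_eq_zero_of_le (hN0 k) ((sub_le_self b (one_div_pos.2 (hN0 k)).le).trans hs)
  have hκ0 : ∀ k x, 0 ≤ κ k x := fun k x => mul_nonneg (by positivity) (hg0 k _)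
  have hκ1 : ∀ k x, κ k x * ‖x‖ ≤ M := fun k x => by
    by_cases hx : ‖x‖ = 0
    · rw [hx, mul_zero]
      exact hM0.le
    · have : κ k x * ‖x‖ = g k ‖x‖ := by
        simp only [κ]
        field_simp
      rw [this]
      exact hgM k _
  have hκ2 : ∀ k x, κ k x * ‖x‖ ^ 2 ≤ M * b := fun k x => by
    rcases le_or_gt b ‖x‖ with hx | hx
    · simp only [κ, hgb k _ hx, mul_zero, zero_mul]
      positivity
    · rw [sq, ← mul_assoc]
      exact mul_le_mul (hκ1 k x) hx.le (norm_nonneg _) hM0.le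
  have hη1 : ∀ k x, |η k x| ≤ M * b := fun k x => by
    rcases le_or_gt b ‖x‖ with hx | hx
    · have : η k x = 0 := by
        refine intervalIntegral.integral_zero_ae (f := g k) (Eventually.of_forall fun s hs => hgb k s ?_)
        rw [uIoc_of_le hx] at hs
        exact hs.1.le
      rw [this, abs_zero]
      positivity
    · refine (intervalIntegral.norm_integral_le_of_norm_le_const (f := g k) (C := M) fun s _ => ?_).trans ?_
      · rw [Real.norm_of_nonneg (hg0 k s)]
        exact hgM k s
      · refine mul_le_mul_of_nonneg_left ?_ hM0.le
        rw [abs_of_nonpos (by linarith)]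
        linarith [norm_nonneg x]
  set C : ℝ := |(n : ℝ) - 1| * (M * b) + M * b with hCdef
  have hC0 : 0 ≤ C := by positivity
  let w : ℕ → Space n → ℝ := fun k x => ((n : ℝ) - 1) * η k x + κ k x * ‖x‖ ^ 2
  have hwC : ∀ k x, |w k x| ≤ C := fun k x => by
    refine (abs_add_le _ _).trans (add_le_add ?_ ?_)
    · rw [abs_mul]
      exact mul_le_mul_of_nonneg_left (hη1 k x) (abs_nonneg _)
    · rw [abs_of_nonneg (mul_nonneg (hκ0 k x) (sq_nonneg _))]
      exact hκ2 k x
  -- `K` and `W` are the limits of `κ` and of the weight `(n - 1) η + κ |x|²`.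
  let K : Space n → ℝ := (annulus n a b).indicator fun x => ‖x‖ ^ (-(n : ℤ) - 1)
  let W : Space n → ℝ := fun x => (ball (0 : Space n) b).indicator (fun _ => b ^ (1 - (n : ℤ))) x
    - (ball (0 : Space n) a).indicator (fun _ => a ^ (1 - (n : ℤ))) x
  have hκlim : ∀ x, Tendsto (fun k => κ k x) atTop (𝓝 (K x)) := fun x => by
    have h1 := ((tendsto_stepApprox (a := a) (b := b) hN ‖x‖).const_mul
      (‖x‖ ^ (-(n : ℤ)))).const_mul ‖x‖⁻¹
    have h2 : ‖x‖⁻¹ * (‖x‖ ^ (-(n : ℤ)) * (Ico a b).indicator (fun _ => 1) ‖x‖) = K x := by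
      by_cases hx : x ∈ annulus n a b
      · simp only [K]
        rw [indicator_of_mem hx, indicator_of_mem (show ‖x‖ ∈ Ico a b from hx), mul_one,
          zpow_sub_one₀ (ha.trans_le hx.1).ne', mul_comm]
      · simp only [K]
        rw [indicator_of_notMem hx, indicator_of_notMem (show ‖x‖ ∉ Ico a b from hx), mul_zero,
          mul_zero]
    rw [h2] at h1
    exact h1
  have hwlim : ∀ x, Tendsto (fun k => w k x) atTop (𝓝 (W x)) := fun x => by
    have h1 := (tendsto_integral_stepDensity (n := n) ha hab hN hN' ‖x‖).add
      ((hκlim x).mul_const (‖x‖ ^ 2))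
    -- In the annulus `κ |x|²` contributes `|x| ^ (1 - n)`, which cancels the same term of `(n - 1)
    -- η`. This is the reason for the density `s⁻ⁿ`: the weight becomes constant there.
    have h2 : b ^ (1 - (n : ℤ)) - (max a (min ‖x‖ b)) ^ (1 - (n : ℤ)) + K x * ‖x‖ ^ 2 = W x := by
      simp only [K, W]
      rcases lt_or_ge ‖x‖ a with hx | hx
      · rw [indicator_of_notMem (fun h => absurd h.1 (not_le.2 hx)),
          indicator_of_mem (by simpa using hx.trans hab), indicator_of_mem (by simpa using hx),
          max_eq_left ((min_le_left _ _).trans hx.le)]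
        ring
      · rw [indicator_of_notMem (s := ball (0 : Space n) a) (by simpa using hx)]
        rcases lt_or_ge ‖x‖ b with hx' | hx'
        · rw [indicator_of_mem (show x ∈ annulus n a b from ⟨hx, hx'⟩),
            indicator_of_mem (by simpa using hx'), min_eq_left hx'.le, max_eq_right hx]
          have hx0 : ‖x‖ ≠ 0 := (ha.trans_le hx).ne'
          have : ‖x‖ ^ (-(n : ℤ) - 1) * ‖x‖ ^ 2 = ‖x‖ ^ (1 - (n : ℤ)) := by
            rw [← zpow_natCast ‖x‖ 2, ← zpow_add₀ hx0]
            congr 1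
            push_cast
            ring
          rw [this]
          ring
        · rw [indicator_of_notMem (fun h => absurd h.2 (not_lt.2 hx')),
            indicator_of_notMem (by simpa using hx'), min_eq_right hx', max_eq_right hab.le]
          ring
    rw [h2] at h1
    exact h1
  have hwc : ∀ k, Continuous (w k) := fun k => by
    have h1 := (hcut k).isTest.continuous
    have h2 := (hcut k).contDiff.continuous
    fun_prop
  have hκc : ∀ k, Continuous (κ k) := fun k => (hcut k).contDiff.continuous
  have hxp : AEStronglyMeasurable (fun x => inner ℝ x (p x)) (volume.restrict Ω) :=
    aestronglyMeasurable_id.inner R.memLp.1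
  have hum := R.admissible.memH1.1.1
  -- The bounds on `κ |x|` and `κ |x|²` are uniform in `k`, so `|p|²` and `|u| |p|` dominate.
  have hlim1 : Tendsto (fun k => ∫ x in Ω, (w k x * ‖p x‖ ^ 2
      - κ k x * (2 * inner ℝ x (p x) ^ 2 - u x * inner ℝ x (p x)))) atTop
      (𝓝 (∫ x in Ω, (W x * ‖p x‖ ^ 2
        - K x * (2 * inner ℝ x (p x) ^ 2 - u x * inner ℝ x (p x))))) := by
    refine tendsto_integral_of_dominated_convergence
      (fun x => (C + 2 * (M * b)) * ‖p x‖ ^ 2 + M * (‖u x‖ * ‖p x‖)) (fun k => ?_)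
      ((R.integrable_norm_sq.const_mul _).add (R.integrable_mul_norm.const_mul _))
      (fun k => Eventually.of_forall fun x => ?_) (Eventually.of_forall fun x => ?_)
    · exact ((hwc k).aestronglyMeasurable.mul (R.memLp.1.norm.pow 2)).sub
        ((hκc k).aestronglyMeasurable.mul (((hxp.pow 2).const_mul 2).sub (hum.mul hxp)))
    · have h1 : |inner ℝ x (p x)| ≤ ‖x‖ * ‖p x‖ := abs_real_inner_le_norm x (p x)
      have h2 : κ k x * inner ℝ x (p x) ^ 2 ≤ M * b * ‖p x‖ ^ 2 := by
        calc κ k x * inner ℝ x (p x) ^ 2 ≤ κ k x * (‖x‖ * ‖p x‖) ^ 2 := by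
              rw [← sq_abs]
              exact mul_le_mul_of_nonneg_left (pow_le_pow_left₀ (abs_nonneg _) h1 2) (hκ0 k x)
          _ = κ k x * ‖x‖ ^ 2 * ‖p x‖ ^ 2 := by ring
          _ ≤ _ := mul_le_mul_of_nonneg_right (hκ2 k x) (sq_nonneg _)
      have h3 : κ k x * |u x * inner ℝ x (p x)| ≤ M * (‖u x‖ * ‖p x‖) := by
        calc κ k x * |u x * inner ℝ x (p x)| ≤ κ k x * (‖u x‖ * (‖x‖ * ‖p x‖)) := by
              rw [abs_mul]
              exact mul_le_mul_of_nonneg_left (mul_le_mul_of_nonneg_left h1 (abs_nonneg _)) (hκ0 k x)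
          _ = κ k x * ‖x‖ * (‖u x‖ * ‖p x‖) := by ring
          _ ≤ _ := mul_le_mul_of_nonneg_right (hκ1 k x) (by positivity)
      have h4 : |w k x * ‖p x‖ ^ 2| ≤ C * ‖p x‖ ^ 2 := by
        rw [abs_mul, abs_of_nonneg (sq_nonneg ‖p x‖)]
        exact mul_le_mul_of_nonneg_right (hwC k x) (sq_nonneg _)
      have h5 : |κ k x * (2 * inner ℝ x (p x) ^ 2 - u x * inner ℝ x (p x))|
          ≤ 2 * (M * b * ‖p x‖ ^ 2) + M * (‖u x‖ * ‖p x‖) := by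
        rw [abs_mul, abs_of_nonneg (hκ0 k x)]
        have h6 : |2 * inner ℝ x (p x) ^ 2 - u x * inner ℝ x (p x)|
            ≤ 2 * inner ℝ x (p x) ^ 2 + |u x * inner ℝ x (p x)| :=
          (abs_sub _ _).trans (by rw [abs_of_nonneg (by positivity)])
        calc _ ≤ κ k x * (2 * inner ℝ x (p x) ^ 2 + |u x * inner ℝ x (p x)|) :=
              mul_le_mul_of_nonneg_left h6 (hκ0 k x)
          _ = 2 * (κ k x * inner ℝ x (p x) ^ 2) + κ k x * |u x * inner ℝ x (p x)| := by ring
          _ ≤ _ := by linarith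
      rw [Real.norm_eq_abs]
      refine (abs_sub _ _).trans ?_
      linarith
    · exact ((hwlim x).mul_const _).sub ((hκlim x).mul_const _)
  have hlim2 : Tendsto (fun k => ∫ x, (w k x - κ k x * inner ℝ x (σ x) ^ 2) ∂μ) atTop
      (𝓝 (∫ x, (W x - K x * inner ℝ x (σ x) ^ 2) ∂μ)) := by
    refine tendsto_integral_of_dominated_convergence (fun _ => C + M * b) (fun k => ?_)
      (integrable_const _) (fun k => ?_) (Eventually.of_forall fun x => ?_)
    · exact ((hwc k).measurable.sub ((hκc k).measurable.mul ((measurable_id.inner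
        R.isPerimeterMeasure.measurable).pow_const 2))).aestronglyMeasurable
    · filter_upwards [R.isPerimeterMeasure.norm_eq_one] with x hx
      rw [Real.norm_eq_abs]
      refine (abs_sub _ _).trans (add_le_add (hwC k x) ?_)
      rw [abs_of_nonneg (mul_nonneg (hκ0 k x) (sq_nonneg _))]
      refine le_trans (mul_le_mul_of_nonneg_left ?_ (hκ0 k x)) (hκ2 k x)
      rw [← sq_abs]
      refine pow_le_pow_left₀ (abs_nonneg _) ((abs_real_inner_le_norm x (σ x)).trans ?_) 2
      rw [hx, mul_one]
    · exact (hwlim x).sub ((hκlim x).mul_const _)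
  have hzero := tendsto_nhds_unique (hlim1.add hlim2)
    (tendsto_const_nhds.congr fun k => (R.total_variation hn hmin (hcut k)).symm)
  have hba : ball (0 : Space n) a ⊆ Ω := (ball_subset_ball hab.le).trans hb
  have hann : annulus n a b ⊆ Ω := (annulus_subset_ball a b).trans hb
  have hmA := measurableSet_annulus (n := n) a b
  have hp2 := R.integrable_norm_sq
  have hr := Measure.restrict_mono (μ := volume) (annulus_subset_ball (n := n) a b) le_rfl
  have ixp := (R.memLp_inner_gradient hb).mono_measure hr
  have iu := (R.memLp_ball hb).mono_measure hr
  have iK : IntegrableOn (fun x => ‖x‖ ^ (-(n : ℤ) - 1) *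
      (2 * inner ℝ x (p x) ^ 2 - u x * inner ℝ x (p x))) (annulus n a b) :=
    integrableOn_zpow_mul ha ((ixp.integrable_sq.const_mul 2).sub (iu.integrable_mul ixp))
  have e1 : ∫ x in Ω, (W x * ‖p x‖ ^ 2
        - K x * (2 * inner ℝ x (p x) ^ 2 - u x * inner ℝ x (p x)))
      = b ^ (1 - (n : ℤ)) * (∫ x in ball 0 b, ‖p x‖ ^ 2)
        - a ^ (1 - (n : ℤ)) * (∫ x in ball 0 a, ‖p x‖ ^ 2)
        - ∫ x in annulus n a b, ‖x‖ ^ (-(n : ℤ) - 1) *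
          (2 * inner ℝ x (p x) ^ 2 - u x * inner ℝ x (p x)) := by
    rw [← integral_const_mul, ← integral_const_mul, ← setIntegral_indicator_subset measurableSet_ball hb,
      ← setIntegral_indicator_subset measurableSet_ball hba, ← setIntegral_indicator_subset hmA hann,
      ← integral_sub, ← integral_sub]
    · refine integral_congr_ae (Eventually.of_forall fun x => ?_)
      simp only [W, K, Set.indicator]
      split_ifs <;> ring
    · exact (integrableOn_indicator_subset measurableSet_ball
        ((IntegrableOn.mono_set hp2 hb).const_mul _)).sub
        (integrableOn_indicator_subset measurableSet_ball ((IntegrableOn.mono_set hp2 hba).const_mul _))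
    · exact integrableOn_indicator_subset hmA iK
    · exact integrableOn_indicator_subset measurableSet_ball
        ((IntegrableOn.mono_set hp2 hb).const_mul _)
    · exact integrableOn_indicator_subset measurableSet_ball
        ((IntegrableOn.mono_set hp2 hba).const_mul _)
  have iσ := integrableOn_zpow_mul ha (R.integrable_inner_sq_annulus a b)
  have e2 : ∫ x, (W x - K x * inner ℝ x (σ x) ^ 2) ∂μ
      = b ^ (1 - (n : ℤ)) * μ.real (ball 0 b) - a ^ (1 - (n : ℤ)) * μ.real (ball 0 a)
        - ∫ x in annulus n a b, ‖x‖ ^ (-(n : ℤ) - 1) * inner ℝ x (σ x) ^ 2 ∂μ := by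
    have hc : ∀ (c : ℝ) (r : ℝ), c * μ.real (ball 0 r)
        = ∫ x, (ball (0 : Space n) r).indicator (fun _ => c) x ∂μ := fun c r => by
      rw [integral_indicator_const _ measurableSet_ball, smul_eq_mul, mul_comm]
    have hi : ∀ (c : ℝ) (r : ℝ), Integrable ((ball (0 : Space n) r).indicator fun _ => c) μ :=
      fun c r => (integrable_const c).indicator measurableSet_ball
    have i2 : Integrable (fun x => (ball (0 : Space n) b).indicator (fun _ => b ^ (1 - (n : ℤ))) x
        - (ball (0 : Space n) a).indicator (fun _ => a ^ (1 - (n : ℤ))) x) μ := (hi _ _).sub (hi _ _)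
    rw [hc, hc, ← integral_indicator hmA, ← integral_sub (hi _ _) (hi _ _),
      ← integral_sub i2 ((integrable_indicator_iff hmA).2 iσ)]
    refine integral_congr_ae (Eventually.of_forall fun x => ?_)
    simp only [W, K, Set.indicator]
    split_ifs <;> ring
  rw [e1, e2] at hzero
  linear_combination hzero

lemma hasTrace_trace (hn : 1 ≤ n) {r : ℝ} (hr : 0 < r) (hb : ball 0 r ⊆ Ω) :
    HasTrace u r (trace u r) := by
  have h : ∃ g, HasTrace u r g := exists_hasTrace hn hr (R.isWeakGradient.mono hb) (R.memLp_ball hb)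
    (R.memLp.mono_measure (Measure.restrict_mono hb le_rfl))
  rw [trace, dif_pos h]
  exact h.choose_spec

/-- The monotonicity formula. -/
lemma Phi_sub (hn : 1 ≤ n) (hmin : IsMinimizingPair Ω u E) {a b : ℝ} (ha : 0 < a) (hab : a < b)
    (hb : ball 0 b ⊆ Ω) :
    Phi u E b - Phi u E a
      = (∫ x in annulus n a b, ‖x‖ ^ (-(n : ℤ) - 1) * (2 * (inner ℝ x (p x) - 1 / 2 * u x) ^ 2))
        + ∫ x in annulus n a b, ‖x‖ ^ (-(n : ℤ) - 1) * inner ℝ x (σ x) ^ 2 ∂μ := by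
  have hba : ball (0 : Space n) a ⊆ Ω := (ball_subset_ball hab.le).trans hb
  have h1 := R.energy_sub hn hmin ha hab hb
  have h2 := boundary_integral_sub hn ha hab (R.isWeakGradient.mono hb) (R.memLp_ball hb)
    (R.memLp.mono_measure (Measure.restrict_mono hb le_rfl)) (R.hasTrace_trace hn ha hba)
    (R.hasTrace_trace hn (ha.trans hab) hb)
  have hr := Measure.restrict_mono (μ := volume) (annulus_subset_ball (n := n) a b) le_rfl
  have ixp := (R.memLp_inner_gradient hb).mono_measure hr
  have iu := (R.memLp_ball hb).mono_measure hr
  have iuxp := iu.integrable_mul ixp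
  have iA : IntegrableOn (fun x => ‖x‖ ^ (-(n : ℤ) - 1) *
      (2 * inner ℝ x (p x) ^ 2 - u x * inner ℝ x (p x))) (annulus n a b) :=
    integrableOn_zpow_mul ha ((ixp.integrable_sq.const_mul 2).sub iuxp)
  have iB : IntegrableOn (fun x => ‖x‖ ^ (-(n : ℤ) - 1) *
      (2 * (u x * inner ℝ x (p x)) - u x * u x)) (annulus n a b) :=
    integrableOn_zpow_mul ha ((iuxp.const_mul 2).sub (iu.integrable_mul iu))
  -- Completing the square with `q = x·p`: `2q² - uq - (2uq - u²)/2 = 2 (q - u/2)²`.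
  have e : ∫ x in annulus n a b, ‖x‖ ^ (-(n : ℤ) - 1) * (2 * (inner ℝ x (p x) - 1 / 2 * u x) ^ 2)
      = (∫ x in annulus n a b, ‖x‖ ^ (-(n : ℤ) - 1) *
          (2 * inner ℝ x (p x) ^ 2 - u x * inner ℝ x (p x)))
        - 1 / 2 * ∫ x in annulus n a b, ‖x‖ ^ (-(n : ℤ) - 1) *
          (2 * (u x * inner ℝ x (p x)) - u x * u x) := by
    rw [← integral_const_mul, ← integral_sub iA (iB.const_mul _)]
    refine integral_congr_ae (Eventually.of_forall fun x => ?_)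
    ring
  rw [e, ← h2, Phi, Phi, R.toReal_energy isOpen_ball hb, R.toReal_energy isOpen_ball hba]
  linear_combination h1

end IsRepresented

/-! ### Euler's theorem in the sense of distributions -/

section Homogeneity

variable {R γ : ℝ} {w φ : Space n → ℝ}

/-- For `s ≤ 1` the support is contracted towards the origin and stays in the ball. -/
lemma IsTest.comp_inv_smul (hφ : IsTest (ball 0 R) φ) {s : ℝ} (hs : 0 < s) (hs1 : s ≤ 1) :
    IsTest (ball 0 R) fun y => φ (s⁻¹ • y) := by
  have hts : tsupport (fun y => φ (s⁻¹ • y)) ⊆ (fun y => s⁻¹ • y) ⁻¹' tsupport φ :=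
    closure_minimal (fun y hy => subset_tsupport φ hy)
      ((isClosed_tsupport φ).preimage (by fun_prop))
  refine ⟨hφ.contDiff.comp (contDiff_const_smul s⁻¹),
    hφ.hasCompactSupport.comp_homeomorph (Homeomorph.smulOfNeZero s⁻¹ (inv_ne_zero hs.ne')),
    fun y hy => ?_⟩
  have h := hφ.tsupport_subset (hts hy)
  rw [mem_ball_zero_iff, norm_smul, norm_inv, Real.norm_of_nonneg hs.le,
    inv_mul_lt_iff₀ hs] at h
  rw [mem_ball_zero_iff]
  have hR : 0 < R := by
    by_contra hR
    nlinarith [norm_nonneg y]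
  nlinarith

/-- The derivative of the rescaled pairing of `w` with a test function. -/
lemma hasDerivAt_scaled_pairing (hw : Integrable w) (hφ : IsTest (ball 0 R) φ) (γ : ℝ) {s : ℝ}
    (hs : 0 < s) :
    HasDerivAt (fun s : ℝ => s ^ (-γ - n) * ∫ y, w y * φ (s⁻¹ • y))
      (-(s ^ (-γ - n - 1) * ((∫ y, w y * divergence (fun z => φ (s⁻¹ • z) • z) y)
        + γ * ∫ y, w y * φ (s⁻¹ • y)))) s := by
  obtain ⟨C₀, hC₀, hφC⟩ := hφ.bounded
  have hid : IsTest (ball 0 R) fun x => φ x • x := hφ.smul_right contDiff_id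
  obtain ⟨C₁, hC₁, hdC⟩ := hid.divergence.bounded
  -- The radial derivative of `φ` is bounded since `div (φ x)` and `φ` are.
  have hψ : ∀ x, fderiv ℝ φ x x = DirichletPerimeter.divergence (fun y => φ y • y) x - n * φ x :=
    fun x => by rw [divergence_smul_id (hφ.differentiable x)]; ring
  have hψC : ∀ x, ‖fderiv ℝ φ x x‖ ≤ C₁ + n * C₀ := fun x => by
    rw [hψ]
    refine (norm_sub_le _ _).trans (add_le_add (hdC x) ?_)
    rw [norm_mul, Real.norm_natCast]
    exact mul_le_mul_of_nonneg_left (hφC x) n.cast_nonneg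
  have hψc : Continuous fun x => fderiv ℝ φ x x :=
    (hφ.contDiff.continuous_fderiv (by simp)).clm_apply continuous_id
  have hder : ∀ y : Space n, ∀ r : ℝ, 0 < r → HasDerivAt (fun r : ℝ => φ (r⁻¹ • y))
      (-(r⁻¹ * fderiv ℝ φ (r⁻¹ • y) (r⁻¹ • y))) r := fun y r hr => by
    have h1 : HasDerivAt (fun r : ℝ => r⁻¹ • y) (-(r ^ 2)⁻¹ • y) r :=
      (hasDerivAt_inv hr.ne').smul_const y
    refine ((hφ.differentiable (r⁻¹ • y)).hasFDerivAt.comp_hasDerivAt r h1).congr_deriv ?_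
    rw [map_smul, map_smul, smul_eq_mul, smul_eq_mul]
    ring
  have h_int : ∀ r : ℝ, Integrable fun y => w y * φ (r⁻¹ • y) := fun r =>
    hw.mul_bdd (c := C₀) (hφ.continuous.comp (by fun_prop)).aestronglyMeasurable
      (Eventually.of_forall fun y => hφC _)
  have hI := (hasDerivAt_integral_of_dominated_loc_of_deriv_le (μ := volume)
    (F := fun (r : ℝ) y => w y * φ (r⁻¹ • y))
    (F' := fun (r : ℝ) y => w y * -(r⁻¹ * fderiv ℝ φ (r⁻¹ • y) (r⁻¹ • y)))
    (bound := fun y => ‖w y‖ * ((s / 2)⁻¹ * (C₁ + n * C₀)))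
    (x₀ := s) (s := Ioi (s / 2)) (Ioi_mem_nhds (by linarith))
    (Eventually.of_forall fun r => (h_int r).1) (h_int s)
    (hw.1.mul (Continuous.aestronglyMeasurable (by
      have h2 : Continuous fun y : Space n => fderiv ℝ φ (s⁻¹ • y) (s⁻¹ • y) :=
        hψc.comp (continuous_const_smul s⁻¹)
      exact (continuous_const.mul h2).neg)))
    (Eventually.of_forall fun y r hr => by
      have hr' : s / 2 < r := hr
      have hr0 : 0 < r := by linarith
      rw [norm_mul, norm_neg, norm_mul, norm_inv, Real.norm_of_nonneg hr0.le]
      refine mul_le_mul_of_nonneg_left (mul_le_mul ?_ (hψC _) (norm_nonneg _) (by positivity))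
        (norm_nonneg _)
      exact inv_anti₀ (by linarith) hr'.le)
    (hw.norm.mul_const _)
    (Eventually.of_forall fun y r hr => (hder y r (by
      have hr' : s / 2 < r := hr
      linarith)).const_mul (w y))).2
  have hP := (Real.hasDerivAt_rpow_const (x := s) (p := -γ - n) (Or.inl hs.ne')).mul hI
  refine hP.congr_deriv ?_
  have hφs : ∀ y, DifferentiableAt ℝ (fun z => φ (s⁻¹ • z)) y := fun y =>
    (hφ.differentiable (s⁻¹ • y)).comp y (by fun_prop)
  have hdiv : ∀ y, DirichletPerimeter.divergence (fun z => φ (s⁻¹ • z) • z) y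
      = n * φ (s⁻¹ • y) + fderiv ℝ φ (s⁻¹ • y) (s⁻¹ • y) := fun y => by
    rw [divergence_smul_id (hφs y)]
    have h1 : HasFDerivAt (fun z => φ (s⁻¹ • z)) ((fderiv ℝ φ (s⁻¹ • y)).comp
        (s⁻¹ • ContinuousLinearMap.id ℝ (Space n))) y :=
      (hφ.differentiable (s⁻¹ • y)).hasFDerivAt.comp y ((hasFDerivAt_id y).const_smul s⁻¹)
    rw [h1.fderiv]
    simp
  have h_int2 : Integrable fun y => w y * fderiv ℝ φ (s⁻¹ • y) (s⁻¹ • y) :=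
    hw.mul_bdd (c := C₁ + n * C₀) (hψc.comp (continuous_const_smul s⁻¹)).aestronglyMeasurable
      (Eventually.of_forall fun y => hψC _)
  have e1 : ∫ y, w y * DirichletPerimeter.divergence (fun z => φ (s⁻¹ • z) • z) y
      = n * (∫ y, w y * φ (s⁻¹ • y)) + ∫ y, w y * fderiv ℝ φ (s⁻¹ • y) (s⁻¹ • y) := by
    rw [← integral_const_mul, ← integral_add ((h_int s).const_mul _) h_int2]
    refine integral_congr_ae (Eventually.of_forall fun y => ?_)
    beta_reduce
    rw [hdiv]
    ring
  have e2 : ∫ y, w y * -(s⁻¹ * fderiv ℝ φ (s⁻¹ • y) (s⁻¹ • y))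
      = -(s⁻¹ * ∫ y, w y * fderiv ℝ φ (s⁻¹ • y) (s⁻¹ • y)) := by
    rw [← integral_const_mul, ← integral_neg]
    refine integral_congr_ae (Eventually.of_forall fun y => ?_)
    ring
  have e3 : s ^ (-γ - n) = s ^ (-γ - n - 1) * s := by
    rw [← Real.rpow_add_one hs.ne']
    congr 1
    ring
  rw [e1, e2, e3]
  field_simp
  ring

/-- A change of variables moves the dilation from the test function to `w`, so that only the smooth
factor is ever differentiated in `s`. -/
lemma scaled_pairing_eq {s : ℝ} (hs : 0 < s) :
    s ^ (-γ - n) * ∫ y, w y * φ (s⁻¹ • y) = s ^ (-γ) * ∫ x, w (s • x) * φ x := by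
  have h := Measure.integral_comp_smul_of_nonneg volume (fun y => w y * φ (s⁻¹ • y)) s
    (hR := hs.le)
  simp only [smul_smul, inv_mul_cancel₀ hs.ne', one_smul, finrank_euclideanSpace,
    Fintype.card_fin, smul_eq_mul] at h
  rw [h, ← mul_assoc]
  congr 1
  rw [Real.rpow_sub hs, Real.rpow_natCast]
  rfl

/-- Euler's theorem for weakly differentiable functions: homogeneity of degree `γ` in `B_R` is
equivalent to a first order equation in the sense of distributions. -/
lemma homogeneous_iff_integral_divergence (hw : Integrable w) :
    (∀ t ∈ Ioo (0 : ℝ) 1, ∀ᵐ x ∂volume.restrict (ball (0 : Space n) R), w (t • x) = t ^ γ * w x) ↔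
      ∀ φ, IsTest (ball 0 R) φ →
        (∫ x, w x * divergence (fun y => φ y • y) x) + γ * (∫ x, w x * φ x) = 0 := by
  have hmul : ∀ φ, IsTest (ball (0 : Space n) R) φ → ∀ f : Space n → ℝ,
      ∫ x in ball 0 R, f x * φ x = ∫ x, f x * φ x := fun φ hφ f =>
    setIntegral_eq_integral_of_forall_compl_eq_zero fun x hx => by rw [hφ.comp_apply hx, mul_zero]
  constructor
  · intro h φ hφ
    have hd := hasDerivAt_scaled_pairing hw hφ γ one_pos
    -- Homogeneity makes the rescaled pairing constant on `(0, 1]`; its derivative at `1`,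
    -- determined by the values on the left, is therefore zero.
    have hconst : ∀ s ∈ Ioc (0 : ℝ) 1, s ^ (-γ - n) * ∫ y, w y * φ (s⁻¹ • y) = ∫ y, w y * φ y := by
      intro s hs
      rcases hs.2.eq_or_lt with rfl | hs1
      · simp
      rw [scaled_pairing_eq hs.1, ← hmul φ hφ, ← hmul φ hφ, ← integral_const_mul]
      refine integral_congr_ae ?_
      filter_upwards [h s ⟨hs.1, hs1⟩] with x hx
      rw [hx, ← mul_assoc, ← mul_assoc, ← Real.rpow_add hs.1]
      simp
    have hd0 : HasDerivWithinAt (fun s : ℝ => s ^ (-γ - n) * ∫ y, w y * φ (s⁻¹ • y)) 0 (Ioc 0 1) 1 :=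
      (hasDerivWithinAt_const (1 : ℝ) (Ioc (0 : ℝ) 1) (∫ y, w y * φ y)).congr hconst
        (hconst 1 ⟨one_pos, le_rfl⟩)
    have hu : UniqueDiffWithinAt ℝ (Ioc (0 : ℝ) 1) 1 :=
      uniqueDiffOn_Ioc 0 1 1 ⟨one_pos, le_rfl⟩
    have h0 := hu.eq_deriv _ hd.hasDerivWithinAt hd0
    simp only [inv_one, one_smul, Real.one_rpow, one_mul] at h0
    linarith
  · intro h t ht
    -- Applied to the rescaled test functions, the equation annihilates the derivative on all of
    -- `[t, 1]`.
    have key : ∀ φ, IsTest (ball (0 : Space n) R) φ →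
        t ^ (-γ) * ∫ x, w (t • x) * φ x = ∫ x, w x * φ x := by
      intro φ hφ
      have hd : ∀ s ∈ Icc t 1, HasDerivAt (fun s : ℝ => s ^ (-γ - n) * ∫ y, w y * φ (s⁻¹ • y)) 0 s := by
        intro s hs
        have hs0 : 0 < s := ht.1.trans_le hs.1
        have := hasDerivAt_scaled_pairing hw hφ γ hs0
        rwa [h _ (hφ.comp_inv_smul hs0 hs.2), mul_zero, neg_zero] at this
      have hc := constant_of_has_deriv_right_zero
        (fun s hs => (hd s hs).continuousAt.continuousWithinAt)
        (fun s hs => (hd s ⟨hs.1, hs.2.le⟩).hasDerivWithinAt) 1 ⟨ht.2.le, le_rfl⟩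
      rw [← scaled_pairing_eq ht.1, ← hc]
      simp
    have hwt : Integrable fun x => w (t • x) := hw.comp_smul ht.1.ne'
    have hz : ∀ᵐ x, x ∈ ball (0 : Space n) R → t ^ (-γ) * w (t • x) - w x = 0 := by
      refine isOpen_ball.ae_eq_zero_of_integral_contDiff_smul_eq_zero
        (((hwt.const_mul (t ^ (-γ))).sub hw).locallyIntegrable.locallyIntegrableOn _)
        fun φ h1 h2 h3 => ?_
      have hφ : IsTest (ball (0 : Space n) R) φ := ⟨h1, h2, h3⟩
      obtain ⟨C, -, hC⟩ := hφ.bounded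
      have hm := hφ.continuous.aestronglyMeasurable (μ := (volume : Measure (Space n)))
      have e : ∀ x, φ x • (t ^ (-γ) * w (t • x) - w x)
          = t ^ (-γ) * (w (t • x) * φ x) - w x * φ x := fun x => by
        rw [smul_eq_mul]
        ring
      simp only [e]
      rw [integral_sub ((hwt.mul_bdd hm (Eventually.of_forall hC)).const_mul _)
        (hw.mul_bdd hm (Eventually.of_forall hC)), integral_const_mul, key φ hφ, sub_self]
    rw [ae_restrict_iff' measurableSet_ball]
    filter_upwards [hz] with x hx hxb
    have h1 := hx hxb
    have h2 : t ^ γ * t ^ (-γ) = 1 := by rw [← Real.rpow_add ht.1]; simp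
    linear_combination t ^ γ * h1 - w (t • x) * h2

end Homogeneity

/-! ### Rigidity -/

/-- A property that holds almost everywhere in all annuli holds almost everywhere in the ball. -/
lemma ae_ball_of_ae_annulus {m : Measure (Space n)} {P : Space n → Prop} {R : ℝ} (hR : 0 < R)
    (h0 : ∀ᵐ x ∂m, x = 0 → P x) (h : ∀ a ∈ Ioo 0 R, ∀ᵐ x ∂m.restrict (annulus n a R), P x) :
    ∀ᵐ x ∂m.restrict (ball (0 : Space n) R), P x := by
  -- The countably many annuli with inner radii `R / (k + 2)` exhaust the punctured ball.
  have h1 : ∀ k : ℕ, ∀ᵐ x ∂m, x ∈ annulus n (R / (k + 2)) R → P x := fun k => by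
    rw [← ae_restrict_iff' (measurableSet_annulus _ _)]
    exact h _ ⟨by positivity, div_lt_self hR (by linarith [k.cast_nonneg (α := ℝ)])⟩
  rw [ae_restrict_iff' measurableSet_ball]
  filter_upwards [h0, ae_all_iff.2 h1] with x hx0 hx hxR
  by_cases h2 : x = 0
  · exact hx0 h2
  have hpos : 0 < ‖x‖ := norm_pos_iff.2 h2
  obtain ⟨k, hk⟩ := exists_nat_gt (R / ‖x‖)
  refine hx k ⟨?_, mem_ball_zero_iff.1 hxR⟩
  rw [div_lt_iff₀ hpos] at hk
  rw [div_le_iff₀ (by positivity)]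
  nlinarith

namespace IsRepresented

variable {Ω E : Set (Space n)} {u : Space n → ℝ} {p : Space n → Space n} {μ : Measure (Space n)}
  {σ : Space n → Space n} (H : IsRepresented Ω u E p μ σ) {R : ℝ}
include H

/-- Homogeneity of degree `1/2` in terms of the radial derivative. -/
lemma homogeneous_iff_inner_gradient (hb : ball 0 R ⊆ Ω) :
    (∀ t ∈ Ioo (0 : ℝ) 1, ∀ᵐ x ∂volume.restrict (ball (0 : Space n) R),
      u (t • x) = t ^ (1 / 2 : ℝ) * u x) ↔
      ∀ᵐ x ∂volume.restrict (ball (0 : Space n) R), inner ℝ x (p x) - 1 / 2 * u x = 0 := by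
  set B : Set (Space n) := ball 0 R with hB
  have hBm : MeasurableSet B := measurableSet_ball
  have hu2 := H.memLp_ball hb
  have hui : IntegrableOn u B := hu2.integrable one_le_two
  have hxp : IntegrableOn (fun x => inner ℝ x (p x)) B :=
    (H.memLp_inner_gradient hb).integrable one_le_two
  have hw : Integrable (B.indicator u) := (integrable_indicator_iff hBm).2 hui
  have h1 : (∀ t ∈ Ioo (0 : ℝ) 1, ∀ᵐ x ∂volume.restrict B, u (t • x) = t ^ (1 / 2 : ℝ) * u x) ↔
      ∀ t ∈ Ioo (0 : ℝ) 1, ∀ᵐ x ∂volume.restrict B,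
        B.indicator u (t • x) = t ^ (1 / 2 : ℝ) * B.indicator u x := by
    refine forall₂_congr fun t ht => eventually_congr ?_
    filter_upwards [ae_restrict_mem hBm] with x hx
    have htx : t • x ∈ B := by
      rw [hB, mem_ball_zero_iff] at hx ⊢
      rw [norm_smul, Real.norm_of_nonneg ht.1.le]
      nlinarith [norm_nonneg x, ht.1, ht.2]
    rw [indicator_of_mem hx, indicator_of_mem htx]
  -- Testing the weak gradient with the radial field `φ x` turns the distributional equation into
  -- the pointwise one.
  have e : ∀ φ, IsTest B φ → (∫ x, B.indicator u x * divergence (fun y => φ y • y) x)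
      + 1 / 2 * (∫ x, B.indicator u x * φ x)
      = -∫ x in B, φ x • (inner ℝ x (p x) - 1 / 2 * u x) := by
    intro φ hφ
    have hid : IsTest B fun x => φ x • x := hφ.smul_right contDiff_id
    obtain ⟨C, -, hC⟩ := hφ.bounded
    have hm := hφ.continuous.aestronglyMeasurable (μ := volume.restrict B)
    have e1 : ∫ x, B.indicator u x * divergence (fun y => φ y • y) x
        = -∫ x in B, φ x * inner ℝ x (p x) := by
      have h2 := (H.isWeakGradient.mono hb).integral_mul_divergence hid
      have h3 : ∫ x, B.indicator u x * divergence (fun y => φ y • y) x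
          = ∫ x, u x * divergence (fun y => φ y • y) x := by
        refine integral_congr_ae (Eventually.of_forall fun x => ?_)
        by_cases hx : x ∈ B
        · simp only [indicator_of_mem hx]
        · simp only [hid.divergence.comp_apply hx, mul_zero]
      have h4 : ∫ x in B, φ x * inner ℝ x (p x) = ∫ x, φ x * inner ℝ x (p x) :=
        setIntegral_eq_integral_of_forall_compl_eq_zero fun x hx => by
          rw [hφ.comp_apply hx, zero_mul]
      rw [h3, h2, h4]
      congr 1
      refine integral_congr_ae (Eventually.of_forall fun x => ?_)
      simp only [inner_smul_right, real_inner_comm]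
    have e2 : ∫ x, B.indicator u x * φ x = ∫ x in B, φ x * u x := by
      rw [← integral_indicator hBm]
      refine integral_congr_ae (Eventually.of_forall fun x => ?_)
      by_cases hx : x ∈ B
      · simp only [indicator_of_mem hx, mul_comm]
      · simp only [indicator_of_notMem hx, zero_mul]
    have i1 : IntegrableOn (fun x => φ x * inner ℝ x (p x)) B :=
      hxp.bdd_mul hm (Eventually.of_forall hC)
    have i2 : IntegrableOn (fun x => φ x * u x) B := hui.bdd_mul hm (Eventually.of_forall hC)
    rw [e1, e2]
    have e3 : ∀ x, φ x • (inner ℝ x (p x) - 1 / 2 * u x)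
        = φ x * inner ℝ x (p x) - 1 / 2 * (φ x * u x) := fun x => by
      rw [smul_eq_mul]
      ring
    simp only [e3]
    rw [integral_sub i1 (i2.const_mul _), integral_const_mul]
    ring
  rw [h1, homogeneous_iff_integral_divergence hw]
  constructor
  · intro h
    have h2 : ∀ᵐ x ∂volume.restrict B, x ∈ B → inner ℝ x (p x) - 1 / 2 * u x = 0 := by
      refine isOpen_ball.ae_eq_zero_of_integral_contDiff_smul_eq_zero
        ((Integrable.locallyIntegrable (hxp.sub (hui.const_mul (1 / 2)))).locallyIntegrableOn _)
        fun φ g1 g2 g3 => ?_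
      have h3 := e φ ⟨g1, g2, g3⟩
      rw [h φ ⟨g1, g2, g3⟩] at h3
      linarith
    filter_upwards [h2, ae_restrict_mem hBm] with x hx hxB
    exact hx hxB
  · intro h φ hφ
    rw [e φ hφ, neg_eq_zero]
    refine integral_eq_zero_of_ae ?_
    filter_upwards [h] with x hx
    rw [hx, smul_zero, Pi.zero_apply]

/-- Homogeneity of degree `0` of a set in terms of its normal. -/
lemma homogeneous_iff_inner_normal (hb : ball 0 R ⊆ Ω) :
    (∀ t ∈ Ioo (0 : ℝ) 1, ∀ᵐ x ∂volume.restrict (ball (0 : Space n) R), t • x ∈ E ↔ x ∈ E) ↔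
      ∀ᵐ x ∂μ.restrict (ball (0 : Space n) R), inner ℝ x (σ x) = 0 := by
  have := H.isPerimeterMeasure.finite
  set B : Set (Space n) := ball 0 R with hB
  have hBm : MeasurableSet B := measurableSet_ball
  have hEm := H.admissible.measurableSet
  -- A set is homogeneous of degree `0` exactly when its indicator is; the restriction to `B` makes
  -- it integrable.
  set w : Space n → ℝ := B.indicator (E.indicator fun _ => 1) with hwdef
  have hw : Integrable w := by
    rw [hwdef, integrable_indicator_iff hBm]
    exact (integrable_const (1 : ℝ)).indicator hEm
  have h1 : (∀ t ∈ Ioo (0 : ℝ) 1, ∀ᵐ x ∂volume.restrict B, t • x ∈ E ↔ x ∈ E) ↔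
      ∀ t ∈ Ioo (0 : ℝ) 1, ∀ᵐ x ∂volume.restrict B, w (t • x) = t ^ (0 : ℝ) * w x := by
    refine forall₂_congr fun t ht => eventually_congr ?_
    filter_upwards [ae_restrict_mem hBm] with x hx
    have htx : t • x ∈ B := by
      rw [hB, mem_ball_zero_iff] at hx ⊢
      rw [norm_smul, Real.norm_of_nonneg ht.1.le]
      nlinarith [norm_nonneg x, ht.1, ht.2]
    rw [hwdef, indicator_of_mem hx, indicator_of_mem htx, Real.rpow_zero, one_mul]
    by_cases h2 : x ∈ E <;> by_cases h3 : t • x ∈ E <;> simp [h2, h3]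
  -- For degree `0` only the flux of `E` through `φ x` remains, and this is `∫ φ x·σ dμ`.
  have e : ∀ φ, IsTest B φ → (∫ x, w x * divergence (fun y => φ y • y) x) + 0 * (∫ x, w x * φ x)
      = ∫ x, φ x • inner ℝ x (σ x) ∂μ := by
    intro φ hφ
    have hid : IsTest B fun x => φ x • x := hφ.smul_right contDiff_id
    have h2 := H.isPerimeterMeasure.flux _ (hid.mono hb)
    have h3 : ∫ x, w x * divergence (fun y => φ y • y) x
        = indicatorFlux E fun y => φ y • y := by
      refine integral_congr_ae (Eventually.of_forall fun x => ?_)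
      by_cases hx : x ∈ B
      · simp only [hwdef, indicator_of_mem hx]
      · simp only [hid.divergence.comp_apply hx, mul_zero]
    rw [zero_mul, add_zero, h3, h2]
    refine integral_congr_ae (Eventually.of_forall fun x => ?_)
    simp only [inner_smul_right, real_inner_comm, smul_eq_mul]
  rw [h1, homogeneous_iff_integral_divergence hw, ae_restrict_iff' hBm]
  have hm : Measurable fun x => inner ℝ x (σ x) := measurable_id.inner H.isPerimeterMeasure.measurable
  constructor
  · intro h
    refine isOpen_ball.ae_eq_zero_of_integral_contDiff_smul_eq_zero ?_ fun φ g1 g2 g3 => ?_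
    · refine IntegrableOn.locallyIntegrableOn ?_
      refine Integrable.of_bound hm.aestronglyMeasurable R ?_
      filter_upwards [ae_restrict_mem hBm,
        ae_restrict_of_ae H.isPerimeterMeasure.norm_eq_one] with x hx hσ
      refine (norm_inner_le_norm x (σ x)).trans ?_
      rw [hσ, mul_one]
      exact (mem_ball_zero_iff.1 hx).le
    · rw [← e φ ⟨g1, g2, g3⟩]
      exact h φ ⟨g1, g2, g3⟩
  · intro h φ hφ
    rw [e φ hφ]
    refine integral_eq_zero_of_ae ?_
    filter_upwards [h] with x hx
    by_cases hxB : x ∈ B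
    · simp [hx hxB]
    · simp [hφ.comp_apply hxB]

lemma Phi_le (hn : 1 ≤ n) (hmin : IsMinimizingPair Ω u E) {a b : ℝ} (ha : 0 < a) (hab : a ≤ b)
    (hb : ball 0 b ⊆ Ω) : Phi u E a ≤ Phi u E b := by
  rcases hab.eq_or_lt with rfl | hab
  · exact le_rfl
  have h := H.Phi_sub hn hmin ha hab hb
  have h1 : 0 ≤ ∫ x in annulus n a b, ‖x‖ ^ (-(n : ℤ) - 1) *
      (2 * (inner ℝ x (p x) - 1 / 2 * u x) ^ 2) :=
    integral_nonneg fun x => mul_nonneg (zpow_nonneg (norm_nonneg x) _) (by positivity)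
  have h2 : 0 ≤ ∫ x in annulus n a b, ‖x‖ ^ (-(n : ℤ) - 1) * inner ℝ x (σ x) ^ 2 ∂μ :=
    integral_nonneg fun x => mul_nonneg (zpow_nonneg (norm_nonneg x) _) (by positivity)
  linarith

/-- The rigidity case of the monotonicity formula. -/
lemma exists_Phi_eq_iff_isConeIn (hn : 1 ≤ n) (hmin : IsMinimizingPair Ω u E) (hR : 0 < R)
    (hb : ball 0 R ⊆ Ω) : (∃ c : ℝ, ∀ r ∈ Ioc 0 R, Phi u E r = c) ↔ IsConeIn R u E := by
  have := nontrivial_space hn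
  have := H.isPerimeterMeasure.finite
  have hcone : IsConeIn R u E ↔
      (∀ᵐ x ∂volume.restrict (ball (0 : Space n) R), inner ℝ x (p x) - 1 / 2 * u x = 0) ∧
        ∀ᵐ x ∂μ.restrict (ball (0 : Space n) R), inner ℝ x (σ x) = 0 := by
    rw [← H.homogeneous_iff_inner_gradient hb, ← H.homogeneous_iff_inner_normal hb]
    exact ⟨fun h => ⟨fun t ht => (h t ht).1, fun t ht => (h t ht).2⟩,
      fun h t ht => ⟨h.1 t ht, h.2 t ht⟩⟩
  rw [hcone]
  constructor
  · rintro ⟨c, hc⟩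
    -- Two nonnegative integrals with sum zero vanish separately, and the weight is positive on the
    -- annulus.
    have hzero : ∀ a ∈ Ioo 0 R,
        (∀ᵐ x ∂volume.restrict (annulus n a R), inner ℝ x (p x) - 1 / 2 * u x = 0) ∧
          ∀ᵐ x ∂μ.restrict (annulus n a R), inner ℝ x (σ x) = 0 := by
      intro a ha
      have h := H.Phi_sub hn hmin ha.1 ha.2 hb
      rw [hc R ⟨hR, le_rfl⟩, hc a ⟨ha.1, ha.2.le⟩, sub_self] at h
      have n1 : (0 : Space n → ℝ) ≤ fun x =>
          ‖x‖ ^ (-(n : ℤ) - 1) * (2 * (inner ℝ x (p x) - 1 / 2 * u x) ^ 2) :=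
        fun x => mul_nonneg (zpow_nonneg (norm_nonneg x) _) (by positivity)
      have n2 : (0 : Space n → ℝ) ≤ fun x => ‖x‖ ^ (-(n : ℤ) - 1) * inner ℝ x (σ x) ^ 2 :=
        fun x => mul_nonneg (zpow_nonneg (norm_nonneg x) _) (by positivity)
      have p1 := integral_nonneg (μ := volume.restrict (annulus n a R)) n1
      have p2 := integral_nonneg (μ := μ.restrict (annulus n a R)) n2
      have hr := Measure.restrict_mono (μ := volume) (annulus_subset_ball (n := n) a R) le_rfl
      have i1 := integrableOn_zpow_mul ha.1 (((((H.memLp_inner_gradient hb).sub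
        ((H.memLp_ball hb).const_mul (1 / 2))).mono_measure hr).integrable_sq).const_mul 2)
      have i2 := integrableOn_zpow_mul ha.1 (H.integrable_inner_sq_annulus a R)
      have z1 := (integral_eq_zero_iff_of_nonneg n1 i1).1 (le_antisymm (by linarith) p1)
      have z2 := (integral_eq_zero_iff_of_nonneg n2 i2).1 (le_antisymm (by linarith) p2)
      constructor
      · filter_upwards [z1, ae_restrict_mem (measurableSet_annulus a R)] with x hx hxa
        have hpos : ‖x‖ ^ (-(n : ℤ) - 1) ≠ 0 := (zpow_pos (ha.1.trans_le hxa.1) _).ne'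
        rw [Pi.zero_apply, mul_eq_zero, or_iff_right hpos, mul_eq_zero, or_iff_right two_ne_zero] at hx
        exact pow_eq_zero_iff two_ne_zero |>.1 hx
      · filter_upwards [z2, ae_restrict_mem (measurableSet_annulus a R)] with x hx hxa
        have hpos : ‖x‖ ^ (-(n : ℤ) - 1) ≠ 0 := (zpow_pos (ha.1.trans_le hxa.1) _).ne'
        rw [Pi.zero_apply, mul_eq_zero, or_iff_right hpos] at hx
        exact pow_eq_zero_iff two_ne_zero |>.1 hx
    -- The origin is Lebesgue null, which handles the first relation; for `μ` nothing has to be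
    -- known, since `x·σ = 0` trivially at `x = 0`.
    refine ⟨ae_ball_of_ae_annulus hR ?_ fun a ha => (hzero a ha).1,
      ae_ball_of_ae_annulus hR (Eventually.of_forall fun x hx => by simp [hx])
        fun a ha => (hzero a ha).2⟩
    have hne : ∀ᵐ x : Space n, x ≠ 0 := compl_mem_ae_iff.2 (measure_singleton 0)
    filter_upwards [hne] with x hx h2
    exact absurd h2 hx
  · rintro ⟨h1, h2⟩
    refine ⟨Phi u E R, fun r hr => ?_⟩
    rcases hr.2.eq_or_lt with rfl | hrR
    · rfl
    have h := H.Phi_sub hn hmin hr.1 hrR hb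
    have hsub := annulus_subset_ball (n := n) r R
    have z1 : ∫ x in annulus n r R, ‖x‖ ^ (-(n : ℤ) - 1) *
        (2 * (inner ℝ x (p x) - 1 / 2 * u x) ^ 2) = 0 := by
      refine integral_eq_zero_of_ae ?_
      filter_upwards [ae_restrict_of_ae_restrict_of_subset hsub h1] with x hx
      simp only [hx, Pi.zero_apply]
      ring
    have z2 : ∫ x in annulus n r R, ‖x‖ ^ (-(n : ℤ) - 1) * inner ℝ x (σ x) ^ 2 ∂μ = 0 := by
      refine integral_eq_zero_of_ae ?_
      filter_upwards [ae_restrict_of_ae_restrict_of_subset hsub h2] with x hx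
      simp only [hx, Pi.zero_apply]
      ring
    rw [z1, z2] at h
    linarith

end IsRepresented

end DirichletPerimeter

end

open DirichletPerimeter in
theorem proposition5p1 {n : ℕ} (hn : 1 ≤ n) (Ω : Set (Space n)) (hΩ : IsOpen Ω)
    (u : Space n → ℝ) (E : Set (Space n)) (hmin : IsMinimizingPair Ω u E) :
    (∀ r : ℝ, 0 < r → ball (0 : Space n) r ⊆ Ω →
      energy (ball 0 r) u E ≠ ⊤ ∧ ∃ g : Space n → ℝ, HasTrace u r g) ∧
    MonotoneOn (Phi u E) {r : ℝ | 0 < r ∧ ball (0 : Space n) r ⊆ Ω} ∧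
    ∀ R : ℝ, 0 < R → ball (0 : Space n) R ⊆ Ω →
      ((∃ c : ℝ, ∀ r ∈ Ioc 0 R, Phi u E r = c) ↔ IsConeIn R u E) := by
  obtain ⟨p, μ, σ, H⟩ := hmin.1.exists_isRepresented hΩ
  exact ⟨fun r hr hb => ⟨H.energy_ne_top isOpen_ball hb, _, H.hasTrace_trace hn hr hb⟩,
    fun a ha b hb hab => H.Phi_le hn hmin ha.1 hab hb.2,
    fun R hR hb => H.exists_Phi_eq_iff_isConeIn hn hmin hR hb⟩
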